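/- Let $d\ge 1$ and consider the nonlinear AR($d$) model $$Y_t=m(Y_{t-1},\dots,Y_{t-d})+v_t,\quad t=1,\dots,T,\qquad (Y_0,\dots,Y_{-d+1})\sim\nu,\qquad v_t\overset{i.i.d.}{\sim}N(0,1),$$ where $(v_t)$ is independent of the initial vector and $\nu$ is a fixed probability measure on $\mathbb R^d$ with $\int|x|\,\nu(dx)<\infty$. Put $X_t=(Y_{t-1},\dots,Y_{t-d})$ and $f_0=m\mathbf 1_{[0,1]^d}$. **Mean functions.** For $\beta,A>0$, $l<u$ and integers $1\le r\le p$ let $\lfloor\beta\rfloor$ be the largest integer strictly smaller than $\beta$, and let $C_r^\beta([l,u]^p,A)$ be the set of functions $f:[l,u]^p\to\mathbb R$ of class $C^{\lfloor\beta\rfloor}$ that depend on at most $r$ coordinates and satisfy $$\sum_{|\alpha|_1<\beta}\|\partial^\alpha f\|_\infty+\sum_{|\alpha|_1=\lfloor\beta\rfloor}\ \sup_{x\ne y}\frac{|\partial^\alpha f(x)-\partial^\alpha f(y)|}{|x-y|_\infty^{\beta-\lfloor\beta\rfloor}}\le A .$$ Let $q\ge 0$, $\mathbf d=(d_0,\dots,d_{q+1})$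 with $d_0=d$, $d_{q+1}=1$, integers $1\le t_i\le d_i$ and $\beta_i>0$ for $0\le i\le q$, and $A>0$. Let $\mathcal G(q,\mathbf d,\mathbf t,\boldsymbol\beta,A)$ be the set of functions $g_q\circ\dots\circ g_0$ on $[0,1]^d$, where $g_i=(g_{ij})_j:[l_i,u_i]^{d_i}\to[l_{i+1},u_{i+1}]^{d_{i+1}}$ with $g_{ij}\in C_{t_i}^{\beta_i}([l_i,u_i]^{d_i},A)$, $l_i<u_i$, $l_0=0$, $u_0=1$ and $|l_{i+1}|,|u_{i+1}|\le A$. For $\mathbf c=(c_0,\dots,c_d)\in(0,\infty)^{d+1}$ with $\sum_{i=1}^dc_i<1$, let $\mathcal M=\mathcal M(\mathbf c,q,\mathbf d,\mathbf t,\boldsymbol\beta,A)$ be the set of measurable $m:\mathbb R^d\to\mathbb R$ with $|m(x)|\le c_0+\sum_{i=1}^d c_i|x_i|$ for all $x$ and $m|_{[0,1]^d}\in\mathcal G(q,\mathbf d,\mathbf t,\boldsymbol\beta,A)$. Put $$\beta_i^*=\beta_i\prod_{\ell=i+1}^q(\beta_\ell\wedge1),\qquad \phi_T=\max_{0\le i\le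 q}T^{-2\beta_i^*/(2\beta_i^*+t_i)} .$$ **Estimator.** For a ReLU network $f$ with input dimension $d$ and scalar output let $\theta(f)$ be the vector of all its weights and shifts, and for $\tau>0$ let $\|\theta\|_{\mathrm{clip},\tau}=\sum_j(|\theta_j|/\tau\wedge1)$. Let $\mathcal F(L,N,B,F)$ be the class of functions $f\mathbf 1_{[0,1]^d}$, where $f$ is such a network with at least one and at most $L$ hidden layers, of widths at most $N$, with $|\theta(f)|_\infty\le B$ and $\sup_{[0,1]^d}|f|\le F$. Let $F\ge 1\vee A$ and $r>1$ be constants, $L_T\asymp\log^rT$, $N_T\asymp T$, $1\le B_T\le C_BT^{\nu_2}$ for constants $C_B,\nu_2>0$, $\lambda_T=F^2\iota_\lambda(T)\log^{2+r}T/T$ with a strictly increasing function $\iota_\lambda:[1,\infty)\to\mathbb R$ such that $\iota_\lambda(x)/\log x\to\infty$ as $x\to\infty$, and $\tau_T>0$ with $\tau_T(L_T+1)((N_T+1)B_T)^{L_T+1}\le C_\tau T^{-1}$ for a constant $C_\tau>0$. Let $\hat f_T$ be an estimator (a function jointly measurable in the data $\{(X_t,Y_t)\}_{t=1}^T$ and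 the point) that minimizes $$\frac1T\sum_{t=1}^T(Y_t-f(X_t))^2+\lambda_T\|\theta(f)\|_{\mathrm{clip},\tau_T}$$ over $f\in\mathcal F(L_T,N_T,B_T,F)$. **Claim.** With $R(\hat f_T,f_0)=\mathrm E\big[\frac1T\sum_{t=1}^T(\hat f_T(X_t^*)-f_0(X_t^*))^2\big]$, where $\{X^*_t\}$ is a copy of $\{X_t\}$ independent of the data, $$\sup_{m\in\mathcal M}R(\hat f_T,f_0)=O\big(\phi_T\,\iota_\lambda(T)\log^{3+r}T\big)\qquad(T\to\infty).$$ -/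

import Mathlib

open MeasureTheory ProbabilityTheory Filter
open scoped ENNReal

namespace SparseDNN

noncomputable section

/-- The cube `[l, u]^p`. -/
def cube (p : ℕ) (l u : ℝ) : Set (Fin p → ℝ) :=
  Set.Icc (fun _ => l) (fun _ => u)

/-! ### Hölder balls and composition structured functions -/

/-- The partial derivative `∂_j f` on the set `S` (one-sided at the boundary). -/
def coordDeriv {p : ℕ} (S : Set (Fin p → ℝ)) (j : Fin p) (f : (Fin p → ℝ) → ℝ) :
    (Fin p → ℝ) → ℝ :=
  fun x => fderivWithin ℝ f S x (Pi.single j 1)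

/-- The mixed partial derivative `∂^α f = ∂_1^{α_1} ⋯ ∂_p^{α_p} f` on the set `S`. -/
def multiDeriv {p : ℕ} (S : Set (Fin p → ℝ)) (α : Fin p → ℕ) (f : (Fin p → ℝ) → ℝ) :
    (Fin p → ℝ) → ℝ :=
  (List.finRange p).foldr (fun j g => (coordDeriv S j)^[α j] g) f

/-- The largest integer strictly smaller than `β` (for `β > 0`). -/
def strictFloor (β : ℝ) : ℕ := ⌈β⌉₊ - 1

/-- The Hölder norm of order `β` on `[l, u]^p`, with values in `[0, ∞]`:
the sum over `|α| < β` of the sup-norms of `∂^α f`, plus the sum over `|α| = strictFloor β` of the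
Hölder seminorms of `∂^α f` with exponent `β - strictFloor β`, with respect to the maximum norm
(which is the norm of `Fin p → ℝ`). For natural `k`, `k < β` iff `k < ⌈β⌉₊`. -/
def holderNorm {p : ℕ} (β l u : ℝ) (f : (Fin p → ℝ) → ℝ) : ℝ≥0∞ :=
  (∑ k ∈ Finset.range ⌈β⌉₊, ∑ α ∈ Finset.piAntidiag (Finset.univ : Finset (Fin p)) k,
      ⨆ x ∈ cube p l u, ENNReal.ofReal |multiDeriv (cube p l u) α f x|) +
  ∑ α ∈ Finset.piAntidiag (Finset.univ : Finset (Fin p)) (strictFloor β),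
    ⨆ x ∈ cube p l u, ⨆ y ∈ cube p l u, ⨆ _ : x ≠ y,
      ENNReal.ofReal
        (|multiDeriv (cube p l u) α f x - multiDeriv (cube p l u) α f y| /
          ‖x - y‖ ^ (β - (strictFloor β : ℝ)))

/-- The class `C_r^β([l,u]^p, A)`: functions on the cube that depend on at most `r` coordinates,
are `strictFloor β` times continuously differentiable and have Hölder norm at most `A`.
Only the values of `f` on the cube matter. -/
def HolderClass (p r : ℕ) (β l u A : ℝ) (f : (Fin p → ℝ) → ℝ) : Prop :=
  (∃ s : Finset (Fin p), s.card ≤ r ∧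
    ∀ x ∈ cube p l u, ∀ y ∈ cube p l u, (∀ i ∈ s, x i = y i) → f x = f y) ∧
  ContDiffOn ℝ (strictFloor β : ℕ) f (cube p l u) ∧
  holderNorm β l u f ≤ ENNReal.ofReal A

/-- `composeUpTo g n = g_{n-1} ∘ ⋯ ∘ g_0`. -/
def composeUpTo {D : ℕ → ℕ} (g : ∀ i, (Fin (D i) → ℝ) → Fin (D (i + 1)) → ℝ) :
    ∀ n, (Fin (D 0) → ℝ) → Fin (D n) → ℝ
  | 0 => id
  | n + 1 => g n ∘ composeUpTo g n

/-- The restriction of `f` to `[0,1]^d` belongs to `𝒢(q, D, t, β, A)`, where `D 0 = d`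
and `D (q + 1) = 1`. -/
def IsComposition {d : ℕ} (q : ℕ) (D t : ℕ → ℕ) (hD : D 0 = d) (β : ℕ → ℝ) (A : ℝ)
    (f : (Fin d → ℝ) → ℝ) : Prop :=
  ∃ (l u : ℕ → ℝ) (g : ∀ i, (Fin (D i) → ℝ) → Fin (D (i + 1)) → ℝ),
    l 0 = 0 ∧ u 0 = 1 ∧
    (∀ i ≤ q, l i < u i ∧ |l (i + 1)| ≤ A ∧ |u (i + 1)| ≤ A ∧
      Set.MapsTo (g i) (cube (D i) (l i) (u i)) (cube (D (i + 1)) (l (i + 1)) (u (i + 1))) ∧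
      ∀ j, HolderClass (D i) (t i) (β i) (l i) (u i) A (fun x => g i x j)) ∧
    ∀ x ∈ cube d 0 1, ∀ j, f x = composeUpTo g (q + 1) (fun k => x (Fin.cast hD k)) j

/-- The class `ℳ₀(c)` of measurable mean functions of at most linear growth. -/
def linearGrowthClass {d : ℕ} (c₀ : ℝ) (c : Fin d → ℝ) : Set ((Fin d → ℝ) → ℝ) :=
  {m | Measurable m ∧ ∀ x, |m x| ≤ c₀ + ∑ i, c i * |x i|}

/-- The class `ℳ(c, q, D, t, β, A)`. -/
def meanClass {d : ℕ} (c₀ : ℝ) (c : Fin d → ℝ) (q : ℕ) (D t : ℕ → ℕ) (hD : D 0 = d)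
    (β : ℕ → ℝ) (A : ℝ) : Set ((Fin d → ℝ) → ℝ) :=
  {m | m ∈ linearGrowthClass c₀ c ∧ IsComposition q D t hD β A m}

/-- `β_i^* = β_i ∏_{ℓ = i+1}^q (β_ℓ ∧ 1)`. -/
def effSmoothness (q : ℕ) (β : ℕ → ℝ) (i : ℕ) : ℝ :=
  β i * ∏ ℓ ∈ Finset.Ioc i q, min (β ℓ) 1

/-- `φ_T = max_{i = 0, …, q} T^{-2β_i^*/(2β_i^* + t_i)}`. -/
def phiRate (q : ℕ) (t : ℕ → ℕ) (β : ℕ → ℝ) (T : ℕ) : ℝ :=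
  (Finset.range (q + 1)).sup' Finset.nonempty_range_add_one fun i =>
    (T : ℝ) ^ (-(2 * effSmoothness q β i / (2 * effSmoothness q β i + (t i : ℝ))))

/-! ### Deep ReLU networks -/

/-- A feed-forward network with input dimension `p` and scalar output: a number of hidden layers,
each given by a weight matrix and a shift vector, followed by an affine output map. -/
inductive Net : ℕ → Type
  | output {p : ℕ} (w : Fin p → ℝ) (b : ℝ) : Net p
  | hidden {p p' : ℕ} (W : Matrix (Fin p') (Fin p) ℝ) (b : Fin p' → ℝ) (rest : Net p') : Net p

/-- The function computed by a network with ReLU activation. -/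
def Net.eval : {p : ℕ} → Net p → (Fin p → ℝ) → ℝ
  | _, .output w b, x => w ⬝ᵥ x + b
  | _, .hidden W b rest, x => rest.eval (fun i => max ((W.mulVec x + b) i) 0)

/-- The list `p_1, …, p_L` of the widths of the hidden layers. -/
def Net.hiddenWidths : {p : ℕ} → Net p → List ℕ
  | _, .output _ _ => []
  | _, .hidden (p' := p') _ _ rest => p' :: rest.hiddenWidths

/-- The number `L` of hidden layers. -/
def Net.depth {p : ℕ} (f : Net p) : ℕ := f.hiddenWidths.length

/-- The parameter vector `θ(f)` (up to the order of its entries): all the entries, with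
multiplicity, of all weight matrices and shift vectors. -/
def Net.params : {p : ℕ} → Net p → Multiset ℝ
  | _, .output w b => Finset.univ.val.map w + {b}
  | _, .hidden W b rest =>
      Finset.univ.val.map (fun ij : _ × _ => W ij.1 ij.2) + Finset.univ.val.map b + rest.params

/-- The clipped `L₁` norm `∑_j min(|θ_j| / τ, 1)` of the parameter vector. -/
def Net.clipNorm {p : ℕ} (τ : ℝ) (f : Net p) : ℝ :=
  (f.params.map fun θ => min (|θ| / τ) 1).sum

/-- The networks that represent the class `ℱ(L, N, B, F)`: at least one and at most `L` hidden
layers, all of positive width at most `N`, all parameters bounded by `B` in absolute value, and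
sup-norm at most `F` on `[0,1]^d`. -/
def netClass (d : ℕ) (L N B F : ℝ) : Set (Net d) :=
  {f | 1 ≤ f.depth ∧ (f.depth : ℝ) ≤ L ∧
    (∀ w ∈ f.hiddenWidths, 1 ≤ w ∧ (w : ℝ) ≤ N) ∧
    (∀ θ ∈ f.params, |θ| ≤ B) ∧
    ∀ x ∈ cube d 0 1, |f.eval x| ≤ F}

/-- The function `f 𝟏_{[0,1]^d}` computed by a network, cut off outside the unit cube. -/
def Net.toFun {d : ℕ} (f : Net d) : (Fin d → ℝ) → ℝ :=
  (cube d 0 1).indicator f.eval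

/-! ### The sparse-penalized estimator -/

/-- A sample `(X_t, Y_t)`, `t = 1, …, T`. -/
abbrev Sample (d T : ℕ) : Type := Fin T → (Fin d → ℝ) × ℝ

/-- The penalized empirical risk
`(1/T) ∑_t (Y_t - f(X_t))² + lam * ‖θ(f)‖_{clip, τ}`. -/
def penalizedRisk {d T : ℕ} (lam τ : ℝ) (z : Sample d T) (f : Net d) : ℝ :=
  1 / (T : ℝ) * ∑ t, ((z t).2 - f.toFun (z t).1) ^ 2 + lam * f.clipNorm τ

/-- `fhat` is a sparse-penalized estimator over `ℱ(L, N, B, F)`: it is jointly measurable in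
the sample and the point, and for every sample it is the function of a network that minimizes the
penalized empirical risk over the class. -/
def IsSparsePenalizedEstimator {d T : ℕ} (L N B F lam τ : ℝ)
    (fhat : Sample d T → (Fin d → ℝ) → ℝ) : Prop :=
  Measurable (Function.uncurry fhat) ∧
  ∀ z : Sample d T, ∃ f ∈ netClass d L N B F, fhat z = f.toFun ∧
    ∀ f' ∈ netClass d L N B F, penalizedRisk lam τ z f ≤ penalizedRisk lam τ z f'

/-! ### The Gaussian nonlinear AR(d) model -/

/-- `arX m (x, v) s = X_{s+1} = (Y_s, …, Y_{s-d+1})` for the recursion `Y_t = m(X_t) + v_t`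
started at `X_1 = x`; here `v s` is the noise variable at time `s + 1`. -/
def arX {d : ℕ} (m : (Fin d → ℝ) → ℝ) (ω : (Fin d → ℝ) × (ℕ → ℝ)) : ℕ → Fin d → ℝ
  | 0 => ω.1
  | s + 1 => fun k =>
      if k.val = 0 then m (arX m ω s) + ω.2 s
      else arX m ω s ⟨k.val - 1, lt_of_le_of_lt (Nat.sub_le _ _) k.isLt⟩

/-- `arY m (x, v) s = Y_{s+1} = m(X_{s+1}) + v_{s+1}`. -/
def arY {d : ℕ} (m : (Fin d → ℝ) → ℝ) (ω : (Fin d → ℝ) × (ℕ → ℝ)) (s : ℕ) : ℝ :=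
  m (arX m ω s) + ω.2 s

/-- The observations `(X_t, Y_t)`, `t = 1, …, T`. -/
def arSample {d : ℕ} (m : (Fin d → ℝ) → ℝ) (T : ℕ) (ω : (Fin d → ℝ) × (ℕ → ℝ)) : Sample d T :=
  fun t => (arX m ω t, arY m ω t)

/-- The joint law of the initial vector, distributed as `ν`, and of an independent i.i.d.
standard normal noise sequence. -/
def arLaw {d : ℕ} (ν : Measure (Fin d → ℝ)) : Measure ((Fin d → ℝ) × (ℕ → ℝ)) :=
  ν.prod (Measure.infinitePi fun _ : ℕ => gaussianReal 0 1)

/-- The generalization error `E[(1/T) ∑_t (fhat(X_t^*) - f₀(X_t^*))²]` with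
`f₀ = m 𝟏_{[0,1]^d}`, where `fhat` is computed from the observations of one copy of the process and
`X^*` is an independent copy. -/
def genError {d : ℕ} (ν : Measure (Fin d → ℝ)) (m : (Fin d → ℝ) → ℝ) (T : ℕ)
    (fhat : Sample d T → (Fin d → ℝ) → ℝ) : ℝ≥0∞ :=
  ∫⁻ ω : ((Fin d → ℝ) × (ℕ → ℝ)) × ((Fin d → ℝ) × (ℕ → ℝ)),
    ENNReal.ofReal (1 / (T : ℝ) * ∑ t : Fin T,
      (fhat (arSample m T ω.1) (arX m ω.2 t) -
        (cube d 0 1).indicator m (arX m ω.2 t)) ^ 2) ∂((arLaw ν).prod (arLaw ν))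

/-- `a_T ≍ b_T` as `T → ∞`, for positive sequences. -/
def SameOrder (a b : ℕ → ℝ) : Prop :=
  ∃ C₁ C₂ : ℝ, 0 < C₁ ∧ 0 < C₂ ∧ ∀ᶠ T in atTop, C₁ * b T ≤ a T ∧ a T ≤ C₂ * b T

end

end SparseDNN

open SparseDNN

/-! Write h for the difference of a network function and m, cut off outside the unit cube. The
yardstick throughout is the integral of h² over the cube with respect to Lebesgue measure. Since the
noise is standard normal, every one-step density is at most one and so is the d-step density; hence
the error on the independent copy is at most that integral, up to the first d times (`genError_le`).
Conversely, from a fixed ball the d-step density is at least κ^d on the cube, and linear growth with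
∑ c_i < 1 forces a fixed fraction of the block starts k d into such a ball, outside an event of
probability O(1/T) (`exists_radius`, `measure_compl_goodEvent_le`). No stationarity or mixing rate
enters, and all constants depend on the class only, not on m.

The stochastic core is one exponential moment. For fixed h bounded by H, the quantity `excess`,
which is b n ∫ h² - ∑ h(X_s)² + 2 ∑ v_s h(X_s), satisfies E exp(excess / (8 H²)) ≤ 1 on the good
event (`lintegral_exp_excess_le_one`). It combines the Gaussian exponential martingale with a bound
for blocks of length d.

To pass from fixed h to the estimator, the networks are quantized, parameters of size at most τ
being set to zero. A quantized network gets the weight exp(-K) for each nonzero parameter, times a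
normalization exp(-K₀). The sum over all networks factorizes into sums over single parameters, so K
and K₀ of order log^(1+r) T make the total weight at most one (`exists_covering_family`,
`exists_covering_parameters`). The weight of a quantized network is at least exp(-K clipNorm - K₀),
so the penalty pays for the selection as soon as K is at most a constant times T lam_T / F²; the
growth of ι guarantees this. Together with the minimizing property this gives the oracle inequality
`genError_le_of_family`, where the elementary bound 1 + z ≤ exp z replaces tail estimates.

It remains to exhibit one sparse network close to m. On each layer of the composition, local Taylor
polynomials are glued by a piecewise linear partition of unity on a dyadic grid in the relevant
coordinates; products come from sawtooth functions (`exists_makes_locPoly`). Errors of inner layers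
are passed on through Hölder continuity with exponent β ∧ 1, which produces the effective smoothness
β*. Weights are brought below one by rescaling, undone by doublings at the output. The result
(`exists_net_phiRate`) has error O(√φ_T) and O(T φ_T log T) nonzero parameters, so its penalty is of
order φ_T ι(T) log^(3+r) T, which dominates all other terms. -/

namespace SparseDNN

/-! ### The autoregressive process as a Markov chain -/

/-- The standard normal noise sequence. -/
noncomputable abbrev noiseLaw : Measure (ℕ → ℝ) :=
  Measure.infinitePi fun _ : ℕ => gaussianReal 0 1

/-- The sequence with first entry `a`, followed by `v`. -/
def consSeq (a : ℝ) (v : ℕ → ℝ) : ℕ → ℝ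
  | 0 => a
  | n + 1 => v n

lemma measurable_consSeq : Measurable fun z : ℝ × (ℕ → ℝ) => consSeq z.1 z.2 := by
  refine measurable_pi_lambda _ fun n => ?_
  cases n with
  | zero => exact measurable_fst
  | succ n => exact (measurable_pi_apply n).comp measurable_snd

/-- A product measure is determined by finite cylinders, on which prepending an independent factor
only shifts the index set. This lets inductions on time peel off the first noise variable instead of
using conditional expectations. -/
lemma map_consSeq_noiseLaw :
    ((gaussianReal 0 1).prod noiseLaw).map (fun z : ℝ × (ℕ → ℝ) => consSeq z.1 z.2) =
      noiseLaw := by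
  classical
  refine Measure.eq_infinitePi _ fun s t ht => ?_
  rw [Measure.map_apply measurable_consSeq (MeasurableSet.pi s.countable_toSet fun i _ => ht i)]
  set s' : Finset ℕ := (s.erase 0).image Nat.pred with hs'
  have hmem : ∀ n, n ∈ s' ↔ n + 1 ∈ s := by
    intro n
    simp only [hs', Finset.mem_image, Finset.mem_erase]
    constructor
    · rintro ⟨a, ⟨ha, has⟩, rfl⟩
      rwa [Nat.pred_eq_sub_one, Nat.sub_add_cancel (Nat.one_le_iff_ne_zero.2 ha)]
    · intro h
      exact ⟨n + 1, ⟨Nat.succ_ne_zero n, h⟩, rfl⟩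
  have hpre : (fun z : ℝ × (ℕ → ℝ) => consSeq z.1 z.2) ⁻¹' (Set.pi s t) =
      (if 0 ∈ s then t 0 else Set.univ) ×ˢ (Set.pi s' fun n => t (n + 1)) := by
    ext ⟨a, v⟩
    simp only [Set.mem_preimage, Set.mem_pi, Finset.mem_coe, Set.mem_prod]
    constructor
    · intro h
      refine ⟨?_, fun n hn => h (n + 1) ((hmem n).1 hn)⟩
      split_ifs with h0
      · exact h 0 h0
      · trivial
    · rintro ⟨h0, h1⟩ n hn
      cases n with
      | zero =>
        rw [if_pos hn] at h0
        exact h0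
      | succ n => exact h1 n ((hmem n).2 hn)
  rw [hpre, Measure.prod_prod, Measure.infinitePi_pi _ fun i _ => ht (i + 1)]
  have hprod : ∏ i ∈ s', gaussianReal 0 1 (t (i + 1)) =
      ∏ i ∈ s.erase 0, gaussianReal 0 1 (t i) := by
    rw [hs', Finset.prod_image]
    · refine Finset.prod_congr rfl fun i hi => ?_
      rw [Nat.pred_eq_sub_one, Nat.sub_add_cancel (Nat.one_le_iff_ne_zero.2 (Finset.ne_of_mem_erase hi))]
    · intro a ha b hb hab
      have ha' := Finset.ne_of_mem_erase ha
      have hb' := Finset.ne_of_mem_erase hb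
      simp only [Nat.pred_eq_sub_one] at hab
      omega
  rw [hprod]
  split_ifs with h0
  · exact Finset.mul_prod_erase s (fun i => gaussianReal 0 1 (t i)) h0
  · rw [Finset.erase_eq_of_notMem h0, measure_univ, one_mul]

lemma lintegral_noiseLaw {Φ : (ℕ → ℝ) → ℝ≥0∞} (hΦ : Measurable Φ) :
    ∫⁻ v, Φ v ∂noiseLaw = ∫⁻ a, ∫⁻ v, Φ (consSeq a v) ∂noiseLaw ∂(gaussianReal 0 1) := by
  conv_lhs => rw [← map_consSeq_noiseLaw]
  rw [lintegral_map hΦ measurable_consSeq]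
  exact lintegral_prod (fun z : ℝ × (ℕ → ℝ) => Φ (consSeq z.1 z.2))
    (hΦ.comp measurable_consSeq).aemeasurable

section Chain

variable {d : ℕ} {m : (Fin d → ℝ) → ℝ}

/-- Shift the coordinates of `x` by one and insert `y` in front. -/
def pushFront (y : ℝ) (x : Fin d → ℝ) : Fin d → ℝ := fun k =>
  if k.val = 0 then y else x ⟨k.val - 1, lt_of_le_of_lt (Nat.sub_le _ _) k.isLt⟩

lemma measurable_pushFront : Measurable fun z : ℝ × (Fin d → ℝ) => pushFront z.1 z.2 := by
  refine measurable_pi_lambda _ fun k => ?_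
  unfold pushFront
  split_ifs
  · exact measurable_fst
  · exact (measurable_pi_apply _).comp measurable_snd

lemma norm_pushFront_le {y R : ℝ} {x : Fin d → ℝ} (hy : |y| ≤ R) (hx : ‖x‖ ≤ R) :
    ‖pushFront y x‖ ≤ R := by
  refine (pi_norm_le_iff_of_nonneg ((abs_nonneg y).trans hy)).2 fun k => ?_
  unfold pushFront
  split_ifs
  · exact hy
  · exact (norm_le_pi_norm x _).trans hx

lemma arX_succ (ω : (Fin d → ℝ) × (ℕ → ℝ)) (s : ℕ) :
    arX m ω (s + 1) = pushFront (m (arX m ω s) + ω.2 s) (arX m ω s) := rfl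

lemma arX_add (x : Fin d → ℝ) (v : ℕ → ℝ) (n s : ℕ) :
    arX m (x, v) (n + s) = arX m (arX m (x, v) n, fun i => v (n + i)) s := by
  induction s with
  | zero => rfl
  | succ s ih => rw [← add_assoc, arX_succ, arX_succ, ih]

lemma arX_consSeq (x : Fin d → ℝ) (a : ℝ) (v : ℕ → ℝ) (s : ℕ) :
    arX m (x, consSeq a v) (s + 1) = arX m (pushFront (m x + a) x, v) s := by
  rw [add_comm s 1, arX_add]
  congr 2
  funext i
  rw [add_comm 1 i]
  rfl

lemma measurable_arX (hm : Measurable m) (s : ℕ) :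
    Measurable fun ω : (Fin d → ℝ) × (ℕ → ℝ) => arX m ω s := by
  induction s with
  | zero => exact measurable_fst
  | succ s ih =>
    exact measurable_pushFront.comp
      (((hm.comp ih).add ((measurable_pi_apply s).comp measurable_snd)).prodMk ih)

lemma measurable_arX_right (hm : Measurable m) (x : Fin d → ℝ) (s : ℕ) :
    Measurable fun v : ℕ → ℝ => arX m (x, v) s :=
  (measurable_arX hm s).comp measurable_prodMk_left

lemma measurable_arSample (hm : Measurable m) (T : ℕ) :
    Measurable fun ω : (Fin d → ℝ) × (ℕ → ℝ) => arSample m T ω := by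
  refine measurable_pi_lambda _ fun t => ?_
  exact (measurable_arX hm t).prodMk
    ((hm.comp (measurable_arX hm t)).add ((measurable_pi_apply (t : ℕ)).comp measurable_snd))

/-- The Markov property at time `n`. -/
lemma lintegral_markov (hm : Measurable m) (n : ℕ) (x : Fin d → ℝ)
    {H : (Fin d → ℝ) × (Fin d → ℝ) × (ℕ → ℝ) → ℝ≥0∞} (hH : Measurable H) :
    ∫⁻ v, H (x, arX m (x, v) n, fun i => v (n + i)) ∂noiseLaw =
      ∫⁻ v, ∫⁻ v', H (x, arX m (x, v) n, v') ∂noiseLaw ∂noiseLaw := by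
  induction n generalizing x H with
  | zero => simp [arX]
  | succ n ih =>
    have hshift : Measurable fun v : ℕ → ℝ => fun i => v (n + 1 + i) :=
      measurable_pi_lambda _ fun i => measurable_pi_apply _
    rw [lintegral_noiseLaw (Φ := fun v => H (x, arX m (x, v) (n + 1), fun i => v (n + 1 + i)))
      (hH.comp (measurable_const.prodMk ((measurable_arX_right hm x (n + 1)).prodMk hshift)))]
    rw [lintegral_noiseLaw (Φ := fun v => ∫⁻ v', H (x, arX m (x, v) (n + 1), v') ∂noiseLaw)]
    · refine lintegral_congr fun a => ?_
      -- The chain restarts from the state after one step, while the first argument of H must stay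
      -- at the original x; it is therefore frozen before the induction hypothesis is applied.
      have hH' : Measurable fun z : (Fin d → ℝ) × (Fin d → ℝ) × (ℕ → ℝ) => H (x, z.2) :=
        hH.comp (measurable_const.prodMk measurable_snd)
      have := ih (pushFront (m x + a) x) hH'
      simp only [arX_consSeq]
      rw [← this]
      refine lintegral_congr fun v => ?_
      have hs : (fun i => consSeq a v (n + 1 + i)) = fun i => v (n + i) := by
        funext i
        rw [Nat.add_right_comm]
        rfl
      rw [hs]
    · have h1 : Measurable fun z : (ℕ → ℝ) × (ℕ → ℝ) => H (x, arX m (x, z.1) (n + 1), z.2) :=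
        hH.comp (measurable_const.prodMk
          (((measurable_arX_right hm x (n + 1)).comp measurable_fst).prodMk measurable_snd))
      exact h1.lintegral_prod_right'

/-- If every one-step exponential moment is at most one, so is that of the sum. -/
lemma lintegral_exp_sum_le_one (hm : Measurable m) {ψ : (Fin d → ℝ) → ℝ → ℝ}
    (hψ : Measurable (Function.uncurry ψ))
    (h : ∀ x, ∫⁻ a, ENNReal.ofReal (Real.exp (ψ x a)) ∂(gaussianReal 0 1) ≤ 1)
    (n : ℕ) (x : Fin d → ℝ) :
    ∫⁻ v, ENNReal.ofReal (Real.exp (∑ s ∈ Finset.range n, ψ (arX m (x, v) s) (v s))) ∂noiseLaw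
      ≤ 1 := by
  induction n generalizing x with
  | zero => simp
  | succ n ih =>
    have hmeas : Measurable fun v : ℕ → ℝ => ENNReal.ofReal
        (Real.exp (∑ s ∈ Finset.range (n + 1), ψ (arX m (x, v) s) (v s))) := by
      refine (Real.measurable_exp.comp (Finset.measurable_sum _ fun s _ => ?_)).ennreal_ofReal
      exact hψ.comp ((measurable_arX_right hm x s).prodMk (measurable_pi_apply s))
    rw [lintegral_noiseLaw hmeas]
    refine le_trans (lintegral_mono fun a => ?_) (h x)
    simp only [Finset.sum_range_succ', arX_consSeq]
    have : ∀ v, ENNReal.ofReal (Real.exp (∑ s ∈ Finset.range n,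
        ψ (arX m (pushFront (m x + a) x, v) s) (consSeq a v (s + 1)) +
          ψ (arX m (x, consSeq a v) 0) (consSeq a v 0))) =
        ENNReal.ofReal (Real.exp (ψ x a)) * ENNReal.ofReal (Real.exp (∑ s ∈ Finset.range n,
          ψ (arX m (pushFront (m x + a) x, v) s) (v s))) := by
      intro v
      rw [← ENNReal.ofReal_mul (Real.exp_pos _).le, ← Real.exp_add, add_comm]
      rfl
    simp only [this]
    rw [lintegral_const_mul']
    · exact mul_le_of_le_one_right' (ih _)
    · exact ENNReal.ofReal_ne_top

/-- The same for blocks of `k₀` consecutive steps. -/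
lemma lintegral_exp_block_sum_le_one (hm : Measurable m) (k₀ : ℕ)
    {φ : (Fin d → ℝ) → (Fin d → ℝ) → ℝ} (hφ : Measurable (Function.uncurry φ))
    (h : ∀ x, ∫⁻ v, ENNReal.ofReal (Real.exp (φ x (arX m (x, v) k₀))) ∂noiseLaw ≤ 1)
    (n : ℕ) (x : Fin d → ℝ) :
    ∫⁻ v, ENNReal.ofReal (Real.exp (∑ k ∈ Finset.range n,
      φ (arX m (x, v) (k * k₀)) (arX m (x, v) ((k + 1) * k₀)))) ∂noiseLaw ≤ 1 := by
  induction n generalizing x with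
  | zero => simp
  | succ n ih =>
    set H : (Fin d → ℝ) × (Fin d → ℝ) × (ℕ → ℝ) → ℝ≥0∞ := fun z =>
      ENNReal.ofReal (Real.exp (φ z.1 z.2.1)) * ENNReal.ofReal (Real.exp (∑ k ∈ Finset.range n,
        φ (arX m z.2 (k * k₀)) (arX m z.2 ((k + 1) * k₀)))) with hHdef
    have hH : Measurable H := by
      refine Measurable.mul (M := ℝ≥0∞) ?_ ?_
      · exact (Real.measurable_exp.comp (hφ.comp
          (measurable_fst.prodMk (measurable_fst.comp measurable_snd)))).ennreal_ofReal
      · refine (Real.measurable_exp.comp (Finset.measurable_sum _ fun k _ => ?_)).ennreal_ofReal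
        exact hφ.comp (((measurable_arX hm _).comp measurable_snd).prodMk
          ((measurable_arX hm _).comp measurable_snd))
    have key : ∀ v : ℕ → ℝ, ENNReal.ofReal (Real.exp (∑ k ∈ Finset.range (n + 1),
        φ (arX m (x, v) (k * k₀)) (arX m (x, v) ((k + 1) * k₀)))) =
        H (x, arX m (x, v) k₀, fun i => v (k₀ + i)) := by
      intro v
      simp only [hHdef]
      rw [← ENNReal.ofReal_mul (Real.exp_pos _).le, ← Real.exp_add, Finset.sum_range_succ', add_comm]
      congr 3
      · simp [arX]
      · refine Finset.sum_congr rfl fun k _ => ?_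
        rw [show (k + 1) * k₀ = k₀ + k * k₀ by ring, show (k + 1 + 1) * k₀ = k₀ + (k₀ + k * k₀) by ring,
          ← arX_add, ← arX_add]
    simp only [key]
    rw [lintegral_markov hm k₀ x hH]
    refine le_trans (lintegral_mono fun v => ?_) (h x)
    simp only [hHdef]
    rw [lintegral_const_mul' _ _ ENNReal.ofReal_ne_top]
    exact mul_le_of_le_one_right' (ih _)

/-! ### Transition densities -/

lemma lintegral_gaussianReal_const_add {φ : ℝ → ℝ≥0∞} (hφ : Measurable φ) (c : ℝ) :
    ∫⁻ a, φ (c + a) ∂(gaussianReal 0 1) = ∫⁻ y, gaussianPDF c 1 y * φ y := by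
  have h := gaussianReal_map_const_add (μ := 0) (v := 1) c
  rw [zero_add] at h
  rw [← lintegral_map (f := φ) (g := fun a => c + a) hφ (measurable_const_add c), h,
    gaussianReal_of_var_ne_zero _ one_ne_zero,
    lintegral_withDensity_eq_lintegral_mul _ (measurable_gaussianPDF c 1) hφ]
  rfl

lemma gaussianPDF_le_one (c y : ℝ) : gaussianPDF c 1 y ≤ 1 := by
  rw [gaussianPDF_def]
  refine ENNReal.ofReal_le_one.2 ?_
  rw [gaussianPDFReal_def]
  have h1 : (1 : ℝ) ≤ √(2 * Real.pi * ((1 : NNReal) : ℝ)) := by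
    rw [Real.one_le_sqrt]
    simp only [NNReal.coe_one, mul_one]
    linarith [Real.pi_gt_three]
  have h2 : Real.exp (-(y - c) ^ 2 / (2 * ((1 : NNReal) : ℝ))) ≤ 1 := by
    rw [Real.exp_le_one_iff]
    simp only [NNReal.coe_one, mul_one]
    nlinarith [sq_nonneg (y - c)]
  exact mul_le_one₀ (inv_le_one_of_one_le₀ h1) (Real.exp_pos _).le h2

/-- Insert the entries of `y` in front one after the other. -/
def pushAll : (n : ℕ) → (Fin n → ℝ) → (Fin d → ℝ) → (Fin d → ℝ)
  | 0, _, x => x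
  | n + 1, y, x => pushAll n (Fin.tail y) (pushFront (y 0) x)

lemma measurable_pushAll (n : ℕ) :
    Measurable fun z : (Fin n → ℝ) × (Fin d → ℝ) => pushAll n z.1 z.2 := by
  induction n with
  | zero => exact measurable_snd
  | succ n ih =>
    refine ih.comp (Measurable.prodMk ?_ ?_)
    · exact measurable_pi_lambda _ fun i => (measurable_pi_apply i.succ).comp measurable_fst
    · have h0 : Measurable fun z : (Fin (n + 1) → ℝ) × (Fin d → ℝ) => (z.1 0, z.2) :=
        ((measurable_pi_apply 0).comp measurable_fst).prodMk measurable_snd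
      exact measurable_pushFront.comp h0

lemma lintegral_fin_succ {n : ℕ} {G : (Fin (n + 1) → ℝ) → ℝ≥0∞} (hG : Measurable G) :
    ∫⁻ y, G y = ∫⁻ a : ℝ, ∫⁻ y : Fin n → ℝ, G (Fin.cons a y) := by
  have h := (volume_preserving_piFinSuccAbove (fun _ : Fin (n + 1) => ℝ) 0).symm
  rw [← h.lintegral_comp hG, Measure.volume_eq_prod]
  refine (lintegral_prod (μ := volume) (ν := volume) (fun z : ℝ × (Fin n → ℝ) => G ((MeasurableEquiv.piFinSuccAbove (fun _ => ℝ) 0).symm z))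
    (hG.comp h.measurable).aemeasurable).trans ?_
  simp [MeasurableEquiv.piFinSuccAbove, Fin.insertNthEquiv]

lemma lintegral_fin_succ_pushAll {G : (Fin d → ℝ) → ℝ≥0∞} (hG : Measurable G) (n : ℕ)
    (x : Fin d → ℝ) : ∫⁻ y : Fin (n + 1) → ℝ, G (pushAll (n + 1) y x) =
      ∫⁻ a : ℝ, ∫⁻ y : Fin n → ℝ, G (pushAll n y (pushFront a x)) := by
  exact lintegral_fin_succ (G := fun y => G (pushAll (n + 1) y x))
    (hG.comp ((measurable_pushAll (n + 1)).comp measurable_prodMk_right))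

lemma lintegral_arX_succ (hm : Measurable m) {G : (Fin d → ℝ) → ℝ≥0∞} (hG : Measurable G) (n : ℕ)
    (x : Fin d → ℝ) : ∫⁻ v, G (arX m (x, v) (n + 1)) ∂noiseLaw =
      ∫⁻ y, gaussianPDF (m x) 1 y * ∫⁻ v, G (arX m (pushFront y x, v) n) ∂noiseLaw := by
  rw [lintegral_noiseLaw (Φ := fun v => G (arX m (x, v) (n + 1)))
    (hG.comp (measurable_arX_right hm x (n + 1)))]
  simp only [arX_consSeq]
  refine lintegral_gaussianReal_const_add
    (φ := fun y => ∫⁻ v, G (arX m (pushFront y x, v) n) ∂noiseLaw) ?_ (m x)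
  have h : Measurable fun z : ℝ × (ℕ → ℝ) => G (arX m (pushFront z.1 x, z.2) n) :=
    hG.comp ((measurable_arX hm n).comp
      ((measurable_pushFront.comp (measurable_fst.prodMk measurable_const)).prodMk measurable_snd))
  exact h.lintegral_prod_right'

/-- The entries of y are the successive values of Y; the Gaussian density of each of them is at most
one and is simply dropped. -/
lemma lintegral_arX_le_pushAll (hm : Measurable m) {G : (Fin d → ℝ) → ℝ≥0∞} (hG : Measurable G)
    (n : ℕ) (x : Fin d → ℝ) :
    ∫⁻ v, G (arX m (x, v) n) ∂noiseLaw ≤ ∫⁻ y : Fin n → ℝ, G (pushAll n y x) := by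
  induction n generalizing x with
  | zero => simp [arX, pushAll, volume_pi]
  | succ n ih =>
    rw [lintegral_arX_succ hm hG, lintegral_fin_succ_pushAll hG]
    exact lintegral_mono fun y => (mul_le_of_le_one_left' (gaussianPDF_le_one _ _)).trans (ih _)

lemma pushAll_apply (n : ℕ) (y : Fin n → ℝ) (x : Fin d → ℝ) (k : Fin d) (hk : k.val < n) :
    pushAll n y x k = y ⟨n - 1 - k.val, by omega⟩ := by
  induction n generalizing x with
  | zero => omega
  | succ n ih =>
    rw [pushAll]
    -- After n insertions the old coordinates survive, moved by n places. This is needed for k = n,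
    -- where the entry inserted first has just reached position k.
    have aux : ∀ (n : ℕ) (y : Fin n → ℝ) (x : Fin d → ℝ) (k : Fin d) (hk : n ≤ k.val),
        pushAll n y x k = x ⟨k.val - n, by omega⟩ := by
      intro n
      induction n with
      | zero => intro y x k _; rfl
      | succ n ihn =>
        intro y x k hk
        rw [pushAll, ihn _ _ _ (by omega), pushFront, if_neg (by simp; omega)]
        congr 1
    rcases Nat.lt_or_ge k.val n with h | h
    · rw [ih _ _ h, Fin.tail]
      congr 1
      ext
      simp
      omega
    · rw [aux n _ _ _ h, pushFront, if_pos (by simp; omega)]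
      congr 1
      ext
      simp
      omega

lemma pushAll_self (y x : Fin d → ℝ) : pushAll d y x = fun k => y (Fin.rev k) := by
  funext k
  rw [pushAll_apply d y x k k.isLt]
  congr 1
  ext
  simp [Fin.val_rev]
  omega

/-- After d insertions the starting state is forgotten and only the order of the entries is
reversed, which preserves Lebesgue measure. -/
lemma lintegral_pushAll_self {G : (Fin d → ℝ) → ℝ≥0∞} (hG : Measurable G) (x : Fin d → ℝ) :
    ∫⁻ y : Fin d → ℝ, G (pushAll d y x) = ∫⁻ y, G y := by
  simp only [pushAll_self]
  have h := volume_measurePreserving_piCongrLeft (fun _ : Fin d => ℝ) Fin.revPerm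
  rw [← h.lintegral_comp hG]
  refine lintegral_congr fun y => ?_
  congr 1
  funext k
  have := Equiv.piCongrLeft_apply_apply (fun _ : Fin d => ℝ) Fin.revPerm y (Fin.rev k)
  simp only [Fin.revPerm_apply, Fin.rev_rev] at this
  exact this.symm

/-- After `d` steps the transition density is at most one. -/
lemma lintegral_arX_le (hm : Measurable m) {G : (Fin d → ℝ) → ℝ≥0∞} (hG : Measurable G)
    (n : ℕ) (hn : d ≤ n) (x : Fin d → ℝ) :
    ∫⁻ v, G (arX m (x, v) n) ∂noiseLaw ≤ ∫⁻ y, G y := by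
  obtain ⟨j, rfl⟩ := Nat.exists_eq_add_of_le' hn
  -- Only the last d of the n = j + d steps matter: by the Markov property at time j, the bound for
  -- d steps is applied from a random starting state.
  have hH : Measurable fun z : (Fin d → ℝ) × (Fin d → ℝ) × (ℕ → ℝ) => G (arX m z.2 d) :=
    hG.comp ((measurable_arX hm d).comp measurable_snd)
  have h := lintegral_markov hm j x hH
  simp only [← arX_add] at h
  rw [h]
  calc _ ≤ ∫⁻ _, (∫⁻ y, G y) ∂noiseLaw := lintegral_mono fun v =>
        (lintegral_arX_le_pushAll hm hG d _).trans (lintegral_pushAll_self hG _).le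
    _ = _ := by simp

/-- Started in a ball, the `d`-step transition density is bounded below on the unit cube. -/
lemma le_lintegral_arX (hm : Measurable m) {G : (Fin d → ℝ) → ℝ≥0∞} (hG : Measurable G)
    {R : ℝ} (hR : 1 ≤ R) {κ : ℝ≥0∞} (hκ' : κ ≠ ⊤)
    (hκ : ∀ x, ‖x‖ ≤ R → ∀ y ∈ Set.Icc (0 : ℝ) 1, κ ≤ gaussianPDF (m x) 1 y)
    (n : ℕ) (x : Fin d → ℝ) (hx : ‖x‖ ≤ R) :
    κ ^ n * ∫⁻ y : Fin n → ℝ, (Set.Icc 0 1).indicator (fun y => G (pushAll n y x)) y ≤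
      ∫⁻ v, G (arX m (x, v) n) ∂noiseLaw := by
  induction n generalizing x with
  | zero => 
    simp only [pow_zero, one_mul, arX, pushAll, lintegral_const, measure_univ, mul_one]
    refine (lintegral_mono (Set.indicator_le_self _ _)).trans ?_
    simp [volume_pi]
  | succ n ih =>
    have hmeas : Measurable fun y : Fin (n + 1) → ℝ => G (pushAll (n + 1) y x) :=
      hG.comp ((measurable_pushAll (n + 1)).comp measurable_prodMk_right)
    rw [lintegral_arX_succ hm hG, lintegral_fin_succ (hmeas.indicator measurableSet_Icc),
      pow_succ', mul_assoc, ← lintegral_const_mul' _ _ (ENNReal.pow_ne_top hκ'),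
      ← lintegral_const_mul' _ _ hκ']
    · refine lintegral_mono fun a => ?_
      by_cases ha : a ∈ Set.Icc (0 : ℝ) 1
      -- An inserted value in [0, 1] keeps the state in the ball of radius R because 1 ≤ R, so the
      -- lower bound κ is available again at the next step.
      · refine mul_le_mul' (hκ x hx a ha) (le_trans (mul_le_mul_right (lintegral_mono fun y => ?_) _)
          (ih (pushFront a x) (norm_pushFront_le ?_ hx)))
        · by_cases hy : (Fin.cons a y : Fin (n + 1) → ℝ) ∈ Set.Icc (0 : Fin (n + 1) → ℝ) 1
          · have hy' : y ∈ Set.Icc (0 : Fin n → ℝ) 1 :=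
              ⟨fun i => by simpa using hy.1 i.succ, fun i => by simpa using hy.2 i.succ⟩
            rw [Set.indicator_of_mem hy, Set.indicator_of_mem hy']
            exact le_of_eq rfl
          · rw [Set.indicator_of_notMem hy]
            exact zero_le
        · rw [abs_of_nonneg ha.1]
          exact ha.2.trans hR
      · have : ∀ y : Fin n → ℝ, (Fin.cons a y : Fin (n + 1) → ℝ) ∉ Set.Icc (0 : Fin (n + 1) → ℝ) 1 :=
          fun y hy => ha ⟨by simpa using hy.1 0, by simpa using hy.2 0⟩
        simp [this]

end Chain

end SparseDNN

namespace SparseDNN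

/-! ### Exponential inequalities for the process -/

lemma lintegral_exp_gaussian (b : ℝ) :
    ∫⁻ a, ENNReal.ofReal (Real.exp (b * a - b ^ 2 / 2)) ∂(gaussianReal 0 1) ≤ 1 := by
  have hint := integrable_exp_mul_gaussianReal (μ := 0) (v := 1) b
  have hmgf : ∫ a, Real.exp (b * a) ∂(gaussianReal 0 1) = Real.exp (b ^ 2 / 2) := by
    have := congrFun (mgf_id_gaussianReal (μ := 0) (v := 1)) b
    simpa [mgf] using this
  have h1 : ∀ a, Real.exp (b * a - b ^ 2 / 2) = Real.exp (b * a) * Real.exp (-(b ^ 2 / 2)) :=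
    fun a => by rw [← Real.exp_add]; rfl
  simp only [h1]
  rw [← ofReal_integral_eq_lintegral_ofReal (hint.mul_const _)
    (ae_of_all _ fun a => by positivity), integral_mul_const, hmgf, ← Real.exp_add]
  simp

/-- Bounding exp |a| by exp a + exp (-a), the claim reduces to the Gaussian moments at 1 and -1 and
to exp(-3/2) ≤ 1/2. The centering 2 is not optimal; it only makes the noise sum at most 3n with high
probability. -/
lemma lintegral_exp_abs_gaussian :
    ∫⁻ a, ENNReal.ofReal (Real.exp (|a| - 2)) ∂(gaussianReal 0 1) ≤ 1 := by
  have h1 := lintegral_exp_gaussian 1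
  have h2 := lintegral_exp_gaussian (-1)
  have h3 : Real.exp (-(3 / 2) : ℝ) ≤ 1 / 2 := by
    rw [Real.exp_neg, inv_le_comm₀ (Real.exp_pos _) (by norm_num)]
    have := Real.add_one_le_exp (3 / 2 : ℝ)
    norm_num at this ⊢
    linarith
  have hm : ∀ b : ℝ, Measurable fun a : ℝ => ENNReal.ofReal (Real.exp (b * a - b ^ 2 / 2)) :=
    fun b => by fun_prop
  calc ∫⁻ a, ENNReal.ofReal (Real.exp (|a| - 2)) ∂(gaussianReal 0 1)
      ≤ ∫⁻ a, ENNReal.ofReal (1 / 2) * (ENNReal.ofReal (Real.exp (1 * a - 1 ^ 2 / 2)) +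
          ENNReal.ofReal (Real.exp (-1 * a - (-1) ^ 2 / 2))) ∂(gaussianReal 0 1) := by
        refine lintegral_mono fun a => ?_
        rw [← ENNReal.ofReal_add (Real.exp_pos _).le (Real.exp_pos _).le,
          ← ENNReal.ofReal_mul (by norm_num)]
        refine ENNReal.ofReal_le_ofReal ?_
        have e1 : ∀ y : ℝ, Real.exp (y - 2) ≤ 1 / 2 * Real.exp (y - 1 / 2) := fun y => by
          rw [show y - 2 = -(3 / 2) + (y - 1 / 2) by ring, Real.exp_add]
          exact mul_le_mul_of_nonneg_right h3 (Real.exp_pos _).le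
        have p1 := Real.exp_pos (1 * a - 1 ^ 2 / 2)
        have p2 := Real.exp_pos (-1 * a - (-1) ^ 2 / 2)
        rcases abs_cases a with ⟨h, _⟩ | ⟨h, _⟩
        · rw [h]
          have := e1 a
          rw [show (1 : ℝ) * a - 1 ^ 2 / 2 = a - 1 / 2 by ring] at *
          linarith
        · rw [h]
          have := e1 (-a)
          rw [show (-1 : ℝ) * a - (-1) ^ 2 / 2 = -a - 1 / 2 by ring] at *
          linarith
    _ = ENNReal.ofReal (1 / 2) * (∫⁻ a, ENNReal.ofReal (Real.exp (1 * a - 1 ^ 2 / 2)) ∂(gaussianReal 0 1)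
        + ∫⁻ a, ENNReal.ofReal (Real.exp (-1 * a - (-1) ^ 2 / 2)) ∂(gaussianReal 0 1)) := by
        rw [lintegral_const_mul' _ _ ENNReal.ofReal_ne_top, lintegral_add_left (hm 1)]
    _ ≤ ENNReal.ofReal (1 / 2) * (1 + 1) := by gcongr
    _ = 1 := by
        rw [one_add_one_eq_two, ← ENNReal.ofReal_ofNat, ← ENNReal.ofReal_mul (by norm_num)]
        norm_num

section

variable {d : ℕ} {m : (Fin d → ℝ) → ℝ}

lemma lintegral_arLaw (ν : Measure (Fin d → ℝ)) [IsProbabilityMeasure ν]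
    {Φ : (Fin d → ℝ) × (ℕ → ℝ) → ℝ≥0∞} (hΦ : Measurable Φ) :
    ∫⁻ ω, Φ ω ∂(arLaw ν) = ∫⁻ x, ∫⁻ v, Φ (x, v) ∂noiseLaw ∂ν :=
  lintegral_prod _ hΦ.aemeasurable

lemma lintegral_arLaw_le (ν : Measure (Fin d → ℝ)) [IsProbabilityMeasure ν]
    {Φ : (Fin d → ℝ) × (ℕ → ℝ) → ℝ≥0∞} (hΦ : Measurable Φ) {a : ℝ≥0∞}
    (h : ∀ x, ∫⁻ v, Φ (x, v) ∂noiseLaw ≤ a) : ∫⁻ ω, Φ ω ∂(arLaw ν) ≤ a := by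
  rw [lintegral_arLaw ν hΦ]
  calc _ ≤ ∫⁻ _, a ∂ν := lintegral_mono h
    _ = a := by simp

instance (ν : Measure (Fin d → ℝ)) [IsProbabilityMeasure ν] : IsProbabilityMeasure (arLaw ν) := by
  unfold arLaw
  infer_instance

lemma measurable_noise (s : ℕ) : Measurable fun ω : (Fin d → ℝ) × (ℕ → ℝ) => ω.2 s :=
  (measurable_pi_apply s).comp measurable_snd

/-- The exponential martingale of the noise: given the past, a h(X_s) is a constant, so the Gaussian
moment applies step by step. -/
lemma lintegral_exp_noise_le_one (ν : Measure (Fin d → ℝ)) [IsProbabilityMeasure ν]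
    (hm : Measurable m) {h : (Fin d → ℝ) → ℝ} (hh : Measurable h) (a : ℝ) (n : ℕ) :
    ∫⁻ ω, ENNReal.ofReal (Real.exp (∑ s ∈ Finset.range n,
      (a * h (arX m ω s) * ω.2 s - (a * h (arX m ω s)) ^ 2 / 2))) ∂(arLaw ν) ≤ 1 := by
  refine lintegral_arLaw_le ν ?_ fun x => ?_
  · refine (Real.measurable_exp.comp (Finset.measurable_sum _ fun s _ => ?_)).ennreal_ofReal
    have := hh.comp (measurable_arX hm s)
    exact ((this.const_mul a).mul (measurable_noise s)).sub
      (((this.const_mul a).pow_const 2).div_const 2)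
  · refine lintegral_exp_sum_le_one hm
      (ψ := fun x v => a * h x * v - (a * h x) ^ 2 / 2) ?_ (fun x => lintegral_exp_gaussian _) n x
    have := hh.comp (measurable_fst : Measurable (Prod.fst : (Fin d → ℝ) × ℝ → _))
    exact ((this.const_mul a).mul measurable_snd).sub
      (((this.const_mul a).pow_const 2).div_const 2)

lemma lintegral_exp_abs_noise_le_one (ν : Measure (Fin d → ℝ)) [IsProbabilityMeasure ν] (n : ℕ) :
    ∫⁻ ω : (Fin d → ℝ) × (ℕ → ℝ),
      ENNReal.ofReal (Real.exp (∑ s ∈ Finset.range n, (|ω.2 s| - 2))) ∂(arLaw ν) ≤ 1 := by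
  refine lintegral_arLaw_le ν ?_ fun x => ?_
  · refine (Real.measurable_exp.comp (Finset.measurable_sum _ fun s _ => ?_)).ennreal_ofReal
    exact (continuous_abs.measurable.comp (measurable_noise s)).sub_const 2
  -- The summands do not see the state, so any measurable mean function serves here.
  · refine lintegral_exp_sum_le_one (m := fun _ => 0) measurable_const (ψ := fun _ v => |v| - 2) ?_
      (fun x => lintegral_exp_abs_gaussian) n x
    exact (continuous_abs.measurable.comp measurable_snd).sub_const 2

/-- The one-block bound: a nonnegative function of the state after `d` steps, compared with its
Lebesgue integral over the unit cube. -/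
lemma lintegral_exp_block_le_one (hm : Measurable m) {u : (Fin d → ℝ) → ℝ} (hu : Measurable u)
    (hu0 : ∀ x, 0 ≤ u x) (hu1 : ∀ x, u x ≤ 1) {R : ℝ} (hR : 1 ≤ R) {κ : ℝ} (hκ0 : 0 ≤ κ)
    (hκ : ∀ x, ‖x‖ ≤ R → ∀ y ∈ Set.Icc (0 : ℝ) 1, κ ≤ gaussianPDFReal (m x) 1 y)
    (x : Fin d → ℝ) :
    ∫⁻ v, ENNReal.ofReal (Real.exp (-u (arX m (x, v) d) +
      κ ^ d / 2 * (∫ y in cube d 0 1, u y) * (if ‖x‖ ≤ R then 1 else 0))) ∂noiseLaw ≤ 1 := by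
  have hcube : MeasurableSet (cube d 0 1) := measurableSet_Icc
  have hmeas : Measurable fun v => u (arX m (x, v) d) := hu.comp (measurable_arX_right hm x d)
  have hint : Integrable (fun v => u (arX m (x, v) d)) noiseLaw :=
    Integrable.of_bound hmeas.aestronglyMeasurable 1
      (ae_of_all _ fun v => by rw [Real.norm_of_nonneg (hu0 _)]; exact hu1 _)
  -- The factor κ^d is the lower bound of the d-step density on the cube, and 1/2 is the loss in
  -- exp(-t) ≤ 1 - t/2 below. Outside the ball nothing is claimed and b = 0.
  set b : ℝ := κ ^ d / 2 * (∫ y in cube d 0 1, u y) * (if ‖x‖ ≤ R then 1 else 0) with hb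
  have hlow : b ≤ 1 / 2 * ∫ v, u (arX m (x, v) d) ∂noiseLaw := by
    by_cases hx : ‖x‖ ≤ R
    · have h := le_lintegral_arX hm hu.ennreal_ofReal hR (κ := ENNReal.ofReal κ)
        ENNReal.ofReal_ne_top
        (fun x hx y hy => ENNReal.ofReal_le_ofReal (hκ x hx y hy)) d x hx
      have h2 : ∫⁻ y : Fin d → ℝ, (Set.Icc 0 1).indicator
          (fun y => ENNReal.ofReal (u (pushAll d y x))) y = ∫⁻ y in cube d 0 1, ENNReal.ofReal (u y) := by
        rw [← lintegral_indicator hcube, ← lintegral_pushAll_self (x := x)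
          (hu.ennreal_ofReal.indicator hcube)]
        refine lintegral_congr fun y => ?_
        have : y ∈ Set.Icc (0 : Fin d → ℝ) 1 ↔ pushAll d y x ∈ cube d 0 1 := by
          rw [pushAll_self]
          constructor
          · exact fun hy => ⟨fun k => hy.1 _, fun k => hy.2 _⟩
          · exact fun hy => ⟨fun k => by simpa using hy.1 (Fin.rev k),
              fun k => by simpa using hy.2 (Fin.rev k)⟩
        by_cases hy : y ∈ Set.Icc (0 : Fin d → ℝ) 1
        · rw [Set.indicator_of_mem hy, Set.indicator_of_mem (this.1 hy)]
        · rw [Set.indicator_of_notMem hy, Set.indicator_of_notMem (fun h => hy (this.2 h))]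
      rw [h2, ← ofReal_integral_eq_lintegral_ofReal hint (ae_of_all _ fun v => hu0 _),
        ← ENNReal.ofReal_pow hκ0] at h
      have hintc : IntegrableOn u (cube d 0 1) volume := by
        refine Measure.integrableOn_of_bounded (M := 1) ?_ hu.aestronglyMeasurable
          (ae_of_all _ fun y => by rw [Real.norm_of_nonneg (hu0 _)]; exact hu1 _)
        exact (isCompact_Icc.measure_lt_top).ne
      rw [← ofReal_integral_eq_lintegral_ofReal hintc (ae_of_all _ fun v => hu0 _),
        ← ENNReal.ofReal_mul (by positivity),
        ENNReal.ofReal_le_ofReal_iff (integral_nonneg fun v => hu0 _)] at h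
      rw [hb, if_pos hx]
      linarith
    · rw [hb, if_neg hx, mul_zero]
      have := integral_nonneg (μ := noiseLaw) (f := fun v => u (arX m (x, v) d)) fun v => hu0 _
      positivity
  -- The chord of exp over [-1, 0] lies above the graph, and exp(-1) ≤ 1/2.
  have hexp : ∀ t : ℝ, 0 ≤ t → t ≤ 1 → Real.exp (-t) ≤ 1 - 1 / 2 * t := by
    intro t h0 h1
    have hc := convexOn_exp.2 (Set.mem_univ 0) (Set.mem_univ (-1)) (sub_nonneg.2 h1) h0 (by ring)
    simp only [smul_eq_mul, mul_zero, zero_add, Real.exp_zero, mul_one, mul_neg] at hc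
    have h3 : Real.exp (-1 : ℝ) ≤ 1 / 2 := by
      rw [Real.exp_neg, inv_le_comm₀ (Real.exp_pos _) (by norm_num)]
      have := Real.add_one_le_exp (1 : ℝ)
      norm_num at this ⊢
      linarith
    nlinarith
  have hle : ∀ v, Real.exp (-u (arX m (x, v) d) + b) ≤
      (1 - 1 / 2 * u (arX m (x, v) d)) * Real.exp b := fun v => by
    rw [Real.exp_add]
    exact mul_le_mul_of_nonneg_right (hexp _ (hu0 _) (hu1 _)) (Real.exp_pos _).le
  calc _ ≤ ∫⁻ v, ENNReal.ofReal ((1 - 1 / 2 * u (arX m (x, v) d)) * Real.exp b) ∂noiseLaw :=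
        lintegral_mono fun v => ENNReal.ofReal_le_ofReal (hle v)
    _ = ENNReal.ofReal (∫ v, (1 - 1 / 2 * u (arX m (x, v) d)) * Real.exp b ∂noiseLaw) := by
        rw [ofReal_integral_eq_lintegral_ofReal]
        · exact ((integrable_const _).sub (hint.const_mul _)).mul_const _
        · exact ae_of_all _ fun v => mul_nonneg (by linarith [hu1 (arX m (x, v) d)]) (Real.exp_pos _).le
    _ ≤ 1 := by
        refine ENNReal.ofReal_le_one.2 ?_
        rw [integral_mul_const, integral_sub (integrable_const _) (hint.const_mul _),
          integral_const_mul]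
        simp only [integral_const, probReal_univ, smul_eq_mul, mul_one]
        -- The expectation of exp(-u) is at most 1 - E u / 2 ≤ 1 - b ≤ exp(-b), which cancels the
        -- factor exp b.
        have h1 := Real.add_one_le_exp (-b)
        calc _ ≤ Real.exp (-b) * Real.exp b :=
              mul_le_mul_of_nonneg_right (by linarith) (Real.exp_pos _).le
          _ = 1 := by rw [← Real.exp_add]; simp

lemma lintegral_exp_blocks_le_one (ν : Measure (Fin d → ℝ)) [IsProbabilityMeasure ν]
    (hm : Measurable m) {u : (Fin d → ℝ) → ℝ} (hu : Measurable u)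
    (hu0 : ∀ x, 0 ≤ u x) (hu1 : ∀ x, u x ≤ 1) {R : ℝ} (hR : 1 ≤ R) {κ : ℝ} (hκ0 : 0 ≤ κ)
    (hκ : ∀ x, ‖x‖ ≤ R → ∀ y ∈ Set.Icc (0 : ℝ) 1, κ ≤ gaussianPDFReal (m x) 1 y) (n : ℕ) :
    ∫⁻ ω, ENNReal.ofReal (Real.exp (∑ k ∈ Finset.range n, (-u (arX m ω ((k + 1) * d)) +
      κ ^ d / 2 * (∫ y in cube d 0 1, u y) * (if ‖arX m ω (k * d)‖ ≤ R then 1 else 0))))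
      ∂(arLaw ν) ≤ 1 := by
  have hind : Measurable fun x : Fin d → ℝ => if ‖x‖ ≤ R then (1 : ℝ) else 0 :=
    Measurable.ite (measurableSet_le measurable_norm measurable_const) measurable_const
      measurable_const
  refine lintegral_arLaw_le ν ?_ fun x => ?_
  · refine (Real.measurable_exp.comp (Finset.measurable_sum _ fun s _ => ?_)).ennreal_ofReal
    exact (hu.comp (measurable_arX hm _)).neg.add
      ((hind.comp (measurable_arX hm _)).const_mul _)
  · refine lintegral_exp_block_sum_le_one hm d (φ := fun x x' => -u x' +
      κ ^ d / 2 * (∫ y in cube d 0 1, u y) * (if ‖x‖ ≤ R then 1 else 0)) ?_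
      (fun x => lintegral_exp_block_le_one hm hu hu0 hu1 hR hκ0 hκ x) n x
    exact (hu.comp measurable_snd).neg.add ((hind.comp measurable_fst).const_mul _)

/-! ### Stability of the process -/

/-- Coordinate i + 1 at time s + 1 is coordinate i at time s, so each shift costs one more initial
value and nothing else. -/
lemma sum_abs_arX_apply_le (ω : (Fin d → ℝ) × (ℕ → ℝ)) (i : ℕ) (hi : i < d) (n : ℕ) :
    ∑ s ∈ Finset.range n, |arX m ω s ⟨i, hi⟩| ≤
      (i + 1) * ‖ω.1‖ + ∑ s ∈ Finset.range n, |arY m ω s| := by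
  induction i generalizing n with
  | zero =>
    cases n with
    | zero => simp
    | succ n =>
      rw [Finset.sum_range_succ']
      have h1 : |arX m ω 0 ⟨0, hi⟩| ≤ ‖ω.1‖ := norm_le_pi_norm ω.1 _
      have h2 : ∀ s, arX m ω (s + 1) ⟨0, hi⟩ = arY m ω s := fun s => by
        rw [arX_succ, pushFront, if_pos rfl, arY]
      simp only [h2]
      rw [Finset.sum_range_succ]
      have := abs_nonneg (arY m ω n)
      push_cast
      linarith
  | succ i ih =>
    cases n with
    | zero => simp; positivity
    | succ n =>
      rw [Finset.sum_range_succ']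
      have h1 : |arX m ω 0 ⟨i + 1, hi⟩| ≤ ‖ω.1‖ := norm_le_pi_norm ω.1 _
      have h2 : ∀ s, arX m ω (s + 1) ⟨i + 1, hi⟩ = arX m ω s ⟨i, by omega⟩ := fun s => by
        rw [arX_succ, pushFront, if_neg (by simp)]
        simp
      simp only [h2]
      have h3 := ih (by omega) n
      rw [Finset.sum_range_succ]
      have := abs_nonneg (arY m ω n)
      push_cast
      linarith

/-- Pathwise stability, uniformly over the class of mean functions of linear growth. -/
lemma exists_sum_norm_arX_le {c₀ : ℝ} (hc₀ : 0 < c₀) {c : Fin d → ℝ} (hc : ∀ i, 0 < c i)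
    (hcsum : ∑ i, c i < 1) : ∃ C : ℝ, 0 < C ∧ ∀ m ∈ linearGrowthClass c₀ c,
      ∀ (ω : (Fin d → ℝ) × (ℕ → ℝ)) (n : ℕ), ∑ s ∈ Finset.range n, ‖arX m ω s‖ ≤
        C * (‖ω.1‖ + n + ∑ s ∈ Finset.range n, |ω.2 s|) := by
  set S : ℝ := ∑ i, c i with hS
  have hS0 : 0 ≤ S := Finset.sum_nonneg fun i _ => (hc i).le
  refine ⟨d * (d + (c₀ + 1 + d) / (1 - S)) + 1, by
    have : 0 < 1 - S := by linarith
    positivity, ?_⟩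
  rintro m ⟨-, hm⟩ ω n
  set SY := ∑ s ∈ Finset.range n, |arY m ω s|
  set SV := ∑ s ∈ Finset.range n, |ω.2 s|
  have hSV : 0 ≤ SV := Finset.sum_nonneg fun _ _ => abs_nonneg _
  have hx : ∀ i : Fin d, ∑ s ∈ Finset.range n, |arX m ω s i| ≤ d * ‖ω.1‖ + SY := fun i => by
    refine (sum_abs_arX_apply_le ω i.val i.isLt n).trans ?_
    have : (i.val : ℝ) + 1 ≤ d := by exact_mod_cast i.isLt
    gcongr
  -- The sum of |Y| bounds itself with the factor S = ∑ c_i < 1 and is absorbed in the next step;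
  -- this is where stability enters.
  have hY : SY ≤ n * c₀ + SV + S * (d * ‖ω.1‖ + SY) := by
    calc SY ≤ ∑ s ∈ Finset.range n, (c₀ + |ω.2 s| + ∑ i, c i * |arX m ω s i|) := by
          refine Finset.sum_le_sum fun s _ => ?_
          have h1 := abs_add_le (m (arX m ω s)) (ω.2 s)
          have h2 := hm (arX m ω s)
          rw [arY]
          linarith
      _ = n * c₀ + SV + ∑ i, c i * ∑ s ∈ Finset.range n, |arX m ω s i| := by
          rw [Finset.sum_add_distrib, Finset.sum_add_distrib, Finset.sum_comm]
          simp [Finset.mul_sum, SV]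
      _ ≤ _ := by
          rw [hS, Finset.sum_mul]
          gcongr with i _
          · exact (hc i).le
          · exact hx i
  have hY' : SY ≤ (c₀ + 1 + d) / (1 - S) * (‖ω.1‖ + n + SV) := by
    have h1S : 0 < 1 - S := by linarith
    rw [div_mul_eq_mul_div, le_div_iff₀ h1S]
    have hn : (0 : ℝ) ≤ n := Nat.cast_nonneg n
    have hw := norm_nonneg ω.1
    have hd : (0 : ℝ) ≤ d := Nat.cast_nonneg d
    have : S * (d * ‖ω.1‖) ≤ d * ‖ω.1‖ := by
      have : 0 ≤ d * ‖ω.1‖ := by positivity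
      nlinarith
    have a1 : 0 ≤ c₀ * ‖ω.1‖ := by positivity
    have a2 : 0 ≤ c₀ * SV := by positivity
    have a3 : 0 ≤ d * (n : ℝ) := by positivity
    have a4 : 0 ≤ d * SV := by positivity
    nlinarith
  have hfin : ∑ s ∈ Finset.range n, ‖arX m ω s‖ ≤ d * (d * ‖ω.1‖ + SY) := by
    calc _ ≤ ∑ s ∈ Finset.range n, ∑ i, |arX m ω s i| := by
          refine Finset.sum_le_sum fun s _ => ?_
          refine (pi_norm_le_iff_of_nonneg (Finset.sum_nonneg fun _ _ => abs_nonneg _)).2 fun i => ?_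
          exact Finset.single_le_sum (f := fun i => |arX m ω s i|) (fun _ _ => abs_nonneg _)
            (Finset.mem_univ i)
      _ = ∑ i, ∑ s ∈ Finset.range n, |arX m ω s i| := Finset.sum_comm
      _ ≤ ∑ _i : Fin d, (d * ‖ω.1‖ + SY) := Finset.sum_le_sum fun i _ => hx i
      _ = _ := by simp [mul_add]
  have hw := norm_nonneg ω.1
  have hn : (0 : ℝ) ≤ n := Nat.cast_nonneg n
  calc _ ≤ d * (d * ‖ω.1‖ + SY) := hfin
    _ ≤ d * (d * (‖ω.1‖ + n + SV) + (c₀ + 1 + d) / (1 - S) * (‖ω.1‖ + n + SV)) := by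
        gcongr
        linarith
    _ ≤ _ := by
        have : 0 ≤ ‖ω.1‖ + n + SV := by positivity
        nlinarith

/-- Up to time `n` the process starts in a ball of radius `n`, and the noise is moderate. -/
def goodEvent (d n : ℕ) : Set ((Fin d → ℝ) × (ℕ → ℝ)) :=
  {ω | ‖ω.1‖ ≤ n ∧ ∑ s ∈ Finset.range n, |ω.2 s| ≤ 3 * n}

lemma measurable_sum_abs_noise (n : ℕ) :
    Measurable fun ω : (Fin d → ℝ) × (ℕ → ℝ) => ∑ s ∈ Finset.range n, |ω.2 s| :=
  Finset.measurable_sum _ fun s _ => continuous_abs.measurable.comp (measurable_noise s)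

lemma measurableSet_goodEvent (n : ℕ) : MeasurableSet (goodEvent d n) :=
  (measurableSet_le (measurable_norm.comp measurable_fst) measurable_const).inter
    (measurableSet_le (measurable_sum_abs_noise n) measurable_const)

lemma measure_compl_goodEvent_le (ν : Measure (Fin d → ℝ)) [IsProbabilityMeasure ν]
    (hν : Integrable (fun x => ‖x‖) ν) (n : ℕ) (hn : 0 < n) :
    arLaw ν (goodEvent d n)ᶜ ≤ ENNReal.ofReal ((1 + ∫ x, ‖x‖ ∂ν) / n) := by
  have hn' : (0 : ℝ) < n := Nat.cast_pos.2 hn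
  -- If the noise sum exceeds 3n, the centered sum exceeds n, so its exponential exceeds n and
  -- Markov's inequality gives 1/n. The initial vector contributes its first moment over n.
  have hsub : (goodEvent d n)ᶜ ⊆ {ω | ENNReal.ofReal (n : ℝ) ≤ ENNReal.ofReal ‖ω.1‖} ∪
      {ω | ENNReal.ofReal n ≤ ENNReal.ofReal
        (Real.exp (∑ s ∈ Finset.range n, (|ω.2 s| - 2)))} := by
    intro ω hω
    by_contra hcon
    simp only [Set.mem_union, Set.mem_ofPred_eq, not_or, not_le] at hcon
    refine hω ⟨?_, ?_⟩
    · have := (ENNReal.ofReal_lt_ofReal_iff hn').1 hcon.1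
      exact this.le
    · have h := (ENNReal.ofReal_lt_ofReal_iff hn').1 hcon.2
      rw [Finset.sum_sub_distrib] at h
      simp only [Finset.sum_const, Finset.card_range, nsmul_eq_mul] at h
      have := Real.add_one_le_exp (∑ s ∈ Finset.range n, |ω.2 s| - n * 2)
      linarith
  have h1 : arLaw ν {ω | ENNReal.ofReal (n : ℝ) ≤ ENNReal.ofReal ‖ω.1‖} ≤
      ENNReal.ofReal (∫ x, ‖x‖ ∂ν) / ENNReal.ofReal n := by
    have hm : Measurable fun ω : (Fin d → ℝ) × (ℕ → ℝ) => ENNReal.ofReal ‖ω.1‖ :=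
      (measurable_norm.comp measurable_fst).ennreal_ofReal
    refine (meas_ge_le_lintegral_div hm.aemeasurable (by simpa using hn.ne')
      ENNReal.ofReal_ne_top).trans (ENNReal.div_le_div_right ?_ _)
    rw [lintegral_arLaw ν hm, ofReal_integral_eq_lintegral_ofReal hν (ae_of_all _ fun _ => norm_nonneg _)]
    simp
  have h2 : arLaw ν {ω | ENNReal.ofReal n ≤ ENNReal.ofReal
      (Real.exp (∑ s ∈ Finset.range n, (|ω.2 s| - 2)))} ≤ 1 / ENNReal.ofReal n := by
    have hm : Measurable fun ω : (Fin d → ℝ) × (ℕ → ℝ) =>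
        ENNReal.ofReal (Real.exp (∑ s ∈ Finset.range n, (|ω.2 s| - 2))) := by
      refine (Real.measurable_exp.comp (Finset.measurable_sum _ fun s _ => ?_)).ennreal_ofReal
      exact (continuous_abs.measurable.comp (measurable_noise s)).sub_const 2
    exact (meas_ge_le_lintegral_div hm.aemeasurable (by simpa using hn.ne')
      ENNReal.ofReal_ne_top).trans
      (ENNReal.div_le_div_right (lintegral_exp_abs_noise_le_one ν n) _)
  refine (measure_mono hsub).trans ((measure_union_le _ _).trans ((add_le_add h1 h2).trans ?_))
  have hI : 0 ≤ ∫ x, ‖x‖ ∂ν := integral_nonneg fun _ => norm_nonneg _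
  rw [add_div, ENNReal.ofReal_add (by positivity) (by positivity), ENNReal.ofReal_div_of_pos hn',
    ENNReal.ofReal_div_of_pos hn', ENNReal.ofReal_one, add_comm]

/-- On the good event a fixed fraction of the sampled states lies in a fixed ball. -/
lemma exists_radius {c₀ : ℝ} (hc₀ : 0 < c₀) {c : Fin d → ℝ} (hc : ∀ i, 0 < c i)
    (hcsum : ∑ i, c i < 1) (hd : 0 < d) : ∃ R : ℝ, 1 ≤ R ∧ ∀ m ∈ linearGrowthClass c₀ c,
      ∀ n : ℕ, 2 + 2 * d ≤ n → ∀ ω ∈ goodEvent d n,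
        (n : ℝ) / (4 * d) ≤ ∑ k ∈ Finset.range ((n - 1) / d),
          (if ‖arX m ω (k * d)‖ ≤ R then (1 : ℝ) else 0) := by
  obtain ⟨C, hC, h⟩ := exists_sum_norm_arX_le hc₀ hc hcsum
  -- On the good event the norms sum to at most C (n + n + 3n) = 5 C n, so at most 5 C n / R block
  -- starts leave the ball. With R above 20 d C this is at most n / (4 d), half of the guaranteed n
  -- / (2 d) blocks.
  refine ⟨1 + 20 * d * C, by have : 0 ≤ d * C := by positivity
                             linarith, ?_⟩
  intro m hm n hn ω hω
  set R := 1 + 20 * d * C with hR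
  have hR0 : 0 < R := by positivity
  set K := (n - 1) / d with hK
  have hd' : (0 : ℝ) < d := Nat.cast_pos.2 hd
  have hsum : ∑ s ∈ Finset.range n, ‖arX m ω s‖ ≤ 5 * C * n := by
    refine (h m hm ω n).trans ?_
    have := hω.1
    have := hω.2
    nlinarith
  have hsub : ∑ k ∈ Finset.range K, ‖arX m ω (k * d)‖ ≤ ∑ s ∈ Finset.range n, ‖arX m ω s‖ := by
    rw [← Finset.sum_image (f := fun s => ‖arX m ω s‖) (s := Finset.range K) (g := fun k => k * d)]
    · refine Finset.sum_le_sum_of_subset_of_nonneg ?_ fun _ _ _ => norm_nonneg _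
      intro s hs
      obtain ⟨k, hk, rfl⟩ := Finset.mem_image.1 hs
      rw [Finset.mem_range] at hk ⊢
      have : (k + 1) * d ≤ n - 1 := (Nat.le_div_iff_mul_le hd).1 hk
      have h2 : (k + 1) * d = k * d + d := by ring
      omega
    · intro a _ b _ hab
      exact Nat.eq_of_mul_eq_mul_right hd hab
  have hcount : (K : ℝ) - 5 * C * n / R ≤
      ∑ k ∈ Finset.range K, (if ‖arX m ω (k * d)‖ ≤ R then (1 : ℝ) else 0) := by
    have h1 : ∀ k, 1 - ‖arX m ω (k * d)‖ / R ≤ if ‖arX m ω (k * d)‖ ≤ R then (1 : ℝ) else 0 := by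
      intro k
      split_ifs with hk
      · have : 0 ≤ ‖arX m ω (k * d)‖ / R := by positivity
        linarith
      · have : 1 ≤ ‖arX m ω (k * d)‖ / R := (one_le_div hR0).2 (not_le.1 hk).le
        linarith
    refine le_trans ?_ (Finset.sum_le_sum fun k _ => h1 k)
    rw [Finset.sum_sub_distrib, ← Finset.sum_div]
    simp only [Finset.sum_const, Finset.card_range, nsmul_eq_mul, mul_one]
    gcongr
    exact hsub.trans hsum
  have hKlow : (n : ℝ) / (2 * d) ≤ K := by
    rw [div_le_iff₀ (by positivity)]
    have h1 : n - 1 < d * (K + 1) := by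
      rw [hK]
      exact Nat.lt_mul_div_succ _ hd
    have h2 : n ≤ K * (2 * d) := by
      have : d * (K + 1) = K * d + d := by ring
      have : K * (2 * d) = 2 * (K * d) := by ring
      omega
    exact_mod_cast h2
  have hbad : 5 * C * n / R ≤ n / (4 * d) := by
    rw [div_le_div_iff₀ hR0 (by positivity), hR]
    have : (0 : ℝ) ≤ n := Nat.cast_nonneg n
    nlinarith
  have : (n : ℝ) / (2 * d) = n / (4 * d) + n / (4 * d) := by
    field_simp
    ring
  linarith

/-- A lower bound for the transition densities, uniform over the class of mean functions. -/
lemma exists_density_lower_bound (c₀ : ℝ) {c : Fin d → ℝ} (hc : ∀ i, 0 < c i)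
    (hcsum : ∑ i, c i < 1) (R : ℝ) (hR : 1 ≤ R) : ∃ κ : ℝ, 0 < κ ∧ κ ≤ 1 ∧
      ∀ m ∈ linearGrowthClass c₀ c, ∀ x, ‖x‖ ≤ R → ∀ y ∈ Set.Icc (0 : ℝ) 1,
        κ ≤ gaussianPDFReal (m x) 1 y := by
  -- On the ball |m x| ≤ c₀ + R, so a point of [0, 1] is at distance at most 1 + c₀ + R from the
  -- mean, and the density decreases with the distance.
  refine ⟨gaussianPDFReal 0 1 (1 + c₀ + R), gaussianPDFReal_pos _ _ _ one_ne_zero, ?_, ?_⟩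
  · have := gaussianPDF_le_one 0 (1 + c₀ + R)
    rw [gaussianPDF_def] at this
    exact ENNReal.ofReal_le_one.1 this
  rintro m ⟨-, hm⟩ x hx y hy
  have h1 : |m x| ≤ c₀ + R := by
    refine (hm x).trans ?_
    have : ∑ i, c i * |x i| ≤ ∑ i, c i * R := Finset.sum_le_sum fun i _ =>
      mul_le_mul_of_nonneg_left ((norm_le_pi_norm x i).trans hx) (hc i).le
    rw [← Finset.sum_mul] at this
    nlinarith
  have h2 : |y - m x| ≤ 1 + c₀ + R := by
    have := abs_sub y (m x)
    rw [abs_of_nonneg hy.1] at this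
    linarith [hy.2]
  rw [gaussianPDFReal_def, gaussianPDFReal_def]
  simp only [NNReal.coe_one, mul_one, sub_zero]
  rw [← sq_abs (y - m x)]
  gcongr

end

end SparseDNN

namespace SparseDNN

section

variable {d : ℕ} {m : (Fin d → ℝ) → ℝ}

/-! ### An oracle inequality -/

lemma Net.continuous_eval : ∀ {p : ℕ} (f : Net p), Continuous f.eval
  | _, .output w b => by
    have : (Net.output w b).eval = fun x => ∑ i, w i * x i + b := rfl
    rw [this]
    fun_prop
  | _, .hidden W b rest => by
    refine (Net.continuous_eval rest).comp (continuous_pi fun i => ?_)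
    have : (fun x => max ((W.mulVec x + b) i) 0) = fun x => max (∑ j, W i j * x j + b i) 0 := rfl
    rw [this]
    fun_prop

lemma Net.clipNorm_nonneg {p : ℕ} {τ : ℝ} (hτ : 0 ≤ τ) (f : Net p) : 0 ≤ f.clipNorm τ := by
  refine Multiset.sum_nonneg fun x hx => ?_
  obtain ⟨θ, -, rfl⟩ := Multiset.mem_map.1 hx
  positivity

lemma measurableSet_cube (p : ℕ) (l u : ℝ) : MeasurableSet (cube p l u) := measurableSet_Icc

lemma volume_cube (p : ℕ) : volume (cube p 0 1) = 1 := by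
  rw [cube, Real.volume_Icc_pi]
  simp

/-- The criterion whose exponential moment is controlled. -/
noncomputable def excess (b : ℝ) (m h : (Fin d → ℝ) → ℝ) (n : ℕ)
    (ω : (Fin d → ℝ) × (ℕ → ℝ)) : ℝ :=
  b * n * (∫ y in cube d 0 1, h y ^ 2) - ∑ s ∈ Finset.range n, h (arX m ω s) ^ 2 +
    2 * ∑ s ∈ Finset.range n, ω.2 s * h (arX m ω s)

lemma measurable_excess (b : ℝ) (hm : Measurable m) {h : (Fin d → ℝ) → ℝ} (hh : Measurable h)
    (n : ℕ) : Measurable (excess b m h n) := by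
  have h1 : ∀ s, Measurable fun ω : (Fin d → ℝ) × (ℕ → ℝ) => h (arX m ω s) :=
    fun s => hh.comp (measurable_arX hm s)
  exact (measurable_const.sub (Finset.measurable_sum _ fun s _ => (h1 s).pow_const 2)).add
    ((Finset.measurable_sum _ fun s _ => (measurable_noise s).mul (h1 s)).const_mul 2)

lemma sum_block_le_sum (hd : 0 < d) (n : ℕ) {a : ℕ → ℝ} (ha : ∀ s, 0 ≤ a s) :
    ∑ k ∈ Finset.range ((n - 1) / d), a ((k + 1) * d) ≤ ∑ s ∈ Finset.range n, a s := by
  rw [← Finset.sum_image (f := a) (s := Finset.range ((n - 1) / d)) (g := fun k => (k + 1) * d)]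
  · refine Finset.sum_le_sum_of_subset_of_nonneg ?_ fun _ _ _ => ha _
    intro s hs
    obtain ⟨k, hk, rfl⟩ := Finset.mem_image.1 hs
    rw [Finset.mem_range] at hk ⊢
    have : (k + 1) * d ≤ n - 1 := (Nat.le_div_iff_mul_le hd).1 hk
    have h2 : (k + 1) * d = k * d + d := by ring
    omega
  · intro a _ b _ hab
    have := Nat.eq_of_mul_eq_mul_right hd hab
    omega

/-- On the good event η times the excess is at most the average of two exponents U and V, each with
exponential moment at most one: U is the noise martingale and V compares ∑ h² with ∫ h² over blocks.
Convexity of exp separates the two although they are dependent. The constant b collects κ^d / 2 from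
the block bound, 1 / (4 d) from the number of good blocks, and 1/2 from the averaging. -/
lemma lintegral_exp_excess_le_one (ν : Measure (Fin d → ℝ)) [IsProbabilityMeasure ν]
    (hm : Measurable m) (hd : 0 < d) {h : (Fin d → ℝ) → ℝ} (hh : Measurable h) {H : ℝ}
    (hH1 : 1 ≤ H) (hhH : ∀ x, |h x| ≤ H) {R : ℝ} (hR : 1 ≤ R) {κ : ℝ} (hκ0 : 0 ≤ κ)
    (hκ : ∀ x, ‖x‖ ≤ R → ∀ y ∈ Set.Icc (0 : ℝ) 1, κ ≤ gaussianPDFReal (m x) 1 y) (n : ℕ)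
    (hgood : ∀ ω ∈ goodEvent d n, (n : ℝ) / (4 * d) ≤ ∑ k ∈ Finset.range ((n - 1) / d),
          (if ‖arX m ω (k * d)‖ ≤ R then (1 : ℝ) else 0)) :
    ∫⁻ ω in goodEvent d n, ENNReal.ofReal
      (Real.exp (1 / (8 * H ^ 2) * excess (κ ^ d / (16 * d)) m h n ω)) ∂(arLaw ν) ≤ 1 := by
  -- This η makes u = η h² at most 1/8, as the block bound requires u ≤ 1, and gives 8 η ≤ 1, so
  -- that the compensator 8 η² ∑ h² of U fits into the half of η ∑ h² that V leaves over.
  set η : ℝ := 1 / (8 * H ^ 2) with hη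
  have hH2 : 1 ≤ H ^ 2 := one_le_pow₀ hH1
  have hη0 : 0 < η := by positivity
  have hη1 : η * H ^ 2 = 1 / 8 := by rw [hη]; field_simp
  have hη8 : 8 * η ≤ 1 := by nlinarith
  have hd' : (0 : ℝ) < d := Nat.cast_pos.2 hd
  set u : (Fin d → ℝ) → ℝ := fun x => η * h x ^ 2 with hu
  have hum : Measurable u := (hh.pow_const 2).const_mul η
  have hu0 : ∀ x, 0 ≤ u x := fun x => by positivity
  have hu1 : ∀ x, u x ≤ 1 := fun x => by
    have : h x ^ 2 ≤ H ^ 2 := sq_le_sq' (by linarith [(abs_le.1 (hhH x)).1]) (abs_le.1 (hhH x)).2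
    calc u x ≤ η * H ^ 2 := mul_le_mul_of_nonneg_left this hη0.le
      _ ≤ 1 := by rw [hη1]; norm_num
  set U : (Fin d → ℝ) × (ℕ → ℝ) → ℝ := fun ω => ∑ s ∈ Finset.range n,
      (4 * η * h (arX m ω s) * ω.2 s - (4 * η * h (arX m ω s)) ^ 2 / 2) with hU
  set V : (Fin d → ℝ) × (ℕ → ℝ) → ℝ := fun ω => ∑ k ∈ Finset.range ((n - 1) / d),
      (-u (arX m ω ((k + 1) * d)) +
      κ ^ d / 2 * (∫ y in cube d 0 1, u y) * (if ‖arX m ω (k * d)‖ ≤ R then 1 else 0)) with hV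
  have hUi := lintegral_exp_noise_le_one ν hm hh (4 * η) n
  have hVi := lintegral_exp_blocks_le_one ν hm hum hu0 hu1 hR hκ0 hκ ((n - 1) / d)
  have hUm : Measurable U := by
    refine Finset.measurable_sum _ fun s _ => ?_
    have := hh.comp (measurable_arX hm s)
    exact ((this.const_mul _).mul (measurable_noise s)).sub
      (((this.const_mul _).pow_const 2).div_const 2)
  have hpt : ∀ ω ∈ goodEvent d n, η * excess (κ ^ d / (16 * d)) m h n ω ≤ 1 / 2 * U ω + 1 / 2 * V ω := by
    intro ω hω
    have hg := hgood ω hω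
    have hI : ∫ y in cube d 0 1, u y = η * ∫ y in cube d 0 1, h y ^ 2 := integral_const_mul _ _
    have hI0 : 0 ≤ ∫ y in cube d 0 1, h y ^ 2 := integral_nonneg fun _ => sq_nonneg _
    have h1 : η * ∑ s ∈ Finset.range n, h (arX m ω s) ^ 2 ≥
        ∑ k ∈ Finset.range ((n - 1) / d), u (arX m ω ((k + 1) * d)) := by
      rw [Finset.mul_sum]
      exact sum_block_le_sum hd n (a := fun s => u (arX m ω s)) fun s => hu0 _
    have h2 : U ω = 4 * η * ∑ s ∈ Finset.range n, ω.2 s * h (arX m ω s) -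
        8 * η * η * ∑ s ∈ Finset.range n, h (arX m ω s) ^ 2 := by
      simp only [hU]
      rw [Finset.sum_sub_distrib, Finset.mul_sum, Finset.mul_sum]
      congr 1 <;> exact Finset.sum_congr rfl fun s _ => by ring
    have h3 : V ω ≥ -(η * ∑ s ∈ Finset.range n, h (arX m ω s) ^ 2) +
        κ ^ d / 2 * (η * ∫ y in cube d 0 1, h y ^ 2) * (n / (4 * d)) := by
      simp only [hV]
      have hsum : ∑ k ∈ Finset.range ((n - 1) / d), κ ^ d / 2 * (∫ y in cube d 0 1, u y) *
          (if ‖arX m ω (k * d)‖ ≤ R then (1 : ℝ) else 0) = κ ^ d / 2 * (∫ y in cube d 0 1, u y) *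
          ∑ k ∈ Finset.range ((n - 1) / d), (if ‖arX m ω (k * d)‖ ≤ R then (1 : ℝ) else 0) :=
        (Finset.mul_sum _ _ _).symm
      rw [Finset.sum_add_distrib, Finset.sum_neg_distrib, hsum, hI]
      have : 0 ≤ κ ^ d / 2 * (η * ∫ y in cube d 0 1, h y ^ 2) := by positivity
      have := mul_le_mul_of_nonneg_left hg this
      linarith
    have h4 : 0 ≤ ∑ s ∈ Finset.range n, h (arX m ω s) ^ 2 :=
      Finset.sum_nonneg fun _ _ => sq_nonneg _
    have h5 : 8 * η * η * ∑ s ∈ Finset.range n, h (arX m ω s) ^ 2 ≤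
        η * ∑ s ∈ Finset.range n, h (arX m ω s) ^ 2 := by
      have : 8 * η * η ≤ 1 * η := by gcongr
      nlinarith
    have h6 : κ ^ d / 2 * (η * ∫ y in cube d 0 1, h y ^ 2) * (n / (4 * d)) =
        2 * (η * (κ ^ d / (16 * d) * n * ∫ y in cube d 0 1, h y ^ 2)) := by
      field_simp
      ring
    rw [h6] at h3
    rw [excess, h2]
    nlinarith
  calc _ ≤ ∫⁻ ω in goodEvent d n, (ENNReal.ofReal (1 / 2) * ENNReal.ofReal (Real.exp (U ω)) +
        ENNReal.ofReal (1 / 2) * ENNReal.ofReal (Real.exp (V ω))) ∂(arLaw ν) := by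
        refine setLIntegral_mono' (measurableSet_goodEvent n) fun ω hω => ?_
        rw [← ENNReal.ofReal_mul (by norm_num), ← ENNReal.ofReal_mul (by norm_num),
          ← ENNReal.ofReal_add (by positivity) (by positivity)]
        refine ENNReal.ofReal_le_ofReal ((Real.exp_le_exp.2 (hpt ω hω)).trans ?_)
        have := convexOn_exp.2 (Set.mem_univ (U ω)) (Set.mem_univ (V ω))
          (by norm_num : (0 : ℝ) ≤ 1 / 2) (by norm_num : (0 : ℝ) ≤ 1 / 2) (by norm_num)
        simpa only [smul_eq_mul] using this
    _ ≤ ∫⁻ ω, (ENNReal.ofReal (1 / 2) * ENNReal.ofReal (Real.exp (U ω)) +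
        ENNReal.ofReal (1 / 2) * ENNReal.ofReal (Real.exp (V ω))) ∂(arLaw ν) :=
        setLIntegral_le_lintegral _ _
    _ = ENNReal.ofReal (1 / 2) * ∫⁻ ω, ENNReal.ofReal (Real.exp (U ω)) ∂(arLaw ν) +
        ENNReal.ofReal (1 / 2) * ∫⁻ ω, ENNReal.ofReal (Real.exp (V ω)) ∂(arLaw ν) := by
        rw [lintegral_add_left, lintegral_const_mul' _ _ ENNReal.ofReal_ne_top,
          lintegral_const_mul' _ _ ENNReal.ofReal_ne_top]
        exact (Real.measurable_exp.comp hUm).ennreal_ofReal.const_mul _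
    _ ≤ ENNReal.ofReal (1 / 2) * 1 + ENNReal.ofReal (1 / 2) * 1 := by
        gcongr
    _ = 1 := by
        rw [mul_one, ← ENNReal.ofReal_add (by norm_num) (by norm_num)]
        norm_num

/-- The difference of a function and `m`, cut off outside the unit cube. -/
noncomputable def cubeDiff (m f : (Fin d → ℝ) → ℝ) : (Fin d → ℝ) → ℝ :=
  (cube d 0 1).indicator fun x => f x - m x

lemma measurable_cubeDiff (hm : Measurable m) {f : (Fin d → ℝ) → ℝ} (hf : Measurable f) :
    Measurable (cubeDiff m f) := (hf.sub hm).indicator (measurableSet_cube d 0 1)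

lemma cubeDiff_of_mem {f : (Fin d → ℝ) → ℝ} {x : Fin d → ℝ} (hx : x ∈ cube d 0 1) :
    cubeDiff m f x = f x - m x := Set.indicator_of_mem hx _

lemma cubeDiff_of_notMem {f : (Fin d → ℝ) → ℝ} {x : Fin d → ℝ} (hx : x ∉ cube d 0 1) :
    cubeDiff m f x = 0 := Set.indicator_of_notMem hx _

lemma abs_cubeDiff_le {f : (Fin d → ℝ) → ℝ} {H : ℝ} (hH : 0 ≤ H)
    (h : ∀ x ∈ cube d 0 1, |f x - m x| ≤ H) (x : Fin d → ℝ) : |cubeDiff m f x| ≤ H := by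
  by_cases hx : x ∈ cube d 0 1
  · rw [cubeDiff_of_mem hx]; exact h x hx
  · rw [cubeDiff_of_notMem hx]; simpa using hH

/-- Replacing a function by a nearby one changes the criterion only slightly. -/
lemma excess_le_excess_add {b F ε : ℝ} (hb0 : 0 ≤ b) (hb1 : b ≤ 1) (hF : 1 ≤ F) (hε0 : 0 ≤ ε)
    (hm : Measurable m) {f g : (Fin d → ℝ) → ℝ} (hf : Measurable f) (hg : Measurable g)
    (hmF : ∀ x ∈ cube d 0 1, |m x| ≤ F) (hfF : ∀ x ∈ cube d 0 1, |f x| ≤ F)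
    (hgF : ∀ x ∈ cube d 0 1, |g x| ≤ F + 1) (hfg : ∀ x ∈ cube d 0 1, |f x - g x| ≤ ε)
    {n : ℕ} {ω : (Fin d → ℝ) × (ℕ → ℝ)} (hω : ω ∈ goodEvent d n) :
    excess b m (cubeDiff m f) n ω ≤ excess b m (cubeDiff m g) n ω + 16 * F * n * ε := by
  have hd1 : ∀ x, |cubeDiff m f x - cubeDiff m g x| ≤ ε := fun x => by
    by_cases hx : x ∈ cube d 0 1
    · rw [cubeDiff_of_mem hx, cubeDiff_of_mem hx, sub_sub_sub_cancel_right]; exact hfg x hx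
    · rw [cubeDiff_of_notMem hx, cubeDiff_of_notMem hx]; simpa using hε0
  have hf2 : ∀ x, |cubeDiff m f x| ≤ 2 * F := abs_cubeDiff_le (by linarith) fun x hx => by
    linarith [abs_sub (f x) (m x), hfF x hx, hmF x hx]
  have hg2 : ∀ x, |cubeDiff m g x| ≤ 3 * F := abs_cubeDiff_le (by linarith) fun x hx => by
    linarith [abs_sub (g x) (m x), hgF x hx, hmF x hx]
  -- The constant 5 F is 2 F + 3 F: the approximating function is only bounded by F + 1 ≤ 2 F, so
  -- its difference from m is bounded by 3 F.
  have hsq : ∀ x, |cubeDiff m f x ^ 2 - cubeDiff m g x ^ 2| ≤ 5 * F * ε := fun x => by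
    rw [sq_sub_sq, abs_mul]
    have h1 := abs_add_le (cubeDiff m f x) (cubeDiff m g x)
    exact mul_le_mul (by linarith [hf2 x, hg2 x]) (hd1 x) (abs_nonneg _) (by linarith)
  have hfin : ∀ {h : (Fin d → ℝ) → ℝ} {H : ℝ}, Measurable h → (∀ x, |h x| ≤ H) →
      IntegrableOn (fun x => h x ^ 2) (cube d 0 1) volume := fun {h H} hh hH => by
    refine Measure.integrableOn_of_bounded (M := H ^ 2) (by simp [volume_cube])
      (hh.pow_const 2).aestronglyMeasurable (ae_of_all _ fun x => ?_)
    rw [Real.norm_of_nonneg (sq_nonneg _), ← sq_abs]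
    gcongr
    exact hH x
  have hI : (∫ y in cube d 0 1, cubeDiff m f y ^ 2) ≤
      (∫ y in cube d 0 1, cubeDiff m g y ^ 2) + 5 * F * ε := by
    have h1 : (∫ y in cube d 0 1, cubeDiff m f y ^ 2) ≤
        ∫ y in cube d 0 1, (cubeDiff m g y ^ 2 + 5 * F * ε) := by
      refine integral_mono (hfin (measurable_cubeDiff hm hf) hf2)
        ((hfin (measurable_cubeDiff hm hg) hg2).add ?_) fun x => by
          have := (abs_le.1 (hsq x)).2
          simp only
          linarith
      exact integrableOn_const (by simp [volume_cube])
    rw [integral_add (hfin (measurable_cubeDiff hm hg) hg2)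
      (integrableOn_const (by simp [volume_cube]))] at h1
    simpa [volume_cube, Measure.real] using h1
  have hS : ∑ s ∈ Finset.range n, cubeDiff m g (arX m ω s) ^ 2 ≤
      ∑ s ∈ Finset.range n, cubeDiff m f (arX m ω s) ^ 2 + n * (5 * F * ε) := by
    have : ∑ s ∈ Finset.range n, cubeDiff m g (arX m ω s) ^ 2 ≤
        ∑ s ∈ Finset.range n, (cubeDiff m f (arX m ω s) ^ 2 + 5 * F * ε) :=
      Finset.sum_le_sum fun s _ => by linarith [(abs_le.1 (hsq (arX m ω s))).1]
    rw [Finset.sum_add_distrib] at this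
    simpa using this
  have hN : ∑ s ∈ Finset.range n, ω.2 s * cubeDiff m f (arX m ω s) ≤
      ∑ s ∈ Finset.range n, ω.2 s * cubeDiff m g (arX m ω s) + 3 * n * ε := by
    have h1 : ∑ s ∈ Finset.range n, ω.2 s * cubeDiff m f (arX m ω s) ≤
        ∑ s ∈ Finset.range n, (ω.2 s * cubeDiff m g (arX m ω s) + |ω.2 s| * ε) := by
      refine Finset.sum_le_sum fun s _ => ?_
      have h2 := le_abs_self (ω.2 s * (cubeDiff m f (arX m ω s) - cubeDiff m g (arX m ω s)))
      rw [abs_mul] at h2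
      have h3 := mul_le_mul_of_nonneg_left (hd1 (arX m ω s)) (abs_nonneg (ω.2 s))
      linarith
    rw [Finset.sum_add_distrib, ← Finset.sum_mul] at h1
    have := mul_le_mul_of_nonneg_right hω.2 hε0
    linarith
  have hn : (0 : ℝ) ≤ n := Nat.cast_nonneg n
  have hbI : b * n * (∫ y in cube d 0 1, cubeDiff m f y ^ 2) ≤
      b * n * (∫ y in cube d 0 1, cubeDiff m g y ^ 2) + n * (5 * F * ε) := by
    have h1 := mul_le_mul_of_nonneg_left hI (mul_nonneg hb0 hn)
    have h2 : b * n * (5 * F * ε) ≤ 1 * n * (5 * F * ε) := by gcongr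
    linarith
  -- The constant 16 F is 5 F for the integral (using b ≤ 1), 5 F for the squares, and 2 · 3 for the
  -- noise on the good event.
  rw [excess, excess]
  have h7 : n * ε ≤ F * n * ε := by
    have : 0 ≤ n * ε := by positivity
    nlinarith
  nlinarith

/-- The basic inequality for a minimizer of the penalized risk. -/
lemma basic_inequality {n : ℕ} (hn : 0 < n) {lam τ : ℝ} {f f' : Net d}
    {ω : (Fin d → ℝ) × (ℕ → ℝ)}
    (h : penalizedRisk lam τ (arSample m n ω) f ≤ penalizedRisk lam τ (arSample m n ω) f') :
    ∑ s ∈ Finset.range n, cubeDiff m f.eval (arX m ω s) ^ 2 -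
      2 * ∑ s ∈ Finset.range n, ω.2 s * cubeDiff m f.eval (arX m ω s) + n * lam * f.clipNorm τ ≤
    ∑ s ∈ Finset.range n, cubeDiff m f'.eval (arX m ω s) ^ 2 -
      2 * ∑ s ∈ Finset.range n, ω.2 s * cubeDiff m f'.eval (arX m ω s) +
        n * lam * f'.clipNorm τ := by
  -- In the cube the residual is v - h, whose square expands; outside it g contributes nothing. The
  -- first sum does not depend on g and cancels when two networks are compared.
  have key : ∀ g : Net d, penalizedRisk lam τ (arSample m n ω) g * n =
      ∑ s ∈ Finset.range n, (arY m ω s - (cube d 0 1).indicator m (arX m ω s)) ^ 2 +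
      (∑ s ∈ Finset.range n, cubeDiff m g.eval (arX m ω s) ^ 2 -
      2 * ∑ s ∈ Finset.range n, ω.2 s * cubeDiff m g.eval (arX m ω s)) +
      n * lam * g.clipNorm τ := by
    intro g
    have hn' : (n : ℝ) ≠ 0 := by positivity
    have h1 : ∑ t : Fin n, ((arSample m n ω t).2 - g.toFun (arSample m n ω t).1) ^ 2 =
        ∑ s ∈ Finset.range n, (arY m ω s - g.toFun (arX m ω s)) ^ 2 := by
      rw [Finset.sum_range]
      rfl
    rw [penalizedRisk, h1, Finset.mul_sum _ _ (2 : ℝ), ← Finset.sum_sub_distrib,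
      ← Finset.sum_add_distrib]
    have h2 : ∀ s ∈ Finset.range n, (arY m ω s - (cube d 0 1).indicator m (arX m ω s)) ^ 2 +
        (cubeDiff m g.eval (arX m ω s) ^ 2 - 2 * (ω.2 s * cubeDiff m g.eval (arX m ω s))) =
        (arY m ω s - g.toFun (arX m ω s)) ^ 2 := by
      intro s _
      by_cases hx : arX m ω s ∈ cube d 0 1
      · rw [cubeDiff_of_mem hx, Net.toFun, Set.indicator_of_mem hx, Set.indicator_of_mem hx, arY]
        ring
      · rw [cubeDiff_of_notMem hx, Net.toFun, Set.indicator_of_notMem hx,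
          Set.indicator_of_notMem hx]
        ring
    rw [Finset.sum_congr rfl h2]
    field_simp
  have h1 := mul_le_mul_of_nonneg_right h (Nat.cast_nonneg (α := ℝ) n)
  rw [key, key] at h1
  linarith

/-- By independence the estimator can be frozen. From time d on the copy has a density at most one,
so each term is bounded by the integral over the cube; the first d terms are bounded trivially by 4
F² each. -/
lemma genError_le (ν : Measure (Fin d → ℝ)) [IsProbabilityMeasure ν] (hm : Measurable m) {F : ℝ}
    (hF : 0 ≤ F) (hmF : ∀ x ∈ cube d 0 1, |m x| ≤ F) {n : ℕ} (hn : 0 < n)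
    {fhat : Sample d n → (Fin d → ℝ) → ℝ} (hmeas : Measurable (Function.uncurry fhat))
    (hrep : ∀ z, ∃ f : Net d, (∀ x ∈ cube d 0 1, |f.eval x| ≤ F) ∧ fhat z = f.toFun) :
    genError ν m n fhat ≤ ENNReal.ofReal (4 * F ^ 2 * d / n) +
      ∫⁻ ω, ENNReal.ofReal (∫ y in cube d 0 1, cubeDiff m (fhat (arSample m n ω)) y ^ 2)
        ∂(arLaw ν) := by
  have hn' : (0 : ℝ) < n := Nat.cast_pos.2 hn
  have hcube := measurableSet_cube d 0 1
  have hdiff : ∀ z x, fhat z x - (cube d 0 1).indicator m x = cubeDiff m (fhat z) x := by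
    intro z x
    obtain ⟨f, -, hf⟩ := hrep z
    by_cases hx : x ∈ cube d 0 1
    · rw [cubeDiff_of_mem hx, Set.indicator_of_mem hx]
    · rw [cubeDiff_of_notMem hx, Set.indicator_of_notMem hx, hf, Net.toFun,
        Set.indicator_of_notMem hx, sub_zero]
  have hbd : ∀ z x, cubeDiff m (fhat z) x ^ 2 ≤ 4 * F ^ 2 := by
    intro z x
    obtain ⟨f, hfF, hf⟩ := hrep z
    have : |cubeDiff m (fhat z) x| ≤ 2 * F := by
      refine abs_cubeDiff_le (by linarith) (fun x hx => ?_) x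
      rw [hf, Net.toFun, Set.indicator_of_mem hx]
      linarith [abs_sub (f.eval x) (m x), hfF x hx, hmF x hx]
    rw [← sq_abs]
    nlinarith [abs_nonneg (cubeDiff m (fhat z) x)]
  have hjm : Measurable fun p : Sample d n × (Fin d → ℝ) => cubeDiff m (fhat p.1) p.2 ^ 2 := by
    have : (fun p : Sample d n × (Fin d → ℝ) => cubeDiff m (fhat p.1) p.2 ^ 2) =
        fun p => (Function.uncurry fhat p - (cube d 0 1).indicator m p.2) ^ 2 := by
      funext p
      rw [← hdiff]
      rfl
    rw [this]
    exact (hmeas.sub ((hm.indicator hcube).comp measurable_snd)).pow_const 2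
  have hzm : ∀ z, Measurable fun x => cubeDiff m (fhat z) x ^ 2 := fun z =>
    hjm.comp measurable_prodMk_left
  rw [genError]
  simp only [hdiff]
  have hbig : Measurable fun ω : ((Fin d → ℝ) × (ℕ → ℝ)) × ((Fin d → ℝ) × (ℕ → ℝ)) =>
      ENNReal.ofReal (1 / (n : ℝ) * ∑ t : Fin n,
        cubeDiff m (fhat (arSample m n ω.1)) (arX m ω.2 t) ^ 2) := by
    refine ((Finset.measurable_sum _ fun t _ => ?_).const_mul _).ennreal_ofReal
    exact hjm.comp (((measurable_arSample hm n).comp measurable_fst).prodMk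
      ((measurable_arX hm t).comp measurable_snd))
  rw [lintegral_prod _ hbig.aemeasurable]
  have hinner : ∀ z, ∫⁻ ω, ENNReal.ofReal (1 / (n : ℝ) * ∑ t : Fin n,
      cubeDiff m (fhat z) (arX m ω t) ^ 2) ∂(arLaw ν) ≤ ENNReal.ofReal (4 * F ^ 2 * d / n) +
      ENNReal.ofReal (∫ y in cube d 0 1, cubeDiff m (fhat z) y ^ 2) := by
    intro z
    set g : (Fin d → ℝ) → ℝ := fun y => cubeDiff m (fhat z) y ^ 2 with hg
    set I : ℝ := ∫ y in cube d 0 1, g y with hI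
    have hg0 : ∀ y, 0 ≤ g y := fun y => sq_nonneg _
    have hI0 : 0 ≤ I := integral_nonneg hg0
    have hgint : IntegrableOn g (cube d 0 1) volume :=
      Measure.integrableOn_of_bounded (M := 4 * F ^ 2) (by simp [volume_cube])
        (hzm z).aestronglyMeasurable (ae_of_all _ fun x => by
          rw [Real.norm_of_nonneg (hg0 x)]; exact hbd z x)
    have hterm : ∀ t : ℕ, ∫⁻ ω, ENNReal.ofReal (g (arX m ω t)) ∂(arLaw ν) ≤
        ENNReal.ofReal (if t < d then 4 * F ^ 2 else I) := by
      intro t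
      refine lintegral_arLaw_le ν ((hzm z).comp (measurable_arX hm t)).ennreal_ofReal fun x => ?_
      split_ifs with ht
      · calc _ ≤ ∫⁻ _, ENNReal.ofReal (4 * F ^ 2) ∂noiseLaw :=
              lintegral_mono fun v => ENNReal.ofReal_le_ofReal (hbd z _)
          _ = _ := by simp
      · refine (lintegral_arX_le hm (hzm z).ennreal_ofReal t (not_lt.1 ht) x).trans ?_
        rw [hI, ofReal_integral_eq_lintegral_ofReal hgint (ae_of_all _ hg0),
          ← lintegral_indicator hcube]
        refine lintegral_mono fun y => ?_
        by_cases hy : y ∈ cube d 0 1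
        · rw [Set.indicator_of_mem hy]
        · have : g y = 0 := by simp only [hg]; rw [cubeDiff_of_notMem hy]; ring
          simp [hy, cubeDiff_of_notMem hy]
    have hsplit : ∀ ω, ENNReal.ofReal (1 / (n : ℝ) * ∑ t : Fin n, g (arX m ω t)) =
        ENNReal.ofReal (1 / n) * ∑ t : Fin n, ENNReal.ofReal (g (arX m ω t)) := by
      intro ω
      rw [ENNReal.ofReal_mul (by positivity), ENNReal.ofReal_sum_of_nonneg fun t _ => hg0 _]
    change ∫⁻ ω, ENNReal.ofReal (1 / (n : ℝ) * ∑ t : Fin n, g (arX m ω t)) ∂(arLaw ν) ≤ _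
    simp only [hsplit]
    rw [lintegral_const_mul' _ _ ENNReal.ofReal_ne_top, lintegral_finsetSum]
    · calc _ ≤ ENNReal.ofReal (1 / n) * ∑ t : Fin n, ENNReal.ofReal (if (t : ℕ) < d then 4 * F ^ 2 else I) := by
            gcongr with t _
            exact hterm t
        _ = ENNReal.ofReal (1 / n * ∑ t : Fin n, (if (t : ℕ) < d then 4 * F ^ 2 else I)) := by
            rw [ENNReal.ofReal_mul (by positivity), ENNReal.ofReal_sum_of_nonneg]
            intro t _
            split_ifs <;> positivity
        _ ≤ ENNReal.ofReal (4 * F ^ 2 * d / n + I) := by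
            refine ENNReal.ofReal_le_ofReal ?_
            have h1 : ∑ t : Fin n, (if (t : ℕ) < d then 4 * F ^ 2 else I) ≤
                4 * F ^ 2 * d + n * I := by
              rw [Fin.sum_univ_eq_sum_range (fun t => if t < d then 4 * F ^ 2 else I) n]
              calc _ ≤ ∑ t ∈ Finset.range n, ((if t < d then 4 * F ^ 2 else 0) + I) := by
                    refine Finset.sum_le_sum fun t _ => ?_
                    split_ifs <;> linarith
                _ ≤ _ := by
                    rw [Finset.sum_add_distrib, ← Finset.sum_filter]
                    simp only [Finset.sum_const, nsmul_eq_mul, Finset.card_range]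
                    have h2 : (((Finset.range n).filter (· < d)).card : ℝ) ≤ d := by
                      have : ((Finset.range n).filter (· < d)).card ≤ (Finset.range d).card := by
                        refine Finset.card_le_card fun t ht => ?_
                        simp only [Finset.mem_filter] at ht
                        exact Finset.mem_range.2 ht.2
                      rw [Finset.card_range] at this
                      exact_mod_cast this
                    have : (0 : ℝ) ≤ 4 * F ^ 2 := by positivity
                    nlinarith
            calc _ ≤ 1 / n * (4 * F ^ 2 * d + n * I) := by gcongr
              _ = _ := by field_simp
        _ = _ := ENNReal.ofReal_add (by positivity) hI0
    · exact fun t _ => ((hzm z).comp (measurable_arX hm t)).ennreal_ofReal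
  calc _ ≤ ∫⁻ ω, (ENNReal.ofReal (4 * F ^ 2 * d / n) + ENNReal.ofReal
        (∫ y in cube d 0 1, cubeDiff m (fhat (arSample m n ω)) y ^ 2)) ∂(arLaw ν) :=
        lintegral_mono fun ω => hinner _
    _ = _ := by
        rw [lintegral_add_left measurable_const]
        simp

end

end SparseDNN

namespace SparseDNN

/-! ### The penalty pays for the selection: oracle inequality over a weighted family. -/

section

variable {d : ℕ} {m : (Fin d → ℝ) → ℝ}

lemma measurable_integral_cubeDiff (hm : Measurable m) {n : ℕ}
    {fhat : Sample d n → (Fin d → ℝ) → ℝ} (hmeas : Measurable (Function.uncurry fhat)) :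
    Measurable fun ω : (Fin d → ℝ) × (ℕ → ℝ) =>
      ∫ y in cube d 0 1, cubeDiff m (fhat (arSample m n ω)) y ^ 2 := by
  have h : Measurable fun p : ((Fin d → ℝ) × (ℕ → ℝ)) × (Fin d → ℝ) =>
      (cube d 0 1).indicator (fun y => fhat (arSample m n p.1) y - m y) p.2 := by
    have h1 : Measurable fun p : ((Fin d → ℝ) × (ℕ → ℝ)) × (Fin d → ℝ) =>
        fhat (arSample m n p.1) p.2 - m p.2 :=
      (hmeas.comp (((measurable_arSample hm n).comp measurable_fst).prodMk measurable_snd)).sub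
        (hm.comp measurable_snd)
    exact h1.indicator (measurable_snd (measurableSet_cube d 0 1))
  exact ((h.pow_const 2).stronglyMeasurable.integral_prod_right').measurable

/-- An oracle inequality for a minimizer of the penalized risk, in terms of a weighted finite
family that approximates all candidate networks. -/
lemma genError_le_of_family (ν : Measure (Fin d → ℝ)) [IsProbabilityMeasure ν]
    (hν : Integrable (fun x => ‖x‖) ν) (hm : Measurable m) (hd : 0 < d) {F : ℝ} (hF : 1 ≤ F)
    (hmF : ∀ x ∈ cube d 0 1, |m x| ≤ F) {R κ : ℝ} (hR : 1 ≤ R) (hκ0 : 0 < κ) (hκ1 : κ ≤ 1)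
    (hκ : ∀ x, ‖x‖ ≤ R → ∀ y ∈ Set.Icc (0 : ℝ) 1, κ ≤ gaussianPDFReal (m x) 1 y)
    {n : ℕ} (hn : 0 < n)
    (hgood : ∀ ω ∈ goodEvent d n, (n : ℝ) / (4 * d) ≤ ∑ k ∈ Finset.range ((n - 1) / d),
          (if ‖arX m ω (k * d)‖ ≤ R then (1 : ℝ) else 0))
    {L N B lam τ : ℝ} (hτ : 0 < τ) (hlam : 0 ≤ lam) {fhat : Sample d n → (Fin d → ℝ) → ℝ}
    (hfhat : IsSparsePenalizedEstimator L N B F lam τ fhat)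
    {ι : Type*} [Fintype ι] {φ : ι → (Fin d → ℝ) → ℝ} {w : ι → ℝ}
    (hφm : ∀ i, Measurable (φ i)) (hφF : ∀ i, ∀ x ∈ cube d 0 1, |φ i x| ≤ F + 1)
    (hw0 : ∀ i, 0 ≤ w i) (hw1 : ∑ i, w i ≤ 1) {K K₀ ε : ℝ} (hK₀ : 0 ≤ K₀) (hε : 0 ≤ ε)
    (hK : K ≤ 1 / (8 * (3 * F) ^ 2) * (n * lam))
    (hcover : ∀ f ∈ netClass d L N B F, ∃ i, (∀ x ∈ cube d 0 1, |f.eval x - φ i x| ≤ ε) ∧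
      Real.exp (-K * f.clipNorm τ - K₀) ≤ w i)
    {f' : Net d} (hf' : f' ∈ netClass d L N B F) {δ : ℝ}
    (hδ : ∀ x ∈ cube d 0 1, |f'.eval x - m x| ≤ δ) :
    genError ν m n fhat ≤ ENNReal.ofReal (4 * F ^ 2 * d / n +
      4 * F ^ 2 * ((1 + ∫ x, ‖x‖ ∂ν) / n) + 1 / (κ ^ d / (16 * d) * n) *
        (3 * n * δ ^ 2 + n * lam * f'.clipNorm τ + 1 + 8 * (3 * F) ^ 2 * (1 + K₀) +
          16 * F * n * ε)) := by
  obtain ⟨hmeas, hmin⟩ := hfhat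
  set η : ℝ := 1 / (8 * (3 * F) ^ 2) with hη
  have hη0 : 0 < η := by positivity
  set b : ℝ := κ ^ d / (16 * d) with hb
  have hd' : (0 : ℝ) < d := Nat.cast_pos.2 hd
  have hd1 : (1 : ℝ) ≤ d := by exact_mod_cast hd
  have hn' : (0 : ℝ) < n := Nat.cast_pos.2 hn
  have hb0 : 0 < b := by positivity
  have hb1 : b ≤ 1 := by
    rw [hb, div_le_one (by positivity)]
    have := pow_le_one₀ (n := d) hκ0.le hκ1
    linarith
  have hIm := measurable_integral_cubeDiff hm hmeas
  set I : (Fin d → ℝ) × (ℕ → ℝ) → ℝ := fun ω =>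
    ∫ y in cube d 0 1, cubeDiff m (fhat (arSample m n ω)) y ^ 2 with hI
  have hν0 : 0 ≤ ∫ x, ‖x‖ ∂ν := integral_nonneg fun _ => norm_nonneg _
  have hFn : 0 ≤ F := by linarith
  have hrep : ∀ z, ∃ f : Net d, (∀ x ∈ cube d 0 1, |f.eval x| ≤ F) ∧ fhat z = f.toFun :=
    fun z => by
      obtain ⟨f, hf, hfz, -⟩ := hmin z
      exact ⟨f, hf.2.2.2.2, hfz⟩
  have hIbound : ∀ ω, I ω ≤ 4 * F ^ 2 := by
    intro ω
    obtain ⟨f, hfF, hf⟩ := hrep (arSample m n ω)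
    have hbd : ∀ x, cubeDiff m (fhat (arSample m n ω)) x ^ 2 ≤ 4 * F ^ 2 := by
      intro x
      have : |cubeDiff m (fhat (arSample m n ω)) x| ≤ 2 * F := by
        refine abs_cubeDiff_le (by linarith) (fun x hx => ?_) x
        rw [hf, Net.toFun, Set.indicator_of_mem hx]
        linarith [abs_sub (f.eval x) (m x), hfF x hx, hmF x hx]
      rw [← sq_abs]
      nlinarith [abs_nonneg (cubeDiff m (fhat (arSample m n ω)) x)]
    have h1 : I ω ≤ ∫ _ in cube d 0 1, 4 * F ^ 2 := by
      refine integral_mono_of_nonneg (ae_of_all _ fun _ => sq_nonneg _)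
        (integrableOn_const (by simp [volume_cube])) (ae_of_all _ hbd)
    simpa [volume_cube, Measure.real] using h1
  set G := goodEvent d n with hG
  have hGm : MeasurableSet G := measurableSet_goodEvent n
  have hφ2 : ∀ i x, |cubeDiff m (φ i) x| ≤ 3 * F := fun i => abs_cubeDiff_le (by linarith)
    fun x hx => by linarith [abs_sub (φ i x) (m x), hφF i x hx, hmF x hx]
  -- exponential terms
  set E₁ : (Fin d → ℝ) × (ℕ → ℝ) → ℝ := fun ω => Real.exp (∑ s ∈ Finset.range n,
    (-2 * cubeDiff m f'.eval (arX m ω s) * ω.2 s -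
      (-2 * cubeDiff m f'.eval (arX m ω s)) ^ 2 / 2)) with hE₁
  set E₂ : ι → (Fin d → ℝ) × (ℕ → ℝ) → ℝ := fun i ω =>
    Real.exp (η * excess b m (cubeDiff m (φ i)) n ω) with hE₂
  have hf'm := measurable_cubeDiff hm f'.continuous_eval.measurable
  have hE₁i : ∫⁻ ω, ENNReal.ofReal (E₁ ω) ∂(arLaw ν) ≤ 1 :=
    lintegral_exp_noise_le_one ν hm hf'm (-2) n
  have hE₂i : ∀ i, ∫⁻ ω in G, ENNReal.ofReal (E₂ i ω) ∂(arLaw ν) ≤ 1 := fun i =>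
    lintegral_exp_excess_le_one ν hm hd (measurable_cubeDiff hm (hφm i)) (by linarith) (hφ2 i) hR
      hκ0.le hκ n hgood
  have hE₁m : Measurable E₁ := by
    refine Real.measurable_exp.comp (Finset.measurable_sum _ fun s _ => ?_)
    have := hf'm.comp (measurable_arX hm s)
    exact ((this.const_mul _).mul (measurable_noise s)).sub
      (((this.const_mul _).pow_const 2).div_const 2)
  have hE₂m : ∀ i, Measurable (E₂ i) := fun i => Real.measurable_exp.comp
    ((measurable_excess b hm (measurable_cubeDiff hm (hφm i)) n).const_mul _)
  set c₁ : ℝ := 3 * n * δ ^ 2 + n * lam * f'.clipNorm τ + 8 * (3 * F) ^ 2 * K₀ + 16 * F * n * ε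
    with hc₁
  -- A pathwise bound. The right-hand side has random terms `E₁` and `E₂` built from fixed functions
  -- only, so expectations can be taken although the selected network depends on the sample.
  have hpt : ∀ ω ∈ G, b * n * I ω ≤ c₁ + E₁ ω + 8 * (3 * F) ^ 2 * ∑ i, w i * E₂ i ω := by
    intro ω hω
    obtain ⟨f, hf, hfz, hfmin⟩ := hmin (arSample m n ω)
    obtain ⟨i, hfi, hwi⟩ := hcover f hf
    have hbasic := basic_inequality (m := m) hn (hfmin f' hf')
    have hclip := f.clipNorm_nonneg hτ.le
    have hIf : I ω = ∫ y in cube d 0 1, cubeDiff m f.eval y ^ 2 := by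
      simp only [hI]
      congr 1
      funext y
      by_cases hy : y ∈ cube d 0 1
      · rw [cubeDiff_of_mem hy, cubeDiff_of_mem hy, hfz, Net.toFun, Set.indicator_of_mem hy]
      · rw [cubeDiff_of_notMem hy, cubeDiff_of_notMem hy]
    have hex := excess_le_excess_add hb0.le hb1 hF hε hm f.continuous_eval.measurable (hφm i) hmF
      hf.2.2.2.2 (hφF i) hfi hω
    have hsq : ∑ s ∈ Finset.range n, cubeDiff m f'.eval (arX m ω s) ^ 2 ≤ n * δ ^ 2 := by
      have : ∀ s ∈ Finset.range n, cubeDiff m f'.eval (arX m ω s) ^ 2 ≤ δ ^ 2 := by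
        intro s _
        by_cases hx : arX m ω s ∈ cube d 0 1
        · rw [cubeDiff_of_mem hx, ← sq_abs]
          gcongr
          exact hδ _ hx
        · rw [cubeDiff_of_notMem hx]
          simpa using sq_nonneg δ
      refine (Finset.sum_le_sum this).trans ?_
      simp
    -- The noise of the comparison network is an exponent of the noise martingale plus 2 ∑ h²; with
    -- the ∑ h² of its own risk this makes 3 n δ².
    have hE₁le : -(2 * ∑ s ∈ Finset.range n, ω.2 s * cubeDiff m f'.eval (arX m ω s)) ≤
        E₁ ω + 2 * ∑ s ∈ Finset.range n, cubeDiff m f'.eval (arX m ω s) ^ 2 := by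
      have h1 := Real.add_one_le_exp (∑ s ∈ Finset.range n,
        (-2 * cubeDiff m f'.eval (arX m ω s) * ω.2 s -
          (-2 * cubeDiff m f'.eval (arX m ω s)) ^ 2 / 2))
      have h2 : ∑ s ∈ Finset.range n, (-2 * cubeDiff m f'.eval (arX m ω s) * ω.2 s -
          (-2 * cubeDiff m f'.eval (arX m ω s)) ^ 2 / 2) =
          -(2 * ∑ s ∈ Finset.range n, ω.2 s * cubeDiff m f'.eval (arX m ω s)) -
            2 * ∑ s ∈ Finset.range n, cubeDiff m f'.eval (arX m ω s) ^ 2 := by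
        rw [Finset.mul_sum _ _ (2 : ℝ), Finset.mul_sum _ _ (2 : ℝ), ← Finset.sum_neg_distrib,
          ← Finset.sum_sub_distrib]
        exact Finset.sum_congr rfl fun s _ => by ring
      simp only [hE₁]
      linarith
    -- The selected member of the family is one summand of ∑ w_i E₂_i, and its weight is at least
    -- exp(-K clipNorm - K₀). Since K ≤ η n lam, the penalty of the estimator covers K clipNorm;
    -- what is left is K₀ and a sum of mean at most one on the good event.
    have hE₂le : excess b m (cubeDiff m (φ i)) n ω - n * lam * f.clipNorm τ ≤
        8 * (3 * F) ^ 2 * (∑ i, w i * E₂ i ω + K₀) := by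
      have h1 : Real.exp (η * excess b m (cubeDiff m (φ i)) n ω - K * f.clipNorm τ - K₀) ≤
          ∑ i, w i * E₂ i ω := by
        refine le_trans ?_ (Finset.single_le_sum (f := fun i => w i * E₂ i ω)
          (fun i _ => mul_nonneg (hw0 i) (Real.exp_pos _).le) (Finset.mem_univ i))
        rw [show η * excess b m (cubeDiff m (φ i)) n ω - K * f.clipNorm τ - K₀ =
          (-K * f.clipNorm τ - K₀) + η * excess b m (cubeDiff m (φ i)) n ω by ring, Real.exp_add]
        exact mul_le_mul_of_nonneg_right hwi (Real.exp_pos _).le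
      have h2 := Real.add_one_le_exp
        (η * excess b m (cubeDiff m (φ i)) n ω - K * f.clipNorm τ - K₀)
      have h3 := mul_le_mul_of_nonneg_right hK hclip
      have h4 : η * (excess b m (cubeDiff m (φ i)) n ω - n * lam * f.clipNorm τ) ≤
          ∑ i, w i * E₂ i ω + K₀ := by linarith
      have h5 : 8 * (3 * F) ^ 2 * η = 1 := by rw [hη]; field_simp
      calc _ = 8 * (3 * F) ^ 2 * (η * (excess b m (cubeDiff m (φ i)) n ω -
            n * lam * f.clipNorm τ)) := by rw [← mul_assoc, h5, one_mul]
        _ ≤ _ := mul_le_mul_of_nonneg_left h4 (by positivity)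
    have hexf : excess b m (cubeDiff m f.eval) n ω = b * n * I ω -
        ∑ s ∈ Finset.range n, cubeDiff m f.eval (arX m ω s) ^ 2 +
        2 * ∑ s ∈ Finset.range n, ω.2 s * cubeDiff m f.eval (arX m ω s) := by
      rw [hIf, excess]
    rw [hc₁]
    linarith
  have hclip' : 0 ≤ f'.clipNorm τ := f'.clipNorm_nonneg hτ.le
  have hc₁0 : 0 ≤ c₁ := by positivity
  have hI0 : ∀ ω, 0 ≤ I ω := fun ω => integral_nonneg fun _ => sq_nonneg _
  have hIG : ∫⁻ ω in G, ENNReal.ofReal (I ω) ∂(arLaw ν) ≤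
      ENNReal.ofReal (1 / (b * n)) * (ENNReal.ofReal c₁ + 1 + ENNReal.ofReal (8 * (3 * F) ^ 2)) := by
    calc _ ≤ ∫⁻ ω in G, ENNReal.ofReal (1 / (b * n)) * (ENNReal.ofReal c₁ +
          ENNReal.ofReal (E₁ ω) + ENNReal.ofReal (8 * (3 * F) ^ 2) *
            ∑ i, ENNReal.ofReal (w i) * ENNReal.ofReal (E₂ i ω)) ∂(arLaw ν) := by
          refine setLIntegral_mono' hGm fun ω hω => ?_
          have h1 : ∑ i, ENNReal.ofReal (w i) * ENNReal.ofReal (E₂ i ω) =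
              ENNReal.ofReal (∑ i, w i * E₂ i ω) := by
            rw [ENNReal.ofReal_sum_of_nonneg fun i _ => mul_nonneg (hw0 i) (Real.exp_pos _).le]
            exact Finset.sum_congr rfl fun i _ => (ENNReal.ofReal_mul (hw0 i)).symm
          rw [h1, ← ENNReal.ofReal_mul (by positivity)]
          have h2 : I ω = 1 / (b * n) * (b * n * I ω) := by field_simp
          rw [h2, ENNReal.ofReal_mul (by positivity)]
          gcongr
          refine (ENNReal.ofReal_le_ofReal (hpt ω hω)).trans ?_
          exact ENNReal.ofReal_add_le.trans (add_le_add_left ENNReal.ofReal_add_le _)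
      _ = ENNReal.ofReal (1 / (b * n)) * (ENNReal.ofReal c₁ * arLaw ν G +
          ∫⁻ ω in G, ENNReal.ofReal (E₁ ω) ∂(arLaw ν) + ENNReal.ofReal (8 * (3 * F) ^ 2) *
            ∑ i, ENNReal.ofReal (w i) * ∫⁻ ω in G, ENNReal.ofReal (E₂ i ω) ∂(arLaw ν)) := by
          have hE₁m' := hE₁m.ennreal_ofReal
          rw [lintegral_const_mul' _ _ ENNReal.ofReal_ne_top,
            lintegral_add_left (f := fun ω => ENNReal.ofReal c₁ + ENNReal.ofReal (E₁ ω))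
              (measurable_const.add hE₁m'),
            lintegral_add_left measurable_const, setLIntegral_const,
            lintegral_const_mul' _ _ ENNReal.ofReal_ne_top, lintegral_finsetSum]
          · simp only [lintegral_const_mul' _ _ ENNReal.ofReal_ne_top]
          · exact fun i _ => (hE₂m i).ennreal_ofReal.const_mul _
      _ ≤ _ := by
          have h1 : ∑ i, ENNReal.ofReal (w i) * ∫⁻ ω in G, ENNReal.ofReal (E₂ i ω) ∂(arLaw ν) ≤ 1 := by
            calc _ ≤ ∑ i, ENNReal.ofReal (w i) * 1 := by
                  gcongr with i _
                  exact hE₂i i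
              _ = ENNReal.ofReal (∑ i, w i) := by
                  simp only [mul_one]
                  rw [ENNReal.ofReal_sum_of_nonneg fun i _ => hw0 i]
              _ ≤ 1 := ENNReal.ofReal_le_one.2 hw1
          have h2 : ∫⁻ ω in G, ENNReal.ofReal (E₁ ω) ∂(arLaw ν) ≤ 1 :=
            (setLIntegral_le_lintegral _ _).trans hE₁i
          have h3 : ENNReal.ofReal c₁ * arLaw ν G ≤ ENNReal.ofReal c₁ :=
            mul_le_of_le_one_right' prob_le_one
          have h4 : ENNReal.ofReal (8 * (3 * F) ^ 2) * ∑ i, ENNReal.ofReal (w i) *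
              ∫⁻ ω in G, ENNReal.ofReal (E₂ i ω) ∂(arLaw ν) ≤ ENNReal.ofReal (8 * (3 * F) ^ 2) :=
            mul_le_of_le_one_right' h1
          exact mul_le_mul_right (add_le_add (add_le_add h3 h2) h4) _
  -- On the bad event only the trivial bound 4 F² is used; its probability is already O(1/n).
  have hIGc : ∫⁻ ω in Gᶜ, ENNReal.ofReal (I ω) ∂(arLaw ν) ≤
      ENNReal.ofReal (4 * F ^ 2 * ((1 + ∫ x, ‖x‖ ∂ν) / n)) := by
    calc _ ≤ ∫⁻ ω in Gᶜ, ENNReal.ofReal (4 * F ^ 2) ∂(arLaw ν) :=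
          lintegral_mono fun ω => ENNReal.ofReal_le_ofReal (hIbound ω)
      _ = ENNReal.ofReal (4 * F ^ 2) * arLaw ν Gᶜ := setLIntegral_const _ _
      _ ≤ ENNReal.ofReal (4 * F ^ 2) * ENNReal.ofReal ((1 + ∫ x, ‖x‖ ∂ν) / n) := by
          gcongr
          exact measure_compl_goodEvent_le ν hν n hn
      _ = _ := (ENNReal.ofReal_mul (by positivity)).symm
  refine (genError_le ν hm hFn hmF hn hmeas hrep).trans ?_
  rw [← lintegral_add_compl _ hGm]
  have hfinal : ENNReal.ofReal (1 / (b * n)) * (ENNReal.ofReal c₁ + 1 +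
      ENNReal.ofReal (8 * (3 * F) ^ 2)) ≤ ENNReal.ofReal (1 / (b * n) *
        (3 * n * δ ^ 2 + n * lam * f'.clipNorm τ + 1 + 8 * (3 * F) ^ 2 * (1 + K₀) +
          16 * F * n * ε)) := by
    rw [← ENNReal.ofReal_one, ← ENNReal.ofReal_add hc₁0 zero_le_one,
      ← ENNReal.ofReal_add (by positivity) (by positivity), ← ENNReal.ofReal_mul (by positivity)]
    refine ENNReal.ofReal_le_ofReal (le_of_eq ?_)
    rw [hc₁]
    ring
  calc _ ≤ ENNReal.ofReal (4 * F ^ 2 * d / n) + (ENNReal.ofReal (1 / (b * n) *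
        (3 * n * δ ^ 2 + n * lam * f'.clipNorm τ + 1 + 8 * (3 * F) ^ 2 * (1 + K₀) +
          16 * F * n * ε)) + ENNReal.ofReal (4 * F ^ 2 * ((1 + ∫ x, ‖x‖ ∂ν) / n))) := by
        gcongr
        exact hIG.trans hfinal
    _ = _ := by
        rw [← ENNReal.ofReal_add (by positivity) (by positivity),
          ← ENNReal.ofReal_add (by positivity) (by positivity)]
        congr 1
        ring

end

end SparseDNN

namespace SparseDNN

/-! ### Quantized networks -/

/-- Apply a function to all parameters of a network. -/
def Net.map (r : ℝ → ℝ) : {p : ℕ} → Net p → Net p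
  | _, .output w b => .output (fun i => r (w i)) (r b)
  | _, .hidden W b rest => .hidden (fun i j => r (W i j)) (fun i => r (b i)) (rest.map r)

lemma Net.params_map (r : ℝ → ℝ) : ∀ {p : ℕ} (f : Net p), (f.map r).params = f.params.map r
  | _, .output w b => by simp [Net.map, Net.params, Function.comp_def]
  | _, .hidden W b rest => by
    simp [Net.map, Net.params, Multiset.map_map, Function.comp_def, Net.params_map r rest]

lemma Net.hiddenWidths_map (r : ℝ → ℝ) :
    ∀ {p : ℕ} (f : Net p), (f.map r).hiddenWidths = f.hiddenWidths
  | _, .output w b => rfl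
  | _, .hidden W b rest => by simp [Net.map, Net.hiddenWidths, Net.hiddenWidths_map r rest]

lemma abs_affine_sub_le {p : ℕ} {w w' x x' : Fin p → ℝ} {b b' B R e δ : ℝ} (hB : 0 ≤ B)
    (hw : ∀ i, |w i| ≤ B) (hww : ∀ i, |w i - w' i| ≤ δ) (hbb : |b - b'| ≤ δ)
    (hx' : ∀ i, |x' i| ≤ R) (hxx : ∀ i, |x i - x' i| ≤ e) :
    |(w ⬝ᵥ x + b) - (w' ⬝ᵥ x' + b')| ≤ p * (B * e + δ * R) + δ := by
  have h1 : (w ⬝ᵥ x + b) - (w' ⬝ᵥ x' + b') =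
      ∑ i, (w i * (x i - x' i) + (w i - w' i) * x' i) + (b - b') := by
    simp only [dotProduct]
    rw [show ∀ s t : ℝ, (s + b) - (t + b') = (s - t) + (b - b') from fun s t => by ring,
      ← Finset.sum_sub_distrib]
    congr 1
    exact Finset.sum_congr rfl fun i _ => by ring
  rw [h1]
  refine (abs_add_le _ _).trans (add_le_add ((Finset.abs_sum_le_sum_abs _ _).trans ?_) hbb)
  calc _ ≤ ∑ _i : Fin p, (B * e + δ * R) := by
        refine Finset.sum_le_sum fun i _ => (abs_add_le _ _).trans ?_
        rw [abs_mul, abs_mul]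
        have hδ := (abs_nonneg _).trans (hww i)
        exact add_le_add (mul_le_mul (hw i) (hxx i) (abs_nonneg _) hB)
          (mul_le_mul (hww i) (hx' i) (abs_nonneg _) hδ)
    _ = _ := by simp [mul_add]

lemma abs_affine_le {p : ℕ} {w x : Fin p → ℝ} {b B R : ℝ} (hB : 0 ≤ B) (hw : ∀ i, |w i| ≤ B)
    (hb : |b| ≤ B) (hx : ∀ i, |x i| ≤ R) : |w ⬝ᵥ x + b| ≤ p * (B * R) + B := by
  refine (abs_add_le _ _).trans (add_le_add ((Finset.abs_sum_le_sum_abs _ _).trans ?_) hb)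
  calc _ ≤ ∑ _i : Fin p, B * R := by
        refine Finset.sum_le_sum fun i _ => ?_
        rw [abs_mul]
        exact mul_le_mul (hw i) (hx i) (abs_nonneg _) hB
    _ = _ := by simp

/-- Perturbing the parameters of a network. -/
lemma Net.abs_eval_sub_eval_map_le {r : ℝ → ℝ} {B δ N : ℝ} (hB : 1 ≤ B) (hδ : 0 ≤ δ)
    (hN : 0 ≤ N) (hr : ∀ θ, |θ| ≤ B → |θ - r θ| ≤ δ) (hrB : ∀ θ, |θ| ≤ B → |r θ| ≤ B) :
    ∀ {p : ℕ} (f : Net p), (p : ℝ) ≤ N → (∀ w ∈ f.hiddenWidths, (w : ℝ) ≤ N) →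
      (∀ θ ∈ f.params, |θ| ≤ B) → ∀ {x x' : Fin p → ℝ} {R e : ℝ}, 1 ≤ R → 0 ≤ e →
      (∀ i, |x' i| ≤ R) → (∀ i, |x i - x' i| ≤ e) →
      |f.eval x - (f.map r).eval x'| ≤
        ((N + 1) * B) ^ (f.depth + 1) * (e + (f.depth + 1) * δ * R)
  | p, .output w b => by
    intro hp _ hpar x x' R e hR he hx' hxx
    have hw : ∀ i, |w i| ≤ B := fun i => hpar _ (by simp [Net.params])
    have hb : |b| ≤ B := hpar _ (by simp [Net.params])
    refine (abs_affine_sub_le (by linarith) hw (fun i => hr _ (hw i)) (hr _ hb) hx' hxx).trans ?_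
    simp only [Net.depth, Net.hiddenWidths, List.length_nil, zero_add, pow_one, Nat.cast_zero,
      one_mul]
    have h1 : (p : ℝ) * (B * e + δ * R) ≤ N * (B * e + δ * R) := by gcongr
    have h2 : δ ≤ δ * R := le_mul_of_one_le_right hδ hR
    have h3 : (N + 1) * (δ * R) ≤ (N + 1) * B * (δ * R) := by
      have : 0 ≤ (N + 1) * (δ * R) := by positivity
      nlinarith
    have h4 : 0 ≤ B * e := by positivity
    nlinarith
  | p, .hidden (p' := p') W b rest => by
    intro hp hwid hpar x x' R e hR he hx' hxx
    have hW : ∀ i j, |W i j| ≤ B := fun i j => hpar _ (by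
      simp only [Net.params, Multiset.mem_add, Multiset.mem_map]
      exact Or.inl (Or.inl ⟨(i, j), by simp, rfl⟩))
    have hb : ∀ i, |b i| ≤ B := fun i => hpar _ (by
      simp only [Net.params, Multiset.mem_add, Multiset.mem_map]
      exact Or.inl (Or.inr ⟨i, by simp, rfl⟩))
    have hB0 : 0 ≤ B := by linarith
    set A := (N + 1) * B with hA
    have hA1 : 1 ≤ A := by nlinarith
    have hmax : ∀ s t : ℝ, |max s 0 - max t 0| ≤ |s - t| := fun s t => abs_max_sub_max_le_abs s t 0
    have hR' : 1 ≤ A * R := one_le_mul_of_one_le_of_one_le hA1 hR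
    -- With A = (N + 1) B, one layer turns the bound R of its input into A R and the error e into A
    -- e + δ A R. These are the values with which the rest of the network is entered, and the
    -- claimed bound reproduces itself.
    have key := Net.abs_eval_sub_eval_map_le hB hδ hN hr hrB rest
      (hwid p' (by simp [Net.hiddenWidths])) (fun w hw => hwid w (by simp [Net.hiddenWidths, hw]))
      (fun θ hθ => hpar θ (by simp [Net.params, hθ]))
      (x := fun i => max ((W.mulVec x + b) i) 0)
      (x' := fun i => max ((Matrix.mulVec (fun i j => r (W i j)) x' + fun i => r (b i)) i) 0)
      (R := A * R) (e := A * e + δ * A * R) hR' (by positivity) ?_ ?_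
    · refine key.trans (le_of_eq ?_)
      have hdep : (Net.hidden W b rest).depth = rest.depth + 1 := by
        simp [Net.depth, Net.hiddenWidths]
      rw [hdep, pow_succ A (rest.depth + 1)]
      push_cast
      ring
    · intro i
      have h1 : |max ((Matrix.mulVec (fun i j => r (W i j)) x' + fun i => r (b i)) i) 0| ≤
          |(fun j => r (W i j)) ⬝ᵥ x' + r (b i)| := by
        refine (abs_max_le_max_abs_abs).trans ?_
        simp only [abs_zero]
        exact max_le le_rfl (abs_nonneg _)
      refine h1.trans ((abs_affine_le hB0 (fun j => hrB _ (hW i j)) (hrB _ (hb i)) hx').trans ?_)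
      have h2 : (p : ℝ) * (B * R) ≤ N * (B * R) := by gcongr
      have h3 : B ≤ B * R := le_mul_of_one_le_right hB0 hR
      rw [hA]
      linarith
    · intro i
      refine (hmax _ _).trans ((abs_affine_sub_le (w := W i) (w' := fun j => r (W i j)) (x := x)
        (x' := x') (b := b i) (b' := r (b i)) hB0 (hW i) (fun j => hr _ (hW i j)) (hr _ (hb i)) hx'
        hxx).trans ?_)
      have h1 : (p : ℝ) * (B * e + δ * R) ≤ N * (B * e + δ * R) := by gcongr
      have h2 : δ ≤ δ * R := le_mul_of_one_le_right hδ hR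
      have h3 : (N + 1) * (δ * R) ≤ (N + 1) * B * (δ * R) := by
        have : 0 ≤ (N + 1) * (δ * R) := by positivity
        nlinarith
      have h4 : 0 ≤ B * e := by positivity
      rw [hA]
      nlinarith

/-- The weight of a network: a factor `ρ` for every nonzero parameter. -/
noncomputable def Net.weight {p : ℕ} (ρ : ℝ) (f : Net p) : ℝ :=
  (f.params.map fun θ => if θ = 0 then 1 else ρ).prod

lemma Net.weight_hidden {p p' : ℕ} (ρ : ℝ) (W : Matrix (Fin p') (Fin p) ℝ) (b : Fin p' → ℝ)
    (rest : Net p') : (Net.hidden W b rest).weight ρ =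
      (∏ ij : Fin p' × Fin p, if W ij.1 ij.2 = 0 then 1 else ρ) *
        ((∏ i, if b i = 0 then 1 else ρ) * rest.weight ρ) := by
  rw [Net.weight, Net.params, Multiset.map_add, Multiset.prod_add, Multiset.map_add,
    Multiset.prod_add, Multiset.map_map, Multiset.map_map, mul_assoc]
  rfl

lemma Net.weight_nonneg {p : ℕ} {ρ : ℝ} (hρ : 0 ≤ ρ) (f : Net p) : 0 ≤ f.weight ρ := by
  refine Multiset.prod_nonneg fun x hx => ?_
  obtain ⟨θ, -, rfl⟩ := Multiset.mem_map.1 hx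
  split_ifs <;> positivity

/-- Parameter by parameter: a value of size at most τ is rounded to zero and has factor one, while a
larger value has clipped norm exactly one and a factor of at least exp(-K). The clipped norm is thus
the right penalty for the weights. -/
lemma Net.exp_neg_clipNorm_le_weight {r : ℝ → ℝ} {τ K : ℝ} (hτ : 0 < τ) (hK : 0 ≤ K)
    (hr : ∀ θ, |θ| ≤ τ → r θ = 0) {p : ℕ} (f : Net p) :
    Real.exp (-K * f.clipNorm τ) ≤ (f.map r).weight (Real.exp (-K)) := by
  rw [Net.weight, Net.params_map, Multiset.map_map, Net.clipNorm, ← Multiset.sum_map_mul_left,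
    Real.exp_multiset_sum, Multiset.map_map]
  refine Multiset.prod_map_le_prod_map₀ _ _ (fun θ _ => (Real.exp_pos _).le) fun θ _ => ?_
  simp only [Function.comp_apply]
  by_cases h : |θ| ≤ τ
  · rw [if_pos (hr θ h), Real.exp_le_one_iff]
    have : 0 ≤ min (|θ| / τ) 1 := by positivity
    nlinarith
  · have h1 : min (|θ| / τ) 1 = 1 := min_eq_right ((one_le_div hτ).2 (not_le.1 h).le)
    rw [h1, mul_one]
    split_ifs
    · exact Real.exp_le_one_iff.2 (by linarith)
    · exact le_rfl

/-- The networks with parameters in a finite set, of given depth and bounded widths, have bounded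
total weight. -/
lemma exists_family_of_depth (G : Finset ℝ) (h0 : (0 : ℝ) ∈ G) {ρ : ℝ} (hρ : 0 ≤ ρ) (N n : ℕ) :
    ∀ p ≤ N, ∃ (I : Type) (_ : Fintype I) (φ : I → Net p),
      (∀ f : Net p, f.depth = n → (∀ w ∈ f.hiddenWidths, w ≤ N) → (∀ θ ∈ f.params, θ ∈ G) →
        ∃ i, φ i = f) ∧
      ∑ i, (φ i).weight ρ ≤
        (N + 1) ^ n * (∑ θ ∈ G, if θ = 0 then 1 else ρ) ^ ((n + 1) * (N + 1) ^ 2) := by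
  classical
  -- The weight is a product over parameters, so the sum over all choices is a power of the
  -- one-parameter sum Z. As 0 lies in the grid, Z ≥ 1, and the exponent may be enlarged to (N + 1)²
  -- per layer.
  set Z : ℝ := ∑ θ ∈ G, if θ = 0 then 1 else ρ with hZ
  have hZ1 : 1 ≤ Z := by
    have := Finset.single_le_sum (f := fun θ : ℝ => if θ = 0 then 1 else ρ)
      (fun θ _ => by split_ifs <;> positivity) h0
    simpa using this
  have hZG : ∑ θ : G, (if (θ : ℝ) = 0 then 1 else ρ) = Z := by
    rw [hZ, ← Finset.sum_coe_sort G (fun θ => if θ = 0 then 1 else ρ)]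
  have hpi : ∀ (κ : Type) [Fintype κ] [DecidableEq κ],
      ∑ u : κ → G, ∏ k, (if (u k : ℝ) = 0 then 1 else ρ) = Z ^ Fintype.card κ := by
    intro κ _ _
    have := Finset.prod_univ_sum (fun _ : κ => (Finset.univ : Finset G))
      (fun _ θ => if (θ : ℝ) = 0 then 1 else ρ)
    rw [Fintype.piFinset_univ] at this
    rw [← this, Finset.prod_const, hZG, Finset.card_univ]
  have hprod : ∀ (α β : Type) [Fintype α] [Fintype β] (f : α → ℝ) (g : β → ℝ),
      ∑ u : α × β, f u.1 * g u.2 = (∑ a, f a) * ∑ b, g b := by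
    intro α β _ _ f g
    rw [Fintype.sum_prod_type, Fintype.sum_mul_sum]
  induction n with
  | zero =>
    intro p hp
    refine ⟨(Fin p → G) × G, inferInstance,
      fun u => .output (fun i => (u.1 i : ℝ)) (u.2 : ℝ), ?_, ?_⟩
    · intro f hf _ hG
      cases f with
      | output w b =>
        exact ⟨(fun i => ⟨w i, hG _ (by simp [Net.params])⟩, ⟨b, hG _ (by simp [Net.params])⟩), rfl⟩
      | hidden W b rest => simp [Net.depth, Net.hiddenWidths] at hf
    · have h1 : ∀ u : (Fin p → G) × G,
          (Net.output (fun i => (u.1 i : ℝ)) (u.2 : ℝ)).weight ρ =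
          (∏ i, if (u.1 i : ℝ) = 0 then 1 else ρ) * (if (u.2 : ℝ) = 0 then 1 else ρ) := by
        intro u
        rw [Net.weight, Net.params, Multiset.map_add, Multiset.prod_add, Multiset.map_map,
          Multiset.map_singleton, Multiset.prod_singleton]
        rfl
      simp only [h1]
      rw [hprod (Fin p → G) G (fun u => ∏ i, if (u i : ℝ) = 0 then 1 else ρ)
        (fun u => if (u : ℝ) = 0 then 1 else ρ), hZG, hpi (Fin p), Fintype.card_fin, ← pow_succ, pow_zero, one_mul]
      refine pow_le_pow_right₀ hZ1 ?_
      nlinarith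
  | succ n ih =>
    intro p hp
    choose I hI φ hφ hsum using fun p' : Fin (N + 1) => ih p'.val (by omega)
    -- The width of the first hidden layer is part of the index; summing over it gives one factor N
    -- + 1 per layer.
    refine ⟨Σ p' : Fin (N + 1), ((Fin p'.val × Fin p) → G) × (Fin p'.val → G) × I p', inferInstance,
      fun u => .hidden (fun i j => (u.2.1 (i, j) : ℝ)) (fun i => (u.2.2.1 i : ℝ)) (φ u.1 u.2.2.2),
      ?_, ?_⟩
    · intro f hf hw hG
      cases f with
      | output w b => simp [Net.depth, Net.hiddenWidths] at hf
      | @hidden _ p' W b rest =>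
        have hp' : p' ≤ N := hw p' (by simp [Net.hiddenWidths])
        obtain ⟨i, hi⟩ := hφ ⟨p', by omega⟩ rest (by simpa [Net.depth, Net.hiddenWidths] using hf)
          (fun w hw' => hw w (by simp [Net.hiddenWidths, hw']))
          (fun θ hθ => hG θ (by simp [Net.params, hθ]))
        refine ⟨⟨⟨p', by omega⟩, fun ij => ⟨W ij.1 ij.2, hG _ ?_⟩, fun i => ⟨b i, hG _ ?_⟩, i⟩, ?_⟩
        · simp only [Net.params, Multiset.mem_add, Multiset.mem_map]
          exact Or.inl (Or.inl ⟨ij, by simp, rfl⟩)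
        · simp only [Net.params, Multiset.mem_add, Multiset.mem_map]
          exact Or.inl (Or.inr ⟨i, by simp, rfl⟩)
        · simp only [hi]
    · have h1 : ∀ (p' : Fin (N + 1)) (u : ((Fin p'.val × Fin p) → G) × (Fin p'.val → G) × I p'),
          (Net.hidden (fun i j => (u.1 (i, j) : ℝ)) (fun i => (u.2.1 i : ℝ)) (φ p' u.2.2)).weight ρ =
          (∏ k, if (u.1 k : ℝ) = 0 then 1 else ρ) * ((∏ i, if (u.2.1 i : ℝ) = 0 then 1 else ρ) *
            (φ p' u.2.2).weight ρ) := by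
        intro p' u
        exact Net.weight_hidden _ _ _ _
      rw [Fintype.sum_sigma]
      have h3 : ∀ p' : Fin (N + 1), ∑ u : ((Fin p'.val × Fin p) → G) × (Fin p'.val → G) × I p',
          (Net.hidden (fun i j => (u.1 (i, j) : ℝ)) (fun i => (u.2.1 i : ℝ)) (φ p' u.2.2)).weight ρ =
          Z ^ Fintype.card (Fin p'.val × Fin p) *
          (Z ^ Fintype.card (Fin p'.val) * ∑ i, (φ p' i).weight ρ) := by
        intro p'
        simp only [h1 p']
        rw [hprod ((Fin p'.val × Fin p) → G) ((Fin p'.val → G) × I p')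
          (fun u => ∏ k, if (u k : ℝ) = 0 then 1 else ρ)
          (fun u => (∏ i, if (u.1 i : ℝ) = 0 then 1 else ρ) * (φ p' u.2).weight ρ),
          hprod (Fin p'.val → G) (I p') (fun u => ∏ i, if (u i : ℝ) = 0 then 1 else ρ)
          (fun u => (φ p' u).weight ρ), hpi, hpi]
      simp only [h3]
      have h2 : ∀ p' : Fin (N + 1), Z ^ Fintype.card (Fin p'.val × Fin p) *
          (Z ^ Fintype.card (Fin p'.val) * ∑ i, (φ p' i).weight ρ) ≤
          Z ^ ((N + 1) ^ 2) * ((N + 1) ^ n * Z ^ ((n + 1) * (N + 1) ^ 2)) := by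
        intro p'
        rw [← mul_assoc, ← pow_add]
        refine mul_le_mul (pow_le_pow_right₀ hZ1 ?_) (hsum p')
          (Finset.sum_nonneg fun i _ => Net.weight_nonneg hρ _) (by positivity)
        simp only [Fintype.card_prod, Fintype.card_fin]
        have : p'.val ≤ N := by omega
        nlinarith [Nat.mul_le_mul this hp]
      refine (Finset.sum_le_sum fun p' _ => h2 p').trans (le_of_eq ?_)
      simp only [Finset.sum_const, Finset.card_univ, Fintype.card_fin, nsmul_eq_mul]
      push_cast
      rw [show (n + 1 + 1) * (N + 1) ^ 2 = (N + 1) ^ 2 + (n + 1) * (N + 1) ^ 2 by ring, pow_add]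
      ring

/-- Set small values to zero, and round the others towards zero to multiples of `δ`. -/
noncomputable def quantize (τ δ θ : ℝ) : ℝ :=
  if |θ| ≤ τ then 0 else if 0 ≤ θ then δ * ⌊θ / δ⌋₊ else -(δ * ⌊-θ / δ⌋₊)

lemma floor_mul_bounds {δ θ : ℝ} (hδ : 0 < δ) (hθ : 0 ≤ θ) :
    θ - δ ≤ δ * ⌊θ / δ⌋₊ ∧ δ * ⌊θ / δ⌋₊ ≤ θ := by
  have h1 := Nat.floor_le (div_nonneg hθ hδ.le)
  have h2 := Nat.lt_floor_add_one (θ / δ)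
  rw [le_div_iff₀ hδ] at h1
  rw [div_lt_iff₀ hδ] at h2
  constructor <;> linarith

lemma abs_sub_quantize_le {τ δ : ℝ} (hδ : 0 < δ) (θ : ℝ) :
    |θ - quantize τ δ θ| ≤ max τ δ := by
  unfold quantize
  split_ifs with h1 h2
  · rw [sub_zero]; exact h1.trans (le_max_left _ _)
  · have := floor_mul_bounds hδ h2
    rw [abs_of_nonneg (by linarith)]
    exact le_trans (by linarith) (le_max_right _ _)
  · have := floor_mul_bounds hδ (by linarith : 0 ≤ -θ)
    rw [abs_of_nonpos (by linarith)]
    exact le_trans (by linarith) (le_max_right _ _)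

/-- Rounding towards zero, rather than to the nearest multiple, keeps the quantized parameters
inside [-B, B]. -/
lemma abs_quantize_le {τ δ : ℝ} (hδ : 0 < δ) (θ : ℝ) : |quantize τ δ θ| ≤ |θ| := by
  unfold quantize
  split_ifs with h1 h2
  · simp
  · have := floor_mul_bounds hδ h2
    rw [abs_of_nonneg (by positivity), abs_of_nonneg h2]
    linarith
  · have := floor_mul_bounds hδ (by linarith : 0 ≤ -θ)
    rw [abs_neg, abs_of_nonneg (by positivity), abs_of_nonpos (by linarith)]
    linarith

/-- The values of `quantize` on `[-B, B]`. -/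
noncomputable def quantGrid (B δ : ℝ) : Finset ℝ :=
  (Finset.range (⌊B / δ⌋₊ + 1)).image (fun k : ℕ => δ * k) ∪
    (Finset.range (⌊B / δ⌋₊ + 1)).image (fun k : ℕ => -(δ * k))

lemma zero_mem_quantGrid (B δ : ℝ) : (0 : ℝ) ∈ quantGrid B δ := by
  refine Finset.mem_union_left _ (Finset.mem_image.2 ⟨0, by simp, by simp⟩)

lemma quantize_mem_quantGrid {τ B δ θ : ℝ} (hδ : 0 < δ) (hθ : |θ| ≤ B) :
    quantize τ δ θ ∈ quantGrid B δ := by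
  unfold quantize
  split_ifs with h1 h2
  · exact zero_mem_quantGrid B δ
  · refine Finset.mem_union_left _ (Finset.mem_image.2 ⟨_, ?_, rfl⟩)
    rw [Finset.mem_range, Nat.lt_succ_iff]
    exact Nat.floor_mono (by gcongr; exact (abs_le.1 hθ).2)
  · refine Finset.mem_union_right _ (Finset.mem_image.2 ⟨_, ?_, rfl⟩)
    rw [Finset.mem_range, Nat.lt_succ_iff]
    exact Nat.floor_mono (by gcongr; linarith [(abs_le.1 hθ).1])

lemma card_quantGrid_le {B δ : ℝ} (hB : 0 ≤ B) (hδ : 0 < δ) :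
    ((quantGrid B δ).card : ℝ) ≤ 2 * (B / δ + 1) := by
  have h1 : (quantGrid B δ).card ≤ (⌊B / δ⌋₊ + 1) + (⌊B / δ⌋₊ + 1) := by
    refine (Finset.card_union_le _ _).trans (add_le_add ?_ ?_) <;>
    exact Finset.card_image_le.trans (by simp)
  have h2 : ((quantGrid B δ).card : ℝ) ≤ (⌊B / δ⌋₊ + 1) + (⌊B / δ⌋₊ + 1) := by exact_mod_cast h1
  have := Nat.floor_le (div_nonneg hB hδ.le)
  linarith

/-- A weighted finite family that covers the whole network class. -/
lemma exists_covering_family {d : ℕ} {L N B F τ δ ε K K₀ : ℝ} (hL : 0 ≤ L) (hdN : (d : ℝ) ≤ N)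
    (hB : 1 ≤ B) (hτ : 0 < τ) (hδ : 0 < δ) (hK : 0 ≤ K)
    (hε : max τ δ * (L + 1) * ((N + 1) * B) ^ (L + 1) ≤ ε) (hε1 : ε ≤ 1)
    (hKV : 2 * (B / δ + 1) * ((L + 1) * (N + 1) ^ 2) ≤ Real.exp K)
    (hK₀ : (L + 1) * (N + 1) ^ L * Real.exp 1 ≤ Real.exp K₀) :
    ∃ (I : Type) (_ : Fintype I) (φ : I → (Fin d → ℝ) → ℝ) (w : I → ℝ),
      (∀ i, Measurable (φ i)) ∧ (∀ i, ∀ x ∈ cube d 0 1, |φ i x| ≤ F + 1) ∧ (∀ i, 0 ≤ w i) ∧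
      ∑ i, w i ≤ 1 ∧
      ∀ f ∈ netClass d L N B F, ∃ i, (∀ x ∈ cube d 0 1, |f.eval x - φ i x| ≤ ε) ∧
        Real.exp (-K * f.clipNorm τ - K₀) ≤ w i := by
  classical
  have hN0 : 0 ≤ N := (Nat.cast_nonneg d).trans hdN
  set G := quantGrid B δ
  set ρ := Real.exp (-K) with hρ
  have hρ0 : 0 < ρ := Real.exp_pos _
  set Ln := ⌊L⌋₊
  set Nn := ⌊N⌋₊
  have hLn : (Ln : ℝ) ≤ L := Nat.floor_le hL
  have hNn : (Nn : ℝ) ≤ N := Nat.floor_le hN0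
  choose I hI φ hφ hsum using fun n : Fin (Ln + 1) =>
    exists_family_of_depth G (zero_mem_quantGrid B δ) hρ0.le Nn n.val d (Nat.le_floor hdN)
  -- Quantized networks that are too large on the cube are discarded. Those needed for the covering
  -- survive, being within ε ≤ 1 of a network bounded by F.
  set J := {i : Σ n, I n // ∀ x ∈ cube d 0 1, |(φ i.1 i.2).eval x| ≤ F + 1} with hJ
  -- Nonzero grid values contribute ρ times their number, which `hKV` makes smaller than the
  -- reciprocal of the number of parameters; the power of Z is then at most e.
  have hZle : (∑ θ ∈ G, if θ = 0 then 1 else ρ) ≤ 1 + ρ * (2 * (B / δ + 1)) := by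
    have h1 : (∑ θ ∈ G, if θ = 0 then 1 else ρ) ≤ ∑ θ ∈ G, ((if θ = 0 then 1 else 0) + ρ) := by
      refine Finset.sum_le_sum fun θ _ => ?_
      split_ifs <;> linarith
    rw [Finset.sum_add_distrib, Finset.sum_ite_eq' G (0 : ℝ) (fun _ => (1 : ℝ)),
      if_pos (zero_mem_quantGrid B δ)] at h1
    simp only [Finset.sum_const, nsmul_eq_mul] at h1
    have := mul_le_mul_of_nonneg_right (card_quantGrid_le (by linarith : 0 ≤ B) hδ) hρ0.le
    linarith
  have hBδ : 0 ≤ B / δ := by positivity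
  have hdepth : ∀ n : Fin (Ln + 1), ∑ i, (φ n i).weight ρ ≤ (N + 1) ^ L * Real.exp 1 := by
    intro n
    refine (hsum n).trans ?_
    have hnL : (n.val : ℝ) ≤ L := le_trans (by exact_mod_cast (by omega : n.val ≤ Ln)) hLn
    have hZ0 : 0 ≤ ∑ θ ∈ G, if θ = 0 then 1 else ρ :=
      Finset.sum_nonneg fun θ _ => by split_ifs <;> positivity
    refine mul_le_mul ?_ ?_ (by positivity) (by positivity)
    · calc ((Nn : ℝ) + 1) ^ n.val ≤ (N + 1) ^ n.val := by gcongr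
        _ = (N + 1) ^ (n.val : ℝ) := (Real.rpow_natCast _ _).symm
        _ ≤ (N + 1) ^ L := Real.rpow_le_rpow_of_exponent_le (by linarith) hnL
    · calc (∑ θ ∈ G, if θ = 0 then 1 else ρ) ^ ((n.val + 1) * (Nn + 1) ^ 2)
          ≤ (Real.exp (ρ * (2 * (B / δ + 1)))) ^ ((n.val + 1) * (Nn + 1) ^ 2) := by
            gcongr
            have := Real.add_one_le_exp (ρ * (2 * (B / δ + 1)))
            linarith
        _ = Real.exp (((n.val + 1) * (Nn + 1) ^ 2 : ℕ) * (ρ * (2 * (B / δ + 1)))) :=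
            (Real.exp_nat_mul _ _).symm
        _ ≤ Real.exp 1 := by
            refine Real.exp_le_exp.2 ?_
            calc _ ≤ ((L + 1) * (N + 1) ^ 2) * (ρ * (2 * (B / δ + 1))) := by
                  push_cast
                  gcongr
              _ = ρ * (2 * (B / δ + 1) * ((L + 1) * (N + 1) ^ 2)) := by ring
              _ ≤ ρ * Real.exp K := by gcongr
              _ = 1 := by rw [hρ, ← Real.exp_add]; simp
  refine ⟨J, inferInstance, fun i => (φ i.1.1 i.1.2).eval,
    fun i => (φ i.1.1 i.1.2).weight ρ * Real.exp (-K₀), fun i => (Net.continuous_eval _).measurable,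
    fun i => i.2, fun i => mul_nonneg (Net.weight_nonneg hρ0.le _) (Real.exp_pos _).le, ?_, ?_⟩
  · rw [← Finset.sum_mul]
    have h1 : ∑ i : J, (φ i.1.1 i.1.2).weight ρ ≤ ∑ i : Σ n, I n, (φ i.1 i.2).weight ρ := by
      have h2 : ∑ i : J, (φ i.1.1 i.1.2).weight ρ = ∑ i ∈ Finset.univ.filter (fun i : Σ n, I n =>
          ∀ x ∈ cube d 0 1, |(φ i.1 i.2).eval x| ≤ F + 1), (φ i.1 i.2).weight ρ :=
        (Finset.sum_subtype (p := fun i : Σ n, I n => ∀ x ∈ cube d 0 1, |(φ i.1 i.2).eval x| ≤ F + 1)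
          _ (fun i => by simp only [Finset.mem_filter, Finset.mem_univ, true_and])
          fun i => (φ i.1 i.2).weight ρ).symm
      rw [h2]
      exact Finset.sum_le_sum_of_subset_of_nonneg (Finset.filter_subset _ _)
        fun i _ _ => Net.weight_nonneg hρ0.le _
    have h2 : ∑ i : Σ n, I n, (φ i.1 i.2).weight ρ ≤ (L + 1) * (N + 1) ^ L * Real.exp 1 := by
      rw [Fintype.sum_sigma]
      refine (Finset.sum_le_sum fun n _ => hdepth n).trans ?_
      simp only [Finset.sum_const, Finset.card_univ, Fintype.card_fin, nsmul_eq_mul]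
      push_cast
      rw [← mul_assoc]
      gcongr
    calc _ ≤ Real.exp K₀ * Real.exp (-K₀) :=
          mul_le_mul_of_nonneg_right (h1.trans (h2.trans hK₀)) (Real.exp_pos _).le
      _ = 1 := by rw [← Real.exp_add]; simp
  · rintro f ⟨hd1, hdL, hw, hθ, hfF⟩
    have hdn : f.depth ≤ Ln := Nat.le_floor hdL
    obtain ⟨i, hi⟩ := hφ ⟨f.depth, by omega⟩ (f.map (quantize τ δ))
      (by simp [Net.depth, Net.hiddenWidths_map])
      (fun w hw' => Nat.le_floor (hw w (by rwa [Net.hiddenWidths_map] at hw')).2)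
      (fun θ hθ' => by
        rw [Net.params_map] at hθ'
        obtain ⟨θ₀, h₀, rfl⟩ := Multiset.mem_map.1 hθ'
        exact quantize_mem_quantGrid hδ (hθ _ h₀))
    have hcl : ∀ x ∈ cube d 0 1, |f.eval x - (f.map (quantize τ δ)).eval x| ≤ ε := by
      intro x hx
      have h1 := Net.abs_eval_sub_eval_map_le hB (δ := max τ δ) (hδ.le.trans (le_max_right _ _)) hN0
        (fun θ _ => abs_sub_quantize_le hδ θ) (fun θ hθ => (abs_quantize_le hδ θ).trans hθ) f hdN
        (fun w hw' => (hw w hw').2) hθ (x := x) (x' := x) (R := 1) (e := 0) le_rfl le_rfl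
        (fun i => abs_le.2 ⟨by linarith [hx.1 i], hx.2 i⟩) (fun i => by simp)
      refine h1.trans (le_trans ?_ hε)
      have hA1 : 1 ≤ (N + 1) * B := by nlinarith
      have h2 : ((N + 1) * B) ^ (f.depth + 1) ≤ ((N + 1) * B) ^ (L + 1) := by
        rw [← Real.rpow_natCast]
        refine Real.rpow_le_rpow_of_exponent_le hA1 ?_
        push_cast
        linarith
      have h3 : (0 : ℝ) ≤ max τ δ := hδ.le.trans (le_max_right _ _)
      calc _ ≤ ((N + 1) * B) ^ (L + 1) * (0 + (L + 1) * max τ δ * 1) := by gcongr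
        _ = _ := by ring
    refine ⟨⟨⟨⟨f.depth, by omega⟩, i⟩, fun x hx => ?_⟩, fun x hx => ?_, ?_⟩
    · rw [hi]
      have h1 := hcl x hx
      have h2 := abs_sub_abs_le_abs_sub ((f.map (quantize τ δ)).eval x) (f.eval x)
      rw [abs_sub_comm] at h2
      linarith [hfF x hx]
    · simp only [hi]
      exact hcl x hx
    · simp only [hi]
      rw [sub_eq_add_neg, Real.exp_add]
      exact mul_le_mul_of_nonneg_right (Net.exp_neg_clipNorm_le_weight hτ hK
        (fun θ hθ => by rw [quantize, if_pos hθ]) f) (Real.exp_pos _).le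

end SparseDNN

namespace SparseDNN

/-! ### Iterated partial derivatives and Taylor expansion on cubes -/

section Taylor

variable {p : ℕ} {l u : ℝ}

lemma convex_cube : Convex ℝ (cube p l u) := convex_Icc _ _

lemma uniqueDiffOn_cube (h : l < u) : UniqueDiffOn ℝ (cube p l u) := by
  rw [cube, ← Set.pi_univ_Icc]
  exact UniqueDiffOn.univ_pi fun _ => uniqueDiffOn_Icc h

lemma interior_cube_nonempty (h : l < u) : (interior (cube p l u)).Nonempty := by
  rw [cube, ← Set.pi_univ_Icc, interior_pi_set Set.finite_univ]
  refine ⟨fun _ => (l + u) / 2, fun i _ => ?_⟩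
  simp only [interior_Icc, Set.mem_Ioo]
  constructor <;> linarith

/-- Iterated partial derivatives along a list of coordinates; the first entry acts first. -/
noncomputable def iterDeriv (Q : Set (Fin p → ℝ)) :
    List (Fin p) → ((Fin p → ℝ) → ℝ) → (Fin p → ℝ) → ℝ
  | [], f => f
  | j :: w, f => iterDeriv Q w (coordDeriv Q j f)

lemma iterDeriv_append (Q : Set (Fin p → ℝ)) (w w' : List (Fin p)) (f : (Fin p → ℝ) → ℝ) :
    iterDeriv Q (w ++ w') f = iterDeriv Q w' (iterDeriv Q w f) := by
  induction w generalizing f with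
  | nil => rfl
  | cons j w ih => exact ih _

lemma iterDeriv_replicate (Q : Set (Fin p → ℝ)) (n : ℕ) (j : Fin p) (f : (Fin p → ℝ) → ℝ) :
    iterDeriv Q (List.replicate n j) f = (coordDeriv Q j)^[n] f := by
  induction n generalizing f with
  | zero => rfl
  | succ n ih => exact ih _

lemma contDiffOn_coordDeriv (h : l < u) {n : ℕ} {f : (Fin p → ℝ) → ℝ}
    (hf : ContDiffOn ℝ (n + 1 : ℕ) f (cube p l u)) (j : Fin p) :
    ContDiffOn ℝ n (coordDeriv (cube p l u) j f) (cube p l u) :=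
  (hf.fderivWithin (uniqueDiffOn_cube h) (by norm_cast)).clm_apply contDiffOn_const

lemma coordDeriv_congr {Q : Set (Fin p → ℝ)} {f g : (Fin p → ℝ) → ℝ} (h : Set.EqOn f g Q)
    (j : Fin p) : Set.EqOn (coordDeriv Q j f) (coordDeriv Q j g) Q := fun x hx => by
  rw [coordDeriv, coordDeriv, fderivWithin_congr h (h hx)]

lemma iterDeriv_congr {Q : Set (Fin p → ℝ)} {f g : (Fin p → ℝ) → ℝ} (h : Set.EqOn f g Q)
    (w : List (Fin p)) : Set.EqOn (iterDeriv Q w f) (iterDeriv Q w g) Q := by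
  induction w generalizing f g with
  | nil => exact h
  | cons j w ih => exact ih (coordDeriv_congr h j)

/-- Symmetry of the second derivative holds up to the boundary because the cube is the closure of
its interior. -/
lemma coordDeriv_comm (h : l < u) {f : (Fin p → ℝ) → ℝ}
    (hf : ContDiffOn ℝ (2 : ℕ) f (cube p l u)) (i j : Fin p) :
    Set.EqOn (coordDeriv (cube p l u) i (coordDeriv (cube p l u) j f))
      (coordDeriv (cube p l u) j (coordDeriv (cube p l u) i f)) (cube p l u) := by
  intro x hx
  have hU := uniqueDiffOn_cube (p := p) h
  have hcl : x ∈ closure (interior (cube p l u)) := by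
    rw [convex_cube.closure_interior_eq_closure_of_nonempty_interior (interior_cube_nonempty h)]
    exact subset_closure hx
  have hs := (hf x hx).isSymmSndFDerivWithinAt (by simp) hU hcl hx
  have hd : DifferentiableWithinAt ℝ (fderivWithin ℝ f (cube p l u)) (cube p l u) x :=
    ((hf.fderivWithin hU (m := 1) (by norm_cast)).differentiableOn one_ne_zero) x hx
  have key : ∀ a b : Fin p, coordDeriv (cube p l u) a (coordDeriv (cube p l u) b f) x =
      fderivWithin ℝ (fderivWithin ℝ f (cube p l u)) (cube p l u) x (Pi.single a 1)
        (Pi.single b 1) := by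
    intro a b
    have := (hd.hasFDerivWithinAt.clm_apply (hasFDerivWithinAt_const (Pi.single b (1 : ℝ)) x
      (cube p l u))).fderivWithin (hU x hx)
    change fderivWithin ℝ (fun y => fderivWithin ℝ f (cube p l u) y (Pi.single b 1)) _ x _ = _
    rw [this]
    simp
  rw [key, key]
  exact hs _ _

lemma iterDeriv_perm (h : l < u) {w w' : List (Fin p)} (hw : w.Perm w') :
    ∀ {f : (Fin p → ℝ) → ℝ}, ContDiffOn ℝ (w.length : ℕ) f (cube p l u) →
      Set.EqOn (iterDeriv (cube p l u) w f) (iterDeriv (cube p l u) w' f) (cube p l u) := by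
  induction hw with
  | nil => exact fun _ _ _ => rfl
  | cons j _ ih => exact fun hf => ih (contDiffOn_coordDeriv h hf j)
  | swap i j w =>
    intro f hf
    refine iterDeriv_congr (coordDeriv_comm h (hf.of_le ?_) i j) w
    norm_cast
    simp
  | trans h₁ _ ih₁ ih₂ =>
    intro f hf
    exact (ih₁ hf).trans (ih₂ (by rwa [← h₁.length_eq]))

/-- Every iterated partial derivative is a mixed partial derivative `∂^α`. -/
lemma iterDeriv_eq_multiDeriv (h : l < u) (w : List (Fin p)) {f : (Fin p → ℝ) → ℝ}
    (hf : ContDiffOn ℝ (w.length : ℕ) f (cube p l u)) :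
    Set.EqOn (iterDeriv (cube p l u) w f) (multiDeriv (cube p l u) (fun j => w.count j) f)
      (cube p l u) := by
  set α : Fin p → ℕ := fun j => w.count j
  -- The sorted word that lists the derivatives in the order in which `multiDeriv` applies them; any
  -- word with the same counts is a permutation of it.
  set flat : List (Fin p) → List (Fin p) := fun L =>
    L.foldr (fun j r => r ++ List.replicate (α j) j) [] with hflat
  have h1 : ∀ L : List (Fin p), L.foldr (fun j g => (coordDeriv (cube p l u) j)^[α j] g) f =
      iterDeriv (cube p l u) (flat L) f := by
    intro L
    induction L with
    | nil => rfl
    | cons j L ih =>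
      rw [List.foldr_cons, ih]
      change _ = iterDeriv _ (flat L ++ List.replicate (α j) j) f
      rw [iterDeriv_append, iterDeriv_replicate]
  have h2 : ∀ (L : List (Fin p)), L.Nodup → ∀ i, (flat L).count i = if i ∈ L then α i else 0 := by
    intro L hL i
    induction L with
    | nil => simp [hflat]
    | cons j L ih =>
      obtain ⟨hj, hL'⟩ := List.nodup_cons.1 hL
      have := ih hL'
      simp only [hflat] at this ⊢
      rw [List.foldr_cons, List.count_append, this, List.count_replicate]
      by_cases hij : i = j
      · subst hij
        simp [hj]
      · simp [hij, Ne.symm hij]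
  have h3 : w.Perm (flat (List.finRange p)) := by
    rw [List.perm_iff_count]
    intro i
    rw [h2 _ (List.nodup_finRange p), if_pos (List.mem_finRange i)]
  rw [multiDeriv, h1]
  exact iterDeriv_perm h h3 hf

/-- The homogeneous terms of the Taylor expansion of `f` at `a`. -/
noncomputable def homTerm (Q : Set (Fin p → ℝ)) (a : Fin p → ℝ) :
    ℕ → ((Fin p → ℝ) → ℝ) → (Fin p → ℝ) → ℝ
  | 0, f, _ => f a
  | n + 1, f, z => ∑ j, z j * homTerm Q a n (coordDeriv Q j f) z

lemma homTerm_smul (Q : Set (Fin p → ℝ)) (a : Fin p → ℝ) (n : ℕ) (f : (Fin p → ℝ) → ℝ) (s : ℝ)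
    (z : Fin p → ℝ) : homTerm Q a n f (s • z) = s ^ n * homTerm Q a n f z := by
  induction n generalizing f with
  | zero => simp [homTerm]
  | succ n ih =>
    simp only [homTerm, ih, Pi.smul_apply, smul_eq_mul, Finset.mul_sum]
    exact Finset.sum_congr rfl fun j _ => by ring

/-- Taylor's formula with a Hölder remainder. -/
lemma abs_sub_taylor_le (h : l < u) (k : ℕ) {H γ : ℝ} (hH : 0 ≤ H) (hγ : 0 ≤ γ)
    {a : Fin p → ℝ} (ha : a ∈ cube p l u) :
    ∀ {f : (Fin p → ℝ) → ℝ}, ContDiffOn ℝ (k : ℕ) f (cube p l u) →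
      (∀ w : List (Fin p), w.length = k → ∀ x ∈ cube p l u,
        |iterDeriv (cube p l u) w f x - iterDeriv (cube p l u) w f a| ≤ H * ‖x - a‖ ^ γ) →
      ∀ x ∈ cube p l u,
        |f x - ∑ n ∈ Finset.range (k + 1), homTerm (cube p l u) a n f (x - a) / (n.factorial : ℝ)| ≤
          p ^ k * H * ‖x - a‖ ^ (k + γ) := by
  set Q := cube p l u
  induction k with
  | zero =>
    intro f _ hw x hx
    simpa [homTerm, iterDeriv] using hw [] rfl x hx
  | succ k ih =>
    intro f hf hw x hx
    set z := x - a with hz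
    have hseg : ∀ s ∈ Set.Icc (0 : ℝ) 1, a + s • z ∈ Q := fun s hs => by
      have := convex_cube.add_smul_sub_mem ha hx hs
      exact this
    have hrem : ∀ (j : Fin p), ∀ s ∈ Set.Icc (0 : ℝ) 1,
        |coordDeriv Q j f (a + s • z) - ∑ n ∈ Finset.range (k + 1),
          s ^ n * homTerm Q a n (coordDeriv Q j f) z / (n.factorial : ℝ)| ≤
        p ^ k * H * ‖z‖ ^ (k + γ) := by
      intro j s hs
      have := ih (contDiffOn_coordDeriv h hf j) (fun w hwk y hy => hw (j :: w) (by simp [hwk]) y hy)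
        (a + s • z) (hseg s hs)
      rw [add_sub_cancel_left] at this
      simp only [homTerm_smul] at this
      refine this.trans ?_
      have hn : ‖s • z‖ ≤ ‖z‖ := by
        rw [norm_smul, Real.norm_of_nonneg hs.1]
        exact mul_le_of_le_one_left (norm_nonneg _) hs.2
      gcongr
    -- The remainder along the segment from a to x. Its derivative is ∑ z_j times the remainders of
    -- order k of the partial derivatives, bounded by the induction hypothesis; the mean value
    -- inequality then gives the remainder of order k + 1, with one more factor p ‖z‖.
    set G : ℝ → ℝ := fun s => f (a + s • z) - ∑ n ∈ Finset.range (k + 1 + 1),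
      s ^ n * (homTerm Q a n f z / (n.factorial : ℝ)) with hG
    have hder : ∀ s ∈ Set.Icc (0 : ℝ) 1, HasDerivWithinAt G (∑ j, z j *
        (coordDeriv Q j f (a + s • z) - ∑ n ∈ Finset.range (k + 1),
          s ^ n * homTerm Q a n (coordDeriv Q j f) z / (n.factorial : ℝ))) (Set.Icc 0 1) s := by
      intro s hs
      have hfd : HasFDerivWithinAt f (fderivWithin ℝ f Q (a + s • z)) Q (a + s • z) :=
        (hf.differentiableOn (by simp) _ (hseg s hs)).hasFDerivWithinAt
      have hline : HasDerivWithinAt (fun s : ℝ => a + s • z) z (Set.Icc 0 1) s := by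
        have := ((hasDerivAt_id s).smul_const z).const_add a
        simp only [one_smul] at this
        exact this.hasDerivWithinAt
      have h1 := hfd.comp_hasDerivWithinAt s hline (fun s hs => hseg s hs)
      have h2 : HasDerivWithinAt (fun s : ℝ => ∑ n ∈ Finset.range (k + 1 + 1),
          s ^ n * (homTerm Q a n f z / (n.factorial : ℝ)))
          (∑ n ∈ Finset.range (k + 1 + 1), (n * s ^ (n - 1)) *
            (homTerm Q a n f z / (n.factorial : ℝ))) (Set.Icc 0 1) s := by
        refine HasDerivWithinAt.fun_sum fun n _ => ?_
        exact ((hasDerivAt_pow n s).mul_const _).hasDerivWithinAt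
      refine (h1.sub h2).congr_deriv ?_
      have h3 : fderivWithin ℝ f Q (a + s • z) z = ∑ j, z j * coordDeriv Q j f (a + s • z) := by
        have hlin : ∀ φ : (Fin p → ℝ) →L[ℝ] ℝ, φ z = ∑ j, z j * φ (Pi.single j 1) := by
          intro φ
          conv_lhs => rw [pi_eq_sum_univ' z, map_sum]
          simp only [map_smul, smul_eq_mul]
        exact hlin _
      rw [h3, Finset.sum_range_succ']
      simp only [mul_sub, Finset.sum_sub_distrib, Finset.mul_sum]
      congr 1
      rw [Finset.sum_comm]
      simp only [Nat.cast_zero, zero_mul, add_zero]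
      refine Finset.sum_congr rfl fun n _ => ?_
      rw [homTerm, Finset.sum_div, Finset.mul_sum]
      refine Finset.sum_congr rfl fun j _ => ?_
      rw [Nat.factorial_succ]
      push_cast
      have : (n.factorial : ℝ) ≠ 0 := by positivity
      have : (n : ℝ) + 1 ≠ 0 := by positivity
      field_simp
    have hbound : ∀ s ∈ Set.Icc (0 : ℝ) 1, ‖∑ j, z j *
        (coordDeriv Q j f (a + s • z) - ∑ n ∈ Finset.range (k + 1),
          s ^ n * homTerm Q a n (coordDeriv Q j f) z / (n.factorial : ℝ))‖ ≤
        p ^ (k + 1) * H * ‖z‖ ^ ((k + 1 : ℕ) + γ) := by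
      intro s hs
      refine (norm_sum_le _ _).trans ?_
      calc _ ≤ ∑ _j : Fin p, ‖z‖ * (p ^ k * H * ‖z‖ ^ (k + γ)) := by
            refine Finset.sum_le_sum fun j _ => ?_
            rw [norm_mul]
            exact mul_le_mul (norm_le_pi_norm z j) (hrem j s hs) (norm_nonneg _) (norm_nonneg _)
        _ = _ := by
            rw [Finset.sum_const, Finset.card_univ, Fintype.card_fin, nsmul_eq_mul]
            have : ((k + 1 : ℕ) : ℝ) + γ = (k + γ) + 1 := by push_cast; ring
            rw [this, Real.rpow_add_one' (norm_nonneg _) (by positivity), pow_succ]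
            ring
    have hfin := Convex.norm_image_sub_le_of_norm_hasDerivWithin_le hder hbound (convex_Icc 0 1)
      (Set.left_mem_Icc.2 zero_le_one) (Set.right_mem_Icc.2 zero_le_one)
    have hG0 : G 0 = 0 := by
      simp only [hG]
      rw [Finset.sum_range_succ']
      simp [homTerm]
    have hG1 : G 1 = f x - ∑ n ∈ Finset.range (k + 1 + 1),
        homTerm Q a n f z / (n.factorial : ℝ) := by
      simp only [hG, one_pow, one_mul, one_smul, hz]
      rw [add_sub_cancel]
    rw [hG0, hG1, sub_zero, sub_zero, norm_one, mul_one] at hfin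
    exact hfin

/-! ### Hölder balls -/

variable {r : ℕ} {β A : ℝ} {f : (Fin p → ℝ) → ℝ}

lemma count_mem_piAntidiag (w : List (Fin p)) :
    (fun j => w.count j) ∈ Finset.piAntidiag (Finset.univ : Finset (Fin p)) w.length := by
  rw [Finset.mem_piAntidiag]
  refine ⟨?_, fun _ _ => Finset.mem_univ _⟩
  have := Multiset.sum_count_eq_card (s := (Finset.univ : Finset (Fin p))) (m := (w : Multiset (Fin p)))
    fun a _ => Finset.mem_univ a
  simpa using this

lemma strictFloor_lt (hβ : 0 < β) : strictFloor β < ⌈β⌉₊ :=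
  Nat.sub_lt (Nat.ceil_pos.2 hβ) one_pos

lemma strictFloor_cast_lt (hβ : 0 < β) : (strictFloor β : ℝ) < β :=
  Nat.lt_ceil.1 (strictFloor_lt hβ)

lemma HolderClass.abs_iterDeriv_le (h : l < u) (hA : 0 ≤ A) (hf : HolderClass p r β l u A f)
    {w : List (Fin p)} (hw : w.length ≤ strictFloor β) (hβ : 0 < β) {x : Fin p → ℝ}
    (hx : x ∈ cube p l u) : |iterDeriv (cube p l u) w f x| ≤ A := by
  obtain ⟨-, hC, hn⟩ := hf
  rw [iterDeriv_eq_multiDeriv h w (hC.of_le (by norm_cast)) hx]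
  rw [← ENNReal.ofReal_le_ofReal_iff hA]
  refine le_trans ?_ (le_trans le_self_add hn)
  refine le_trans ?_ (Finset.single_le_sum (f := fun k => ∑ α ∈ Finset.piAntidiag
    (Finset.univ : Finset (Fin p)) k, ⨆ x ∈ cube p l u,
      ENNReal.ofReal |multiDeriv (cube p l u) α f x|) (fun _ _ => zero_le)
    (Finset.mem_range.2 (hw.trans_lt (strictFloor_lt hβ))))
  refine le_trans ?_ (Finset.single_le_sum (f := fun α => ⨆ x ∈ cube p l u,
      ENNReal.ofReal |multiDeriv (cube p l u) α f x|) (fun _ _ => zero_le)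
    (count_mem_piAntidiag w))
  exact le_iSup₂ (f := fun x (_ : x ∈ cube p l u) =>
    ENNReal.ofReal |multiDeriv (cube p l u) (fun j => w.count j) f x|) x hx

lemma HolderClass.abs_iterDeriv_sub_le (h : l < u) (hA : 0 ≤ A) (hf : HolderClass p r β l u A f)
    {w : List (Fin p)} (hw : w.length = strictFloor β) {x y : Fin p → ℝ}
    (hx : x ∈ cube p l u) (hy : y ∈ cube p l u) :
    |iterDeriv (cube p l u) w f x - iterDeriv (cube p l u) w f y| ≤
      A * ‖x - y‖ ^ (β - strictFloor β) := by
  by_cases hxy : x = y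
  · subst hxy
    simp only [sub_self, abs_zero]
    positivity
  obtain ⟨-, hC, hn⟩ := hf
  have heq := iterDeriv_eq_multiDeriv h w (hC.of_le (by rw [hw]))
  rw [heq hx, heq hy, ← div_le_iff₀ (Real.rpow_pos_of_pos (norm_pos_iff.2 (sub_ne_zero.2 hxy)) _),
    ← ENNReal.ofReal_le_ofReal_iff hA]
  refine le_trans ?_ (le_trans le_add_self hn)
  rw [← hw]
  refine le_trans ?_ (Finset.single_le_sum (f := fun α => ⨆ x ∈ cube p l u, ⨆ y ∈ cube p l u,
    ⨆ _ : x ≠ y, ENNReal.ofReal (|multiDeriv (cube p l u) α f x - multiDeriv (cube p l u) α f y| /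
      ‖x - y‖ ^ (β - (w.length : ℝ)))) (fun _ _ => zero_le) (count_mem_piAntidiag w))
  refine le_iSup₂_of_le x hx (le_iSup₂_of_le y hy (le_iSup_of_le hxy le_rfl))

/-! ### Polynomials as combinations of words -/

/-- The extended coordinate: `1` for `none`. -/
def hatCoord (x : Fin p → ℝ) : Option (Fin p) → ℝ
  | none => 1
  | some j => x j

/-- The monomial of a word. -/
def wordMonomial {k : ℕ} (v : Fin k → Option (Fin p)) (x : Fin p → ℝ) : ℝ := ∏ i, hatCoord x (v i)

/-- `P` is a polynomial of degree at most `k` with coefficients bounded by `C`. -/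
def PolyRep (k : ℕ) (C : ℝ) (P : (Fin p → ℝ) → ℝ) : Prop :=
  ∃ c : (Fin k → Option (Fin p)) → ℝ, (∀ v, |c v| ≤ C) ∧ ∀ x, P x = ∑ v, c v * wordMonomial v x

lemma PolyRep.mono {k : ℕ} {C C' : ℝ} {P : (Fin p → ℝ) → ℝ} (h : PolyRep k C P) (hC : C ≤ C') :
    PolyRep k C' P := by
  obtain ⟨c, hc, hP⟩ := h
  exact ⟨c, fun v => (hc v).trans hC, hP⟩

lemma polyRep_const (b : ℝ) : PolyRep 0 |b| (fun _ : Fin p → ℝ => b) :=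
  ⟨fun _ => b, fun _ => le_rfl, fun x => by simp [wordMonomial]⟩

lemma PolyRep.sum {k : ℕ} {ι : Type*} (s : Finset ι) {C : ι → ℝ} {P : ι → (Fin p → ℝ) → ℝ}
    (h : ∀ i ∈ s, PolyRep k (C i) (P i)) : PolyRep k (∑ i ∈ s, C i) (fun x => ∑ i ∈ s, P i x) := by
  classical
  choose! c hc hP using h
  refine ⟨fun v => ∑ i ∈ s, c i v, fun v => (Finset.abs_sum_le_sum_abs _ _).trans
    (Finset.sum_le_sum fun i hi => hc i hi v), fun x => ?_⟩
  simp only [Finset.sum_mul]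
  rw [Finset.sum_comm]
  exact Finset.sum_congr rfl fun i hi => hP i hi x

lemma PolyRep.const_mul {k : ℕ} {C : ℝ} {P : (Fin p → ℝ) → ℝ} (h : PolyRep k C P) (b : ℝ) :
    PolyRep k (|b| * C) (fun x => b * P x) := by
  obtain ⟨c, hc, hP⟩ := h
  refine ⟨fun v => b * c v, fun v => ?_, fun x => ?_⟩
  · rw [abs_mul]
    exact mul_le_mul_of_nonneg_left (hc v) (abs_nonneg _)
  · simp only [hP, Finset.mul_sum]
    exact Finset.sum_congr rfl fun v _ => by ring

/-- Multiplication by a polynomial of degree one. -/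
lemma PolyRep.affine_mul {k : ℕ} {C M : ℝ} {P : (Fin p → ℝ) → ℝ} (h : PolyRep k C P)
    {b : Option (Fin p) → ℝ} (hb : ∀ o, |b o| ≤ M) :
    PolyRep (k + 1) (M * C) (fun x => (∑ o, b o * hatCoord x o) * P x) := by
  obtain ⟨c, hc, hP⟩ := h
  refine ⟨fun v => b (v 0) * c (Fin.tail v), fun v => ?_, fun x => ?_⟩
  · rw [abs_mul]
    exact mul_le_mul (hb _) (hc _) (abs_nonneg _) ((abs_nonneg _).trans (hb none))
  · simp only [hP]
    rw [Finset.sum_mul_sum, ← Fintype.sum_prod_type' (f := fun o v =>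
      b o * hatCoord x o * (c v * wordMonomial v x))]
    refine Fintype.sum_equiv (Fin.consEquiv fun _ => Option (Fin p)) _ _ fun ov => ?_
    obtain ⟨o, v⟩ := ov
    simp only [Fin.consEquiv, Equiv.coe_fn_mk, Fin.cons_zero, Fin.tail_cons, wordMonomial]
    rw [Fin.prod_univ_succ]
    simp only [Fin.cons_zero, Fin.cons_succ]
    ring

/-- Words are padded with the letter `none`, whose coordinate is 1. All monomials thereby become
products of exactly k factors, the form needed for networks. -/
lemma PolyRep.succ {k : ℕ} {C : ℝ} {P : (Fin p → ℝ) → ℝ} (h : PolyRep k C P) :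
    PolyRep (k + 1) C P := by
  have := h.affine_mul (M := 1) (b := fun o => if o = none then 1 else 0)
    (fun o => by split_ifs <;> simp)
  rw [one_mul] at this
  convert this using 2 with x
  simp [hatCoord]

lemma PolyRep.of_le {k k' : ℕ} {C : ℝ} {P : (Fin p → ℝ) → ℝ} (h : PolyRep k C P) (hk : k ≤ k') :
    PolyRep k' C P := by
  induction hk with
  | refl => exact h
  | step _ ih => exact ih.succ

/-- Each differentiation contributes an affine factor κ (y_j - b_j) with coefficients at most κ, and
the sum over j gives the factor p. -/
lemma polyRep_homTerm {Q : Set (Fin p → ℝ)} {a b : Fin p → ℝ} {κ : ℝ} (hκ : 1 ≤ κ)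
    (hb : ∀ j, |b j| ≤ 1) (n : ℕ) {f : (Fin p → ℝ) → ℝ}
    (hf : ∀ w : List (Fin p), w.length = n → |iterDeriv Q w f a| ≤ A) :
    PolyRep n ((p * κ) ^ n * A) (fun y => homTerm Q a n f (κ • (y - b))) := by
  induction n generalizing f with
  | zero =>
    have h1 := polyRep_const (p := p) (f a)
    rw [pow_zero, one_mul]
    exact h1.mono (hf [] rfl)
  | succ n ih =>
    have hstep : ∀ j ∈ (Finset.univ : Finset (Fin p)), PolyRep (n + 1) (κ * ((p * κ) ^ n * A))
        (fun y => (κ • (y - b)) j * homTerm Q a n (coordDeriv Q j f) (κ • (y - b))) := by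
      intro j _
      have h1 := (ih (f := coordDeriv Q j f) fun w hw => hf (j :: w) (by simp [hw])).affine_mul
        (M := κ) (b := fun o => if o = none then -(κ * b j) else if o = some j then κ else 0) ?_
      · convert h1 using 2 with y
        simp [Fintype.sum_option, hatCoord]
        left
        ring
      · intro o
        split_ifs
        · rw [abs_neg, abs_mul, abs_of_nonneg (by linarith)]
          exact mul_le_of_le_one_right (by linarith) (hb j)
        · rw [abs_of_nonneg (by linarith)]
        · simpa using by linarith
    have h2 := PolyRep.sum Finset.univ hstep
    simp only [homTerm]
    refine h2.mono (le_of_eq ?_)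
    rw [Finset.sum_const, Finset.card_univ, Fintype.card_fin, nsmul_eq_mul, pow_succ]
    ring

/-- Local approximation by polynomials of degree `k`, up to order `β`, with constant `C`. -/
def LocPoly (k : ℕ) (β C : ℝ) (Q : Set (Fin p → ℝ)) (G : (Fin p → ℝ) → ℝ) : Prop :=
  ∀ b ∈ Q, ∃ c : (Fin k → Option (Fin p)) → ℝ, (∀ v, |c v| ≤ C) ∧
    ∀ y ∈ Q, |G y - ∑ v, c v * wordMonomial v y| ≤ C * ‖y - b‖ ^ β

/-- Functions in a Hölder ball, normalized to the unit interval, have local approximations by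
polynomials. -/
lemma exists_locPoly (p : ℕ) {β A F : ℝ} (hβ : 0 < β) (hA : 0 ≤ A) (hF : 1 ≤ F) :
    ∃ C : ℝ, 0 < C ∧ ∀ (r : ℕ) (l u : ℝ), l < u → |l| ≤ F → |u| ≤ F → ∀ f : (Fin p → ℝ) → ℝ,
      HolderClass p r β l u A f →
      LocPoly (strictFloor β) β C (cube p ((l + F) / (2 * F)) ((u + F) / (2 * F)))
        (fun y => (f (fun j => 2 * F * y j - F) + F) / (2 * F)) := by
  set k := strictFloor β with hk
  -- D bounds the coefficients of the Taylor polynomial after the substitution y ↦ 2 F y - F, and E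
  -- below bounds the Hölder remainder. The final addition of F and division by 2 F costs at most 1.
  set D : ℝ := ∑ n ∈ Finset.range (k + 1), (p * (2 * F)) ^ n * A with hD
  have hD0 : 0 ≤ D := Finset.sum_nonneg fun n _ => by positivity
  set E : ℝ := p ^ k * A * (2 * F) ^ β with hE
  refine ⟨D + 1 + E, by positivity, ?_⟩
  intro r l u hlu hl hu f hf b hb
  set Q := cube p l u with hQ
  set a : Fin p → ℝ := fun j => 2 * F * b j - F with ha
  have h2F : 0 < 2 * F := by linarith
  have hmem : ∀ y ∈ cube p ((l + F) / (2 * F)) ((u + F) / (2 * F)),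
      (fun j => 2 * F * y j - F) ∈ Q := by
    intro y hy
    refine ⟨fun j => ?_, fun j => ?_⟩
    · have := hy.1 j
      simp only at this
      rw [div_le_iff₀ h2F] at this
      simp only
      linarith
    · have := hy.2 j
      simp only at this
      rw [le_div_iff₀ h2F] at this
      simp only
      linarith
  have haQ := hmem b hb
  have hb1 : ∀ j, |b j| ≤ 1 := fun j => by
    have h1 := hb.1 j
    have h2 := hb.2 j
    simp only at h1 h2
    rw [div_le_iff₀ h2F] at h1
    rw [le_div_iff₀ h2F] at h2
    rw [abs_le]
    constructor <;> nlinarith [abs_le.1 hl, abs_le.1 hu]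
  have hpoly : PolyRep k (D + 1) fun y => (∑ n ∈ Finset.range (k + 1),
      (1 / (n.factorial : ℝ)) * homTerm Q a n f ((2 * F) • (y - b)) + F) * (1 / (2 * F)) := by
    have h1 : PolyRep k D fun y => ∑ n ∈ Finset.range (k + 1),
        (1 / (n.factorial : ℝ)) * homTerm Q a n f ((2 * F) • (y - b)) := by
      refine PolyRep.sum _ fun n hn => ?_
      have hnk : n ≤ k := Nat.lt_succ_iff.1 (Finset.mem_range.1 hn)
      have h2 := polyRep_homTerm (Q := Q) (a := a) (b := b) (κ := 2 * F) (by linarith) hb1 n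
        (f := f) fun w hw => hf.abs_iterDeriv_le hlu hA (by omega) hβ haQ
      refine ((h2.of_le hnk).const_mul (1 / (n.factorial : ℝ))).mono ?_
      rw [abs_of_nonneg (by positivity)]
      refine mul_le_of_le_one_left (by positivity) ?_
      rw [div_le_one (by positivity)]
      exact_mod_cast n.factorial_pos
    have h3 := PolyRep.sum (p := p) (k := k) (Finset.univ : Finset Bool)
      (C := fun t => if t then D else F)
      (P := fun t y => if t then ∑ n ∈ Finset.range (k + 1),
        (1 / (n.factorial : ℝ)) * homTerm Q a n f ((2 * F) • (y - b)) else F) (by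
        intro t _
        cases t
        · have h4 := (polyRep_const (p := p) F).of_le (Nat.zero_le k)
          rw [abs_of_nonneg (by linarith)] at h4
          simpa using h4
        · simpa using h1)
    simp only [Fintype.sum_bool, if_true, Bool.false_eq_true, if_false] at h3
    have h5 := h3.const_mul (1 / (2 * F))
    have h6 : |1 / (2 * F)| * (D + F) ≤ D + 1 := by
      rw [abs_of_nonneg (by positivity), div_mul_eq_mul_div, one_mul, div_le_iff₀ h2F]
      nlinarith
    refine PolyRep.mono ?_ h6
    convert h5 using 2 with y
    exact mul_comm _ _
  obtain ⟨c, hc, hcP⟩ := hpoly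
  refine ⟨c, fun v => (hc v).trans (by have : 0 ≤ E := by positivity
                                       linarith), fun y hy => ?_⟩
  rw [← hcP]
  have hyQ := hmem y hy
  have hkβ : (k : ℝ) < β := strictFloor_cast_lt hβ
  have htay := abs_sub_taylor_le hlu k hA (sub_nonneg.2 hkβ.le) haQ (f := f) hf.2.1
    (fun w hw x hx => hf.abs_iterDeriv_sub_le hlu hA hw hx haQ) _ hyQ
  have hsub : (fun j => 2 * F * y j - F) - a = (2 * F) • (y - b) := by
    funext j
    simp [ha]
    ring
  rw [hsub, add_sub_cancel, norm_smul, Real.norm_of_nonneg h2F.le,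
    Real.mul_rpow h2F.le (norm_nonneg _)] at htay
  have hsum : ∑ n ∈ Finset.range (k + 1), homTerm Q a n f ((2 * F) • (y - b)) / (n.factorial : ℝ) =
      ∑ n ∈ Finset.range (k + 1), (1 / (n.factorial : ℝ)) * homTerm Q a n f ((2 * F) • (y - b)) :=
    Finset.sum_congr rfl fun n _ => by ring
  rw [hsum] at htay
  set S := ∑ n ∈ Finset.range (k + 1), (1 / (n.factorial : ℝ)) * homTerm Q a n f ((2 * F) • (y - b))
  have h1 : (f (fun j => 2 * F * y j - F) + F) / (2 * F) - (S + F) * (1 / (2 * F)) =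
      (f (fun j => 2 * F * y j - F) - S) / (2 * F) := by
    field_simp
    ring
  rw [h1, abs_div, abs_of_pos h2F, div_le_iff₀ h2F]
  have hyb : 0 ≤ ‖y - b‖ ^ β := by positivity
  have h2 : p ^ k * A * ((2 * F) ^ β * ‖y - b‖ ^ β) = E * ‖y - b‖ ^ β := by rw [hE]; ring
  rw [h2] at htay
  refine htay.trans ?_
  have hE0 : 0 ≤ E := by positivity
  calc E * ‖y - b‖ ^ β ≤ (D + 1 + E) * ‖y - b‖ ^ β * 1 := by
        rw [mul_one]
        gcongr
        linarith
    _ ≤ _ := by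
        gcongr
        linarith

end Taylor

end SparseDNN

namespace SparseDNN

/-! ### Sparse layered computations -/

section Reach

variable {X : Type*} {K : ℝ}

/-- `Reach K f L e n' f'`: the functions `f'` arise from `f` by adding, in at most `L` layers,
ReLU units with at most `e` connections in total, with all weights bounded by `K`. -/
inductive Reach (K : ℝ) {n : ℕ} (f : Fin n → X → ℝ) :
    ℕ → ℕ → (n' : ℕ) → (Fin n' → X → ℝ) → Prop
  | refl (L e : ℕ) : Reach K f L e n f
  | step {L e n' m c : ℕ} {f' : Fin n' → X → ℝ} (h : Reach K f L e n' f')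
      (W : Matrix (Fin m) (Fin n') ℝ) (b : Fin m → ℝ) (hW : ∀ k i, |W k i| ≤ K)
      (hb : ∀ k, |b k| ≤ K) (hc : ∑ k, ((Finset.univ.filter fun i => W k i ≠ 0).card + 1) ≤ c) :
      Reach K f (L + 1) (e + c) (n' + m)
        (Fin.append f' fun k ξ => max (∑ i, W k i * f' i ξ + b k) 0)

variable {n n' n'' L L' e e' : ℕ} {f : Fin n → X → ℝ} {f' : Fin n' → X → ℝ}
  {f'' : Fin n'' → X → ℝ}

lemma Reach.mono (h : Reach K f L e n' f') : ∀ {L' e' : ℕ}, L ≤ L' → e ≤ e' →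
    Reach K f L' e' n' f' := by
  induction h with
  | refl => exact fun _ _ => Reach.refl _ _
  | @step L e n' m c f' _ W b hW hb hc ih =>
    intro L' e' hL he
    obtain ⟨L'', rfl⟩ : ∃ L'', L' = L'' + 1 := ⟨L' - 1, by omega⟩
    obtain ⟨e'', rfl⟩ : ∃ e'', e' = e'' + c := ⟨e' - c, by omega⟩
    exact Reach.step (ih (by omega) (by omega)) W b hW hb hc

lemma Reach.trans (h : Reach K f L e n' f') (h' : Reach K f' L' e' n'' f'') :
    Reach K f (L + L') (e + e') n'' f'' := by
  induction h' with
  | refl => exact h.mono (by omega) (by omega)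
  | step _ W b hW hb hc ih =>
    rw [← add_assoc, ← add_assoc]
    exact Reach.step ih W b hW hb hc

lemma Reach.range_subset (h : Reach K f L e n' f') : Set.range f ⊆ Set.range f' := by
  induction h with
  | refl => exact subset_rfl
  | step _ W b _ _ _ ih =>
    refine ih.trans ?_
    rintro _ ⟨i, rfl⟩
    exact ⟨Fin.castAdd _ i, Fin.append_left _ _ _⟩

/-! ### Conversion to networks -/

/-- The number of nonzero parameters. -/
noncomputable def Net.nnz {p : ℕ} (f : Net p) : ℕ :=
  (f.params.filter fun θ => θ ≠ 0).card

lemma Net.clipNorm_le_nnz {p : ℕ} (f : Net p) (τ : ℝ) : f.clipNorm τ ≤ f.nnz := by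
  rw [Net.clipNorm, Net.nnz]
  induction f.params using Multiset.induction with
  | empty => simp
  | cons a s ih =>
    rw [Multiset.map_cons, Multiset.sum_cons]
    by_cases ha : a = 0
    · subst ha
      rw [Multiset.filter_cons_of_neg (p := fun θ : ℝ => θ ≠ 0) _ (by simp)]
      simpa using ih
    · rw [Multiset.filter_cons_of_pos (p := fun θ : ℝ => θ ≠ 0) _ ha, Multiset.card_cons]
      push_cast
      linarith [min_le_right (|a| / τ) 1]

lemma card_filter_map_ne {ι : Type*} [Fintype ι] (g : ι → ℝ) :
    ((Finset.univ.val.map g).filter fun θ => θ ≠ 0).card =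
      (Finset.univ.filter fun i => g i ≠ 0).card := by
  rw [← Multiset.countP_eq_card_filter, Multiset.countP_map]
  rfl

lemma Net.nnz_hidden {p p' : ℕ} (W : Matrix (Fin p') (Fin p) ℝ) (b : Fin p' → ℝ) (rest : Net p') :
    (Net.hidden W b rest).nnz ≤
      (∑ i, (Finset.univ.filter fun j => W i j ≠ 0).card) + p' + rest.nnz := by
  rw [Net.nnz, Net.params, Multiset.filter_add, Multiset.filter_add, Multiset.card_add,
    Multiset.card_add, card_filter_map_ne, card_filter_map_ne]
  refine Nat.add_le_add (Nat.add_le_add (le_of_eq ?_) ?_) le_rfl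
  · rw [Finset.card_filter, Fintype.sum_prod_type]
    simp only [Finset.card_filter]
  · exact (Finset.card_le_univ _).trans (by simp)

/-- All functions are nonnegative, so ReLU units with one connection carry the old ones through each
layer. Every layer is scaled by K⁻¹, which brings weights below one and accumulates the factor K⁻¹ ^
L₀ on all functions; shifts are scaled by the full accumulated factor to match. Carrying costs at
most 2 (n + e) parameters per layer, counting shifts. Quantifying over `rest` makes the induction
prepend a layer to an arbitrary continuation. -/
theorem Reach.exists_net (hK : 1 ≤ K) (h : Reach K f L e n' f') (hn : 0 < n)
    (hf : ∀ i ξ, 0 ≤ f i ξ) :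
    (∀ i ξ, 0 ≤ f' i ξ) ∧ n' ≤ n + e ∧ 0 < n' ∧ ∃ L₀ ≤ L, ∀ rest : Net n', ∃ net : Net n,
      (∀ ξ, net.eval (fun i => f i ξ) = rest.eval (fun i => K⁻¹ ^ L₀ * f' i ξ)) ∧
      net.depth = L₀ + rest.depth ∧
      (∀ w ∈ net.hiddenWidths, w ∈ rest.hiddenWidths ∨ (1 ≤ w ∧ w ≤ n + e)) ∧
      (∀ θ ∈ net.params, |θ| ≤ 1 ∨ θ ∈ rest.params) ∧
      net.nnz ≤ rest.nnz + 2 * (L * (n + e)) + e := by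
  have hK0 : 0 < K := by linarith
  have hK1 : K⁻¹ ≤ 1 := inv_le_one_of_one_le₀ hK
  have hKi : 0 < K⁻¹ := inv_pos.2 hK0
  induction h with
  | refl L e =>
    exact ⟨hf, by omega, hn, 0, Nat.zero_le _, fun rest => ⟨rest, fun ξ => by simp, by simp,
      fun w hw => Or.inl hw, fun θ hθ => Or.inr hθ, by omega⟩⟩
  | @step L e n' m c f' _ W b hW hb hc ih =>
    obtain ⟨hf', hn', hn'0, L₀, hL₀, hnet⟩ := ih
    have hmc : m ≤ c := by
      refine le_trans ?_ hc
      rw [Finset.sum_add_distrib]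
      simp
    refine ⟨?_, by omega, by omega, L₀ + 1, by omega, fun rest => ?_⟩
    · intro i ξ
      refine Fin.addCases (fun i => ?_) (fun k => ?_) i
      · rw [Fin.append_left]
        exact hf' i ξ
      · rw [Fin.append_right]
        exact le_max_right _ _
    set W' : Matrix (Fin (n' + m)) (Fin n') ℝ :=
      Fin.append (fun i => Pi.single i K⁻¹) (fun k i => K⁻¹ * W k i) with hW'
    set b' : Fin (n' + m) → ℝ := Fin.append (fun _ => 0) (fun k => K⁻¹ ^ (L₀ + 1) * b k) with hb'
    obtain ⟨net, h1, h2, h3, h4, h5⟩ := hnet (Net.hidden W' b' rest)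
    refine ⟨net, fun ξ => ?_, ?_, fun w hw => ?_, fun θ hθ => ?_, ?_⟩
    · rw [h1, Net.eval]
      congr 1
      funext i
      refine Fin.addCases (fun i => ?_) (fun k => ?_) i
      · rw [Fin.append_left, Pi.add_apply, Matrix.mulVec, dotProduct]
        simp only [hW', hb', Fin.append_left]
        simp only [Pi.single_apply, ite_mul, zero_mul, Finset.sum_ite_eq', Finset.mem_univ,
          if_true, add_zero]
        rw [max_eq_left, pow_succ]
        · ring
        · have := hf' i ξ
          positivity
      · rw [Fin.append_right, Pi.add_apply, Matrix.mulVec, dotProduct]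
        simp only [hW', hb', Fin.append_right]
        rw [mul_max_of_nonneg _ _ (by positivity), mul_zero, mul_add, Finset.mul_sum]
        congr 2
        refine Finset.sum_congr rfl fun j _ => ?_
        rw [pow_succ]
        ring
    · rw [h2]
      simp only [Net.depth, Net.hiddenWidths, List.length_cons]
      ring
    · rcases h3 w hw with h | h
      · rw [Net.hiddenWidths, List.mem_cons] at h
        rcases h with rfl | h
        · exact Or.inr ⟨by omega, by omega⟩
        · exact Or.inl h
      · exact Or.inr ⟨h.1, by omega⟩
    · rcases h4 θ hθ with h | h
      · exact Or.inl h
      rw [Net.params, Multiset.mem_add, Multiset.mem_add] at h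
      rcases h with (h | h) | h
      · obtain ⟨⟨i, j⟩, -, rfl⟩ := Multiset.mem_map.1 h
        left
        refine Fin.addCases (fun i => ?_) (fun k => ?_) i
        · simp only [hW', Fin.append_left, Pi.single_apply]
          split_ifs
          · rwa [abs_of_pos hKi]
          · simp
        · simp only [hW', Fin.append_right]
          rw [abs_mul, abs_of_pos hKi]
          calc K⁻¹ * |W k j| ≤ K⁻¹ * K := by gcongr; exact hW k j
            _ = 1 := inv_mul_cancel₀ hK0.ne'
      · obtain ⟨i, -, rfl⟩ := Multiset.mem_map.1 h
        left
        refine Fin.addCases (fun i => ?_) (fun k => ?_) i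
        · simp [hb']
        · simp only [hb', Fin.append_right]
          rw [abs_mul, abs_of_pos (by positivity), pow_succ, mul_assoc]
          calc K⁻¹ ^ L₀ * (K⁻¹ * |b k|) ≤ 1 * (K⁻¹ * K) := by
                gcongr
                · exact pow_le_one₀ hKi.le hK1
                · exact hb k
            _ = 1 := by rw [one_mul, inv_mul_cancel₀ hK0.ne']
      · exact Or.inr h
    · refine h5.trans ?_
      have h6 := Net.nnz_hidden W' b' rest
      have h7 : (∑ i, (Finset.univ.filter fun j => W' i j ≠ 0).card) ≤
          n' + ∑ k, (Finset.univ.filter fun i => W k i ≠ 0).card := by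
        rw [Fin.sum_univ_add]
        refine Nat.add_le_add ?_ (Finset.sum_le_sum fun k _ => ?_)
        · refine (Finset.sum_le_card_nsmul _ _ 1 fun i _ => ?_).trans (by simp)
          rw [Finset.card_le_one]
          intro a ha b hb
          simp only [hW', Fin.append_left, Finset.mem_filter, Finset.mem_univ, true_and,
            Pi.single_apply, ne_eq, ite_eq_right_iff, not_forall] at ha hb
          rw [ha.1, hb.1]
        · refine Finset.card_le_card fun j hj => ?_
          simp only [hW', Fin.append_right, Finset.mem_filter, Finset.mem_univ, true_and] at hj ⊢
          exact right_ne_zero_of_mul hj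
      have h8 : (∑ k, (Finset.univ.filter fun i => W k i ≠ 0).card) + m ≤ c := by
        rw [Finset.sum_add_distrib] at hc
        simpa using hc
      have h9 : L * (n + e) ≤ L * (n + (e + c)) := Nat.mul_le_mul_left _ (by omega)
      rw [Nat.add_mul L 1, one_mul]
      omega

/-! ### Computable sets of functions -/

/-- From any list of functions containing `I`, a list containing `J` can be reached. -/
def Makes (K : ℝ) (L e : ℕ) (I J : Set (X → ℝ)) : Prop :=
  ∀ (n : ℕ) (f : Fin n → X → ℝ), I ⊆ Set.range f → ∃ (n' : ℕ) (f' : Fin n' → X → ℝ),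
    Reach K f L e n' f' ∧ J ⊆ Set.range f'

variable {I I' J J' : Set (X → ℝ)}

lemma makes_self (L e : ℕ) : Makes K L e I I := fun n f hf => ⟨n, f, Reach.refl _ _, hf⟩

lemma Makes.mono (h : Makes K L e I J) (hL : L ≤ L') (he : e ≤ e') (hI : I ⊆ I') (hJ : J' ⊆ J) :
    Makes K L' e' I' J' := fun n f hf => by
  obtain ⟨n', f', h1, h2⟩ := h n f (hI.trans hf)
  exact ⟨n', f', h1.mono hL he, hJ.trans h2⟩

lemma Makes.trans (h : Makes K L e I J) (h' : Makes K L' e' (I ∪ J) J') :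
    Makes K (L + L') (e + e') I (J ∪ J') := fun n f hf => by
  obtain ⟨n', f', h1, h2⟩ := h n f hf
  obtain ⟨n'', f'', h3, h4⟩ := h' n' f' (Set.union_subset (hf.trans h1.range_subset) h2)
  exact ⟨n'', f'', h1.trans h3, Set.union_subset (h2.trans h3.range_subset) h4⟩

/-- The members are computed one after another, so the depth is multiplied too. This is harmless
because it is used for index sets whose size does not depend on T; larger families go through
`makes_family` in a single layer. -/
lemma Makes.finset {ι : Type*} (s : Finset ι) {g : ι → Set (X → ℝ)}
    (h : ∀ i ∈ s, Makes K L e I (g i)) : Makes K (s.card * L) (s.card * e) I (⋃ i ∈ s, g i) := by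
  classical
  induction s using Finset.induction_on with
  | empty => simpa using (makes_self (K := K) 0 0).mono le_rfl le_rfl (Set.empty_subset I) subset_rfl
  | insert i s hi ih =>
    rw [Finset.card_insert_of_notMem hi, Finset.set_biUnion_insert, add_mul, add_mul, one_mul,
      one_mul, add_comm, add_comm _ e]
    exact (h i (Finset.mem_insert_self _ _)).trans
      ((ih fun j hj => h j (Finset.mem_insert_of_mem hj)).mono le_rfl le_rfl
        Set.subset_union_left subset_rfl)

/-- Several inputs of a unit may be the same function in the list; their weights are then added,
hence the hypothesis on the sum of the |w k j|. The injective positions allow a later unit to give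
every member its own coefficient. -/
lemma exists_reach_family {ι : Type*} [Fintype ι] {a : ℕ} (w : ι → Fin a → ℝ)
    (h : ι → Fin a → X → ℝ) (b : ι → ℝ) (hI : I ⊆ Set.range f) (hh : ∀ k j, h k j ∈ I)
    (hw : ∀ k, ∑ j, |w k j| ≤ K) (hb : ∀ k, |b k| ≤ K) :
    ∃ (n' : ℕ) (f' : Fin n' → X → ℝ) (idx : ι → Fin n'), Function.Injective idx ∧
      Reach K f 1 (Fintype.card ι * (a + 1)) n' f' ∧
      ∀ k, f' (idx k) = fun ξ => max (∑ j, w k j * h k j ξ + b k) 0 := by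
  classical
  choose φ hφ using fun k j => hI (hh k j)
  set ε := Fintype.equivFin ι
  set W : Matrix (Fin (Fintype.card ι)) (Fin n) ℝ := fun k i =>
    ∑ j, if φ (ε.symm k) j = i then w (ε.symm k) j else 0 with hW
  have key := Reach.step (K := K) (Reach.refl (f := f) 0 0) W (fun k => b (ε.symm k))
    (c := Fintype.card ι * (a + 1)) ?_ (fun k => hb _) ?_
  · rw [zero_add, zero_add] at key
    refine ⟨_, _, fun k => Fin.natAdd n (ε k), ?_, key, fun k => ?_⟩
    · intro k k' hkk
      exact ε.injective (Fin.natAdd_injective _ _ hkk)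
    · rw [Fin.append_right]
      funext ξ
      simp only [hW, Equiv.symm_apply_apply, Finset.sum_mul]
      rw [Finset.sum_comm]
      congr 2
      refine Finset.sum_congr rfl fun j _ => ?_
      simp [ite_mul, hφ]
  · intro k i
    refine (Finset.abs_sum_le_sum_abs _ _).trans (le_trans ?_ (hw (ε.symm k)))
    refine Finset.sum_le_sum fun j _ => ?_
    split_ifs
    · exact le_rfl
    · simp
  · refine (Finset.sum_le_card_nsmul _ _ (a + 1) fun k _ => ?_).trans (by simp)
    refine Nat.add_le_add_right ?_ 1
    calc _ ≤ (Finset.univ.image (φ (ε.symm k))).card := by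
          refine Finset.card_le_card fun i hi => ?_
          rw [Finset.mem_filter] at hi
          by_contra hc
          refine hi.2 (Finset.sum_eq_zero fun j _ => if_neg fun hj => hc ?_)
          exact Finset.mem_image.2 ⟨j, Finset.mem_univ _, hj⟩
      _ ≤ a := Finset.card_image_le.trans (by simp)

lemma makes_family {ι : Type*} [Fintype ι] {a : ℕ} (w : ι → Fin a → ℝ)
    (h : ι → Fin a → X → ℝ) (b : ι → ℝ) (hh : ∀ k j, h k j ∈ I)
    (hw : ∀ k, ∑ j, |w k j| ≤ K) (hb : ∀ k, |b k| ≤ K) :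
    Makes K 1 (Fintype.card ι * (a + 1)) I
      (Set.range fun k ξ => max (∑ j, w k j * h k j ξ + b k) 0) := fun n f hf => by
  obtain ⟨n', f', idx, -, h1, h2⟩ := exists_reach_family w h b hf hh hw hb
  refine ⟨n', f', h1, ?_⟩
  rintro _ ⟨k, rfl⟩
  exact ⟨idx k, h2 k⟩

lemma makes_node {a : ℕ} (w : Fin a → ℝ) (h : Fin a → X → ℝ) (b : ℝ) (hh : ∀ j, h j ∈ I)
    (hw : ∑ j, |w j| ≤ K) (hb : |b| ≤ K) :
    Makes K 1 (a + 1) I {fun ξ => max (∑ j, w j * h j ξ + b) 0} := by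
  have := makes_family (ι := Unit) (K := K) (I := I) (fun _ => w) (fun _ => h) (fun _ => b)
    (fun _ => hh) (fun _ => hw) (fun _ => hb)
  refine this.mono le_rfl (by simp) subset_rfl ?_
  rintro _ rfl
  exact ⟨(), rfl⟩

/-- Since the summands sit at distinct positions even if they coincide as functions, the
coefficients need only be bounded one by one, although their number grows with the grid. -/
lemma makes_wide_sum {ι : Type*} [Fintype ι] {a : ℕ} (w : ι → Fin a → ℝ)
    (h : ι → Fin a → X → ℝ) (b : ι → ℝ) (hh : ∀ k j, h k j ∈ I)
    (hw : ∀ k, ∑ j, |w k j| ≤ K) (hb : ∀ k, |b k| ≤ K) (c : ι → ℝ) (hc : ∀ k, |c k| ≤ K)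
    (hK : 0 ≤ K) :
    Makes K 2 (Fintype.card ι * (a + 2) + 1) I
      {fun ξ => max (∑ k, c k * max (∑ j, w k j * h k j ξ + b k) 0) 0} := fun n f hf => by
  classical
  obtain ⟨n', f', idx, hidx, h1, h2⟩ := exists_reach_family w h b hf hh hw hb
  set V : Matrix (Fin 1) (Fin n') ℝ := fun _ i => ∑ k, if idx k = i then c k else 0 with hV
  have hV1 : ∀ k, V 0 (idx k) = c k := fun k => by
    simp only [hV]
    rw [Finset.sum_eq_single k (fun k' _ hk' => if_neg fun h => hk' (hidx h)) (by simp)]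
    simp
  have hV0 : ∀ i, (∀ k, idx k ≠ i) → V 0 i = 0 := fun i hi =>
    Finset.sum_eq_zero fun k _ => if_neg (hi k)
  have key := Reach.step (K := K) h1 V (fun _ => 0) (c := Fintype.card ι + 1) ?_
    (fun k => by simpa using hK) ?_
  · refine ⟨_, _, key.mono le_rfl (le_of_eq (by ring)), ?_⟩
    rintro _ rfl
    refine ⟨Fin.natAdd n' 0, ?_⟩
    rw [Fin.append_right]
    funext ξ
    simp only [hV, Finset.sum_mul, add_zero]
    rw [Finset.sum_comm]
    congr 1
    refine Finset.sum_congr rfl fun k _ => ?_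
    simp [ite_mul, h2]
  · intro k i
    rw [Subsingleton.elim k 0]
    by_cases hi : ∃ k, idx k = i
    · obtain ⟨k, rfl⟩ := hi
      rw [hV1]
      exact hc k
    · push Not at hi
      rw [hV0 i hi]
      simpa using hK
  · rw [Fin.sum_univ_one]
    refine Nat.add_le_add_right ?_ 1
    calc _ ≤ (Finset.univ.image idx).card := by
          refine Finset.card_le_card fun i hi => ?_
          rw [Finset.mem_filter] at hi
          by_contra hcon
          refine hi.2 (hV0 i fun k hk => hcon ?_)
          exact Finset.mem_image.2 ⟨k, Finset.mem_univ _, hk⟩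
      _ ≤ _ := Finset.card_image_le

end Reach

end SparseDNN

namespace SparseDNN

/-! ### Rescaling at the output -/

section Output

/-- A chain of `m` doublings of two duplicated numbers. -/
noncomputable def doublingNet (w : ℝ) : ℕ → Net 4
  | 0 => .output ![w, w, -(w / 2), -(w / 2)] 0
  | m + 1 => .hidden !![1, 1, 0, 0; 1, 1, 0, 0; 0, 0, 1, 1; 0, 0, 1, 1] 0 (doublingNet w m)

/-- Each number is kept twice, so adding the two copies doubles it with weights equal to one. -/
lemma doublingNet_eval (w : ℝ) (m : ℕ) {a c : ℝ} (ha : 0 ≤ a) (hc : 0 ≤ c) :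
    (doublingNet w m).eval ![a, a, c, c] = w * 2 ^ m * (2 * a - c) := by
  induction m generalizing a c with
  | zero =>
    simp [doublingNet, Net.eval]
    ring
  | succ m ih =>
    have : (fun i => max (((!![1, 1, 0, 0; 1, 1, 0, 0; 0, 0, 1, 1; 0, 0, 1, 1] :
        Matrix (Fin 4) (Fin 4) ℝ).mulVec ![a, a, c, c] + (0 : Fin 4 → ℝ)) i) 0) =
        ![2 * a, 2 * a, 2 * c, 2 * c] := by
      funext i
      fin_cases i <;> simp <;>
        rw [max_eq_left (by positivity)] <;> ring
    rw [doublingNet, Net.eval, this, ih (by positivity) (by positivity), pow_succ]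
    ring

lemma doublingNet_hiddenWidths (w : ℝ) (m : ℕ) :
    (doublingNet w m).hiddenWidths = List.replicate m 4 := by
  induction m with
  | zero => rfl
  | succ m ih => rw [doublingNet, Net.hiddenWidths, ih]; rfl

lemma doublingNet_params {w : ℝ} (hw : |w| ≤ 1) (m : ℕ) :
    ∀ θ ∈ (doublingNet w m).params, |θ| ≤ 1 := by
  induction m with
  | zero =>
    intro θ hθ
    rw [doublingNet, Net.params, Multiset.mem_add, Multiset.mem_map, Multiset.mem_singleton] at hθ
    rcases hθ with ⟨i, -, rfl⟩ | rfl
    · fin_cases i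
      · simpa using hw
      · simpa using hw
      · simp only [Fin.reduceFinMk, Matrix.cons_val, abs_neg, abs_div, Nat.abs_ofNat]
        linarith
      · simp only [Fin.reduceFinMk, Matrix.cons_val, abs_neg, abs_div, Nat.abs_ofNat]
        linarith
    · simp
  | succ m ih =>
    intro θ hθ
    rw [doublingNet, Net.params, Multiset.mem_add, Multiset.mem_add, Multiset.mem_map,
      Multiset.mem_map] at hθ
    rcases hθ with (⟨⟨i, j⟩, -, rfl⟩ | ⟨i, -, rfl⟩) | h
    · fin_cases i <;> fin_cases j <;> simp
    · simp
    · exact ih θ h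

lemma doublingNet_nnz (w : ℝ) (m : ℕ) : (doublingNet w m).nnz ≤ 20 * m + 5 := by
  refine (Multiset.card_le_card (Multiset.filter_le _ _)).trans ?_
  induction m with
  | zero => simp [doublingNet, Net.params]
  | succ m ih =>
    rw [doublingNet, Net.params, Multiset.card_add, Multiset.card_add, Multiset.card_map,
      Multiset.card_map]
    simp only [Finset.card_val, Finset.card_univ, Fintype.card_prod, Fintype.card_fin]
    omega

/-- The conversion yields K⁻¹ ^ L₀ g and, from an added unit for the constant one, K⁻¹ ^ L₀ itself.
Their combination 2 g - 1 maps [0, 1] to [-1, 1], and multiplication by F K ^ L₀ is done by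
doublings. -/
theorem exists_net_of_makes {d : ℕ} (hd : 0 < d) {K F : ℝ} (hK : 1 ≤ K) (hF : 1 ≤ F) {a b : ℕ}
    (ha : K ≤ 2 ^ a) (hb : F ≤ 2 ^ b) {L e : ℕ} {g : cube d 0 1 → ℝ}
    (h : Makes K L e (Set.range fun j (ξ : cube d 0 1) => ξ.1 j) {g}) :
    ∃ net : Net d, (∀ ξ : cube d 0 1, net.eval ξ = F * (2 * g ξ - 1)) ∧ 1 ≤ net.depth ∧
      net.depth ≤ (a + 1) * (L + 1) + b + 1 ∧
      (∀ w ∈ net.hiddenWidths, 1 ≤ w ∧ w ≤ d + e + 4) ∧ (∀ θ ∈ net.params, |θ| ≤ 1) ∧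
      net.nnz ≤ 2 * ((L + 1) * (d + e + 1)) + e + 20 * (a * (L + 1) + b) + 14 := by
  have hmk : Makes K (L + 1) (e + (0 + 1)) (Set.range fun j (ξ : cube d 0 1) => ξ.1 j)
      ({g} ∪ {fun _ => (1 : ℝ)}) := by
    refine h.trans ((makes_node (a := 0) Fin.elim0 Fin.elim0 1 (fun j => j.elim0)
      (by simp; linarith) (by simpa)).mono le_rfl le_rfl subset_rfl ?_)
    rintro _ rfl
    simp
  obtain ⟨n', f', hreach, hJ⟩ := hmk d _ subset_rfl
  obtain ⟨hf', hn', hn'0, L₀, hL₀, hnet⟩ := hreach.exists_net hK hd (fun i ξ => ξ.2.1 i)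
  obtain ⟨i₀, hi₀⟩ := hJ (Or.inl rfl)
  obtain ⟨i₁, hi₁⟩ := hJ (Or.inr rfl)
  -- So many doublings reach F K ^ L₀, since K ≤ 2 ^ a and F ≤ 2 ^ b; the leftover factor w is then
  -- at most one and is an admissible weight.
  set m := a * L₀ + b with hm
  set w := F * K ^ L₀ / 2 ^ m with hw
  have hK0 : 0 < K := by linarith
  have hw1 : |w| ≤ 1 := by
    rw [hw, abs_of_pos (by positivity), div_le_one (by positivity), hm, pow_add, pow_mul, mul_comm]
    gcongr
  set W : Matrix (Fin 4) (Fin n') ℝ := fun i => Pi.single (![i₀, i₀, i₁, i₁] i) 1 with hW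
  obtain ⟨net, h1, h2, h3, h4, h5⟩ := hnet (.hidden W 0 (doublingNet w m))
  have hdep : (doublingNet w m).depth = m := by
    rw [Net.depth, doublingNet_hiddenWidths, List.length_replicate]
  have hdep' : (Net.hidden W 0 (doublingNet w m)).depth = m + 1 := by
    have := congrArg (· + 1) hdep
    exact this
  have haL : a * L₀ ≤ a * (L + 1) := Nat.mul_le_mul_left _ hL₀
  refine ⟨net, fun ξ => ?_, ?_, ?_, fun w hw => ?_, fun θ hθ => ?_, ?_⟩
  · have h1' := h1 ξ
    rw [Net.eval] at h1'
    have : (fun i => max ((W.mulVec (fun i => K⁻¹ ^ L₀ * f' i ξ) + 0) i) 0) =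
        ![K⁻¹ ^ L₀ * g ξ, K⁻¹ ^ L₀ * g ξ, K⁻¹ ^ L₀, K⁻¹ ^ L₀] := by
      have hg : 0 ≤ g ξ := by rw [← hi₀]; exact hf' i₀ ξ
      funext i
      rw [Pi.add_apply, Matrix.mulVec]
      simp only [hW, single_dotProduct, one_mul, Pi.zero_apply, add_zero]
      fin_cases i
      · simp only [Fin.zero_eta, Matrix.cons_val_zero, hi₀]
        exact max_eq_left (by positivity)
      · simp only [Fin.mk_one, Matrix.cons_val_one, Matrix.cons_val_zero, hi₀]
        exact max_eq_left (by positivity)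
      · simp only [Fin.reduceFinMk, Matrix.cons_val, hi₁, mul_one]
        exact max_eq_left (by positivity)
      · simp only [Fin.reduceFinMk, Matrix.cons_val, hi₁, mul_one]
        exact max_eq_left (by positivity)
    rw [this, doublingNet_eval _ _ (by rw [← hi₀]; have := hf' i₀ ξ; positivity)
      (by positivity)] at h1'
    rw [h1', hw, inv_pow]
    field_simp
  · omega
  · rw [h2, hdep']
    rw [add_mul, one_mul]
    omega
  · rcases h3 w hw with h | h
    · rw [Net.hiddenWidths, List.mem_cons, doublingNet_hiddenWidths, List.mem_replicate] at h
      omega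
    · omega
  · rcases h4 θ hθ with h | h
    · exact h
    · rw [Net.params, Multiset.mem_add, Multiset.mem_add, Multiset.mem_map, Multiset.mem_map] at h
      rcases h with (⟨⟨i, j⟩, -, rfl⟩ | ⟨i, -, rfl⟩) | h
      · simp only [hW, Pi.single_apply]
        split_ifs <;> simp
      · simp
      · exact doublingNet_params hw1 m θ h
  · have h6 := Net.nnz_hidden W 0 (doublingNet w m)
    have h7 := doublingNet_nnz w m
    have h8 : ∑ i, (Finset.univ.filter fun j => W i j ≠ 0).card ≤ 4 := by
      refine (Finset.sum_le_card_nsmul _ _ 1 fun i _ => ?_).trans (by simp)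
      rw [Finset.card_le_one]
      intro x hx y hy
      simp only [hW, Finset.mem_filter, Finset.mem_univ, true_and,
        Pi.single_apply, ne_eq, ite_eq_right_iff, not_forall] at hx hy
      rw [hx.1, hy.1]
    have h9 : d + e + (0 + 1) = d + e + 1 := rfl
    rw [← add_assoc d e, h9] at h5
    omega

end Output

/-! ### Elementary computations -/

section Gadgets

variable {X : Type*} {K : ℝ} {I : Set (X → ℝ)}

lemma makes_relu₁ {x : X → ℝ} (hx : x ∈ I) {w b : ℝ} (hw : |w| ≤ K) (hb : |b| ≤ K) :
    Makes K 1 2 I {fun ξ => max (w * x ξ + b) 0} := by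
  refine (makes_node ![w] ![x] b (fun j => ?_) (by simpa) hb).mono le_rfl le_rfl subset_rfl ?_
  · fin_cases j
    exact hx
  · simp

lemma makes_relu₂ {x y : X → ℝ} (hx : x ∈ I) (hy : y ∈ I) {w v b : ℝ} (hw : |w| + |v| ≤ K)
    (hb : |b| ≤ K) : Makes K 1 3 I {fun ξ => max (w * x ξ + v * y ξ + b) 0} := by
  refine (makes_node ![w, v] ![x, y] b (fun j => ?_) (by simpa [Fin.sum_univ_succ]) hb).mono
    le_rfl le_rfl subset_rfl ?_
  · fin_cases j
    · exact hx
    · exact hy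
  · simp [Fin.sum_univ_succ]

/-- Clipping to the unit interval, by two ReLU units. -/
noncomputable def unitClip (v : ℝ) : ℝ := max (1 - max (1 - v) 0) 0

lemma unitClip_nonneg (v : ℝ) : 0 ≤ unitClip v := le_max_right _ _

lemma unitClip_le_one (v : ℝ) : unitClip v ≤ 1 :=
  max_le (by linarith [le_max_right (1 - v) 0]) zero_le_one

lemma abs_unitClip_sub_le {t : ℝ} (h0 : 0 ≤ t) (h1 : t ≤ 1) (v : ℝ) :
    |unitClip v - t| ≤ |v - t| := by
  rw [unitClip]
  rcases max_cases (1 - v) 0 with ⟨h, h'⟩ | ⟨h, h'⟩ <;> rw [h] <;>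
  rcases max_cases (1 - (1 - v)) 0 with ⟨h2, h2'⟩ | ⟨h2, h2'⟩ <;>
  rcases max_cases ((1 : ℝ) - 0) 0 with ⟨h3, h3'⟩ | ⟨h3, h3'⟩ <;>
  simp only [h2, h3] <;>
  rcases abs_cases (v - t) with ⟨h4, h4'⟩ | ⟨h4, h4'⟩ <;> rw [h4, abs_le] <;>
  constructor <;> linarith

lemma makes_unitClip {a : ℕ} (w : Fin a → ℝ) (h : Fin a → X → ℝ) (b : ℝ) (hh : ∀ j, h j ∈ I)
    (hw : ∑ j, |w j| ≤ K) (hb : |1 - b| ≤ K) (hK : 1 ≤ K) :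
    Makes K 2 (a + 3) I {fun ξ => unitClip (∑ j, w j * h j ξ + b)} := by
  have h1 := makes_node (K := K) (I := I) (fun j => -w j) h (1 - b) hh (by simpa) hb
  refine (h1.trans (makes_relu₁ (w := -1) (b := 1) (Or.inr rfl) (by simpa) (by simpa))).mono
    le_rfl le_rfl subset_rfl ?_
  rintro _ rfl
  right
  rw [Set.mem_singleton_iff]
  funext ξ
  rw [unitClip]
  simp only [neg_mul, Finset.sum_neg_distrib]
  ring_nf

lemma makes_two_pow_mul {x : X → ℝ} (hx : x ∈ I) (hx0 : ∀ ξ, 0 ≤ x ξ) (hK : 2 ≤ K) (m : ℕ) :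
    Makes K m (2 * m) I {fun ξ => 2 ^ m * x ξ} := by
  induction m with
  | zero => exact (makes_self 0 0).mono le_rfl le_rfl subset_rfl (by simpa using hx)
  | succ m ih =>
    refine (ih.trans (makes_relu₁ (w := 2) (b := 0) (Or.inr rfl) (by simpa)
      (by simp; linarith))).mono le_rfl (by omega) subset_rfl ?_
    rintro _ rfl
    right
    rw [Set.mem_singleton_iff]
    funext ξ
    rw [max_eq_left (by have := hx0 ξ; positivity), pow_succ]
    ring

lemma makes_clip {x : X → ℝ} (hx : x ∈ I) (hx0 : ∀ ξ, 0 ≤ x ξ) {l u : ℝ} (hl : 0 ≤ l)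
    (hlu : l ≤ u) (hu : u ≤ 1) (hK : 2 ≤ K) :
    Makes K 4 8 I {fun ξ => max l (min (x ξ) u)} := by
  have hu' : |u| ≤ K := by rw [abs_of_nonneg (by linarith)]; linarith
  have hl' : |l| ≤ K := by rw [abs_of_nonneg (by linarith)]; linarith
  have h1 := makes_relu₁ (K := K) hx (w := -1) (b := u) (by simp; linarith) hu'
  have h2 := h1.trans (makes_relu₁ (w := -1) (b := u) (Or.inr rfl) (by simp; linarith) hu')
  have h3 := h2.trans (makes_relu₁ (w := 1) (b := -l) (Or.inr (Or.inr rfl)) (by simp; linarith)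
    (by rwa [abs_neg]))
  have h4 := h3.trans (makes_relu₁ (w := 1) (b := l) (Or.inr (Or.inr rfl)) (by simp; linarith) hl')
  refine h4.mono le_rfl le_rfl subset_rfl ?_
  rintro _ rfl
  right
  rw [Set.mem_singleton_iff]
  funext ξ
  have := hx0 ξ
  rcases le_total (x ξ) u with h | h
  · have e1 : max (-1 * x ξ + u) 0 = u - x ξ := by rw [max_eq_left (by linarith)]; ring
    rw [e1, min_eq_left h, max_eq_left (a := -1 * (u - x ξ) + u) (by linarith)]
    rcases le_total l (x ξ) with h' | h'
    · rw [max_eq_left (a := 1 * _ + -l) (by linarith), max_eq_left (a := 1 * _ + l) (by linarith),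
        max_eq_right h']
      ring
    · rw [max_eq_right (a := 1 * _ + -l) (by linarith), max_eq_left (a := 1 * _ + l) (by linarith),
        max_eq_left h']
      ring
  · have e1 : max (-1 * x ξ + u) 0 = 0 := max_eq_right (by linarith)
    rw [e1, min_eq_right h, max_eq_left (a := -1 * 0 + u) (by linarith),
      max_eq_left (a := 1 * _ + -l) (by linarith), max_eq_left (a := 1 * _ + l) (by linarith),
      max_eq_right hlu]
    ring

/-! ### Multiplication -/

/-- The sawtooth map on the unit interval. -/
noncomputable def tooth (y : ℝ) : ℝ := 2 * y - 4 * max (y - 1 / 2) 0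

lemma tooth_mem {y : ℝ} (hy : y ∈ Set.Icc (0 : ℝ) 1) : tooth y ∈ Set.Icc (0 : ℝ) 1 := by
  obtain ⟨h0, h1⟩ := hy
  rw [tooth]
  rcases max_cases (y - 1 / 2) 0 with ⟨h, h'⟩ | ⟨h, h'⟩ <;> rw [h] <;> constructor <;> linarith

lemma tooth_iterate_mem {y : ℝ} (hy : y ∈ Set.Icc (0 : ℝ) 1) (m : ℕ) :
    tooth^[m] y ∈ Set.Icc (0 : ℝ) 1 := by
  induction m with
  | zero => exact hy
  | succ m ih => rw [Function.iterate_succ_apply']; exact tooth_mem ih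

/-- The self-similarity of the parabola under the sawtooth map. Iterating it gains a factor 4 per
step, so logarithmic depth gives polynomial accuracy. -/
lemma mul_one_sub_eq_tooth (y : ℝ) : y * (1 - y) = (tooth y + tooth y * (1 - tooth y)) / 4 := by
  rw [tooth]
  rcases max_cases (y - 1 / 2) 0 with ⟨h, h'⟩ | ⟨h, h'⟩ <;> rw [h] <;> ring

/-- The piecewise linear interpolation of `y (1 - y)`. -/
noncomputable def toothSum (m : ℕ) (y : ℝ) : ℝ :=
  ∑ k ∈ Finset.range m, (1 / 4) ^ (k + 1) * tooth^[k + 1] y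

lemma mul_one_sub_eq_toothSum (m : ℕ) (y : ℝ) :
    y * (1 - y) = toothSum m y + (1 / 4) ^ m * (tooth^[m] y * (1 - tooth^[m] y)) := by
  induction m with
  | zero => simp [toothSum]
  | succ m ih =>
    rw [ih, toothSum, toothSum, Finset.sum_range_succ, mul_one_sub_eq_tooth (tooth^[m] y),
      ← Function.iterate_succ_apply' tooth]
    ring

lemma toothSum_le {y : ℝ} (hy : y ∈ Set.Icc (0 : ℝ) 1) (m : ℕ) : toothSum m y ≤ y * (1 - y) := by
  obtain ⟨h0, h1⟩ := tooth_iterate_mem hy m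
  rw [mul_one_sub_eq_toothSum m y]
  have : 0 ≤ tooth^[m] y * (1 - tooth^[m] y) := mul_nonneg h0 (by linarith)
  have : (0 : ℝ) ≤ (1 / 4) ^ m * (tooth^[m] y * (1 - tooth^[m] y)) := by positivity
  linarith

lemma le_toothSum {y : ℝ} (hy : y ∈ Set.Icc (0 : ℝ) 1) (m : ℕ) :
    y * (1 - y) ≤ toothSum m y + (1 / 4) ^ m := by
  obtain ⟨h0, h1⟩ := tooth_iterate_mem hy m
  rw [mul_one_sub_eq_toothSum m y]
  have h2 : tooth^[m] y * (1 - tooth^[m] y) ≤ 1 := by nlinarith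
  have : (1 / 4 : ℝ) ^ m * (tooth^[m] y * (1 - tooth^[m] y)) ≤ (1 / 4) ^ m :=
    mul_le_of_le_one_right (by positivity) h2
  linarith

lemma makes_toothSum {y : X → ℝ} (hy : y ∈ I) (hy' : ∀ ξ, y ξ ∈ Set.Icc (0 : ℝ) 1) (hK : 6 ≤ K)
    (m : ℕ) : Makes K (3 * m + 1) (8 * m + 1) I
      {fun ξ => tooth^[m] (y ξ), fun ξ => toothSum m (y ξ)} := by
  induction m with
  | zero =>
    have h := (makes_self (K := K) (I := I) 0 0).trans (makes_node (a := 0) Fin.elim0 Fin.elim0 0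
      (fun j => j.elim0) (by simp; linarith) (by simp; linarith))
    refine h.mono le_rfl le_rfl subset_rfl ?_
    rintro _ (rfl | rfl)
    · exact Or.inl hy
    · right
      simp [toothSum]
  | succ m ih =>
    set tm : X → ℝ := fun ξ => tooth^[m] (y ξ)
    set S : X → ℝ := fun ξ => toothSum m (y ξ)
    set J : Set (X → ℝ) := {tm, S}
    have htm : tm ∈ J := Or.inl rfl
    have hS : S ∈ J := Or.inr rfl
    set A : X → ℝ := fun ξ => max (1 * tm ξ + -(1 / 2)) 0
    set tm' : X → ℝ := fun ξ => max (2 * tm ξ + (-4) * A ξ + 0) 0 with htm'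
    have heq : tm' = fun ξ => tooth^[m + 1] (y ξ) := by
      funext ξ
      have := tooth_mem (tooth_iterate_mem (hy' ξ) m)
      rw [Function.iterate_succ_apply']
      rw [htm']
      have h2 : 2 * tm ξ + -4 * A ξ + 0 = tooth (tooth^[m] (y ξ)) := by
        rw [tooth]
        simp only [A, tm]
        ring_nf
      simp only [h2]
      exact max_eq_left this.1
    have h1 := ih.trans (makes_relu₁ (w := 1) (b := -(1 / 2)) (Or.inr htm) (by simp; linarith)
      (by rw [abs_neg, abs_of_pos (by norm_num)]; linarith))
    have h2 := h1.trans (makes_relu₂ (x := tm) (y := A) (w := 2) (v := -4) (b := 0)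
      (Or.inr (Or.inl htm)) (Or.inr (Or.inr rfl)) (by norm_num; linarith) (by simp; linarith))
    have hq : |(1 / 4 : ℝ) ^ (m + 1)| ≤ 1 := by
      rw [abs_of_pos (by positivity)]
      exact pow_le_one₀ (by norm_num) (by norm_num)
    have h3 := h2.trans (makes_relu₂ (x := S) (y := tm') (w := 1) (v := (1 / 4) ^ (m + 1)) (b := 0)
      (Or.inr (Or.inl (Or.inl hS))) (Or.inr (Or.inr rfl)) (by simp only [abs_one]; linarith)
      (by simp; linarith))
    refine h3.mono (by omega) (by omega) subset_rfl ?_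
    rintro _ (rfl | rfl)
    · exact Or.inl (Or.inr heq.symm)
    · right
      rw [Set.mem_singleton_iff]
      funext ξ
      rw [heq]
      have h5 : ∀ k, 0 ≤ toothSum k (y ξ) := fun k => Finset.sum_nonneg fun i _ =>
        mul_nonneg (by positivity) (tooth_iterate_mem (hy' ξ) _).1
      have h6 : 1 * S ξ + (1 / 4) ^ (m + 1) * tooth^[m + 1] (y ξ) + 0 = toothSum (m + 1) (y ξ) := by
        rw [toothSum, Finset.sum_range_succ, ← toothSum]
        ring
      rw [h6, max_eq_left (h5 _)]

/-- Polarization, x y = A² - B² with A = (x + y)/2 and B = |x - y|/2, and a² = a - a (1 - a). Both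
sawtooth sums err from below by at most 4⁻ᵐ and enter with opposite signs, so the errors do not add
up. -/
lemma exists_makes_mul {x y : X → ℝ} (hx : x ∈ I) (hy : y ∈ I)
    (hx' : ∀ ξ, x ξ ∈ Set.Icc (0 : ℝ) 1) (hy' : ∀ ξ, y ξ ∈ Set.Icc (0 : ℝ) 1) (hK : 6 ≤ K)
    (m : ℕ) : ∃ g : X → ℝ, Makes K (6 * m + 8) (16 * m + 21) I {g} ∧
      (∀ ξ, g ξ ∈ Set.Icc (0 : ℝ) 1) ∧ ∀ ξ, |g ξ - x ξ * y ξ| ≤ (1 / 4) ^ m := by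
  set A : X → ℝ := fun ξ => max (1 / 2 * x ξ + 1 / 2 * y ξ + 0) 0
  set P : X → ℝ := fun ξ => max (1 / 2 * x ξ + (-(1 / 2)) * y ξ + 0) 0
  set N : X → ℝ := fun ξ => max (1 / 2 * y ξ + (-(1 / 2)) * x ξ + 0) 0
  set B : X → ℝ := fun ξ => max (1 * P ξ + 1 * N ξ + 0) 0
  have hw1 : |(1 / 2 : ℝ)| + |(1 / 2 : ℝ)| ≤ K := by norm_num; linarith
  have hw2 : |(1 / 2 : ℝ)| + |(-(1 / 2) : ℝ)| ≤ K := by norm_num; linarith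
  have h0 : |(0 : ℝ)| ≤ K := by simp; linarith
  have hA : ∀ ξ, A ξ = (x ξ + y ξ) / 2 := fun ξ => by
    have := (hx' ξ).1
    have := (hy' ξ).1
    simp only [A]
    rw [max_eq_left (by positivity)]
    ring
  have hB : ∀ ξ, B ξ = |x ξ - y ξ| / 2 := fun ξ => by
    have hP : P ξ = max ((x ξ - y ξ) / 2) 0 := by simp only [P]; ring_nf
    have hN : N ξ = max ((y ξ - x ξ) / 2) 0 := by simp only [N]; ring_nf
    simp only [B, hP, hN]
    rcases le_total (x ξ) (y ξ) with h | h
    · rw [max_eq_right (a := (x ξ - y ξ) / 2) (by linarith),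
        max_eq_left (a := (y ξ - x ξ) / 2) (by linarith), max_eq_left (by linarith),
        abs_of_nonpos (by linarith)]
      ring
    · rw [max_eq_left (a := (x ξ - y ξ) / 2) (by linarith),
        max_eq_right (a := (y ξ - x ξ) / 2) (by linarith), max_eq_left (by linarith),
        abs_of_nonneg (by linarith)]
      ring
  have hA' : ∀ ξ, A ξ ∈ Set.Icc (0 : ℝ) 1 := fun ξ => by
    obtain ⟨h1, h2⟩ := hx' ξ
    obtain ⟨h3, h4⟩ := hy' ξ
    rw [hA]
    constructor <;> linarith
  have hB' : ∀ ξ, B ξ ∈ Set.Icc (0 : ℝ) 1 := fun ξ => by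
    obtain ⟨h1, h2⟩ := hx' ξ
    obtain ⟨h3, h4⟩ := hy' ξ
    rw [hB]
    refine ⟨by positivity, ?_⟩
    have : |x ξ - y ξ| ≤ 2 := abs_le.2 ⟨by linarith, by linarith⟩
    linarith
  have s1 := makes_relu₂ (K := K) hx hy (w := 1 / 2) (v := 1 / 2) (b := 0) hw1 h0
  have s2 := s1.trans (makes_relu₂ (x := x) (y := y) (w := 1 / 2) (v := -(1 / 2)) (b := 0)
    (Or.inl hx) (Or.inl hy) hw2 h0)
  have s3 := s2.trans (makes_relu₂ (x := y) (y := x) (w := 1 / 2) (v := -(1 / 2)) (b := 0)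
    (Or.inl hy) (Or.inl hx) hw2 h0)
  have s4 := s3.trans (makes_relu₂ (x := P) (y := N) (w := 1) (v := 1) (b := 0)
    (Or.inr (Or.inl (Or.inr rfl))) (Or.inr (Or.inr rfl)) (by norm_num; linarith) h0)
  have s4' : Makes K 4 12 I {A, B} := by
    refine s4.mono le_rfl le_rfl subset_rfl ?_
    rintro _ (rfl | rfl)
    · exact Or.inl (Or.inl (Or.inl rfl))
    · exact Or.inr rfl
  have s5 := s4'.trans (makes_toothSum (y := A) (Or.inr (Or.inl rfl)) hA' hK m)
  have s6 := s5.trans (makes_toothSum (y := B) (Or.inr (Or.inl (Or.inr rfl))) hB' hK m)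
  have s7 := s6.trans (makes_unitClip (K := K) ![1, -1, -1, 1]
    ![A, fun ξ => toothSum m (A ξ), B, fun ξ => toothSum m (B ξ)] 0 (fun j => ?_)
    (by simp [Fin.sum_univ_succ]; linarith) (by simp; linarith) (by linarith))
  · refine ⟨_, s7.mono (by omega) (by omega) subset_rfl Set.subset_union_right, fun ξ =>
      ⟨unitClip_nonneg _, unitClip_le_one _⟩, fun ξ => ?_⟩
    obtain ⟨h1, h2⟩ := hx' ξ
    obtain ⟨h3, h4⟩ := hy' ξ
    refine (abs_unitClip_sub_le (mul_nonneg h1 h3) (mul_le_one₀ h2 h3 h4) _).trans ?_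
    simp only [Fin.sum_univ_succ, Fin.sum_univ_zero, Matrix.cons_val_zero, Matrix.cons_val_succ]
    have a1 := toothSum_le (hA' ξ) m
    have a2 := le_toothSum (hA' ξ) m
    have b1 := toothSum_le (hB' ξ) m
    have b2 := le_toothSum (hB' ξ) m
    have hxy : x ξ * y ξ = A ξ - A ξ * (1 - A ξ) - B ξ + B ξ * (1 - B ξ) := by
      have : B ξ ^ 2 = (x ξ - y ξ) ^ 2 / 4 := by rw [hB, div_pow, sq_abs]; norm_num
      have h : x ξ * y ξ = A ξ ^ 2 - B ξ ^ 2 := by rw [this, hA]; ring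
      rw [h]
      ring
    rw [hxy, abs_le]
    constructor <;> linarith
  · fin_cases j
    · exact Or.inr (Or.inl (Or.inl (Or.inl rfl)))
    · exact Or.inr (Or.inl (Or.inr (Or.inr rfl)))
    · exact Or.inr (Or.inl (Or.inl (Or.inr rfl)))
    · exact Or.inr (Or.inr (Or.inr rfl))

lemma exists_makes_prod {x : X → ℝ} (hx : x ∈ I) (hx' : ∀ ξ, x ξ ∈ Set.Icc (0 : ℝ) 1) (hK : 6 ≤ K)
    (m k : ℕ) (y : Fin k → X → ℝ) (hy : ∀ i, y i ∈ I) (hy' : ∀ i ξ, y i ξ ∈ Set.Icc (0 : ℝ) 1) :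
    ∃ g : X → ℝ, Makes K (k * (6 * m + 8)) (k * (16 * m + 21)) I {g} ∧
      (∀ ξ, g ξ ∈ Set.Icc (0 : ℝ) 1) ∧ ∀ ξ, |g ξ - x ξ * ∏ i, y i ξ| ≤ k * (1 / 4) ^ m := by
  induction k with
  | zero =>
    refine ⟨x, (makes_self _ _).mono le_rfl le_rfl subset_rfl (by simpa using hx), hx', ?_⟩
    simp
  | succ k ih =>
    obtain ⟨g, h1, h2, h3⟩ := ih (fun i => y i.castSucc) (fun i => hy _) (fun i => hy' _)
    obtain ⟨g', h1', h2', h3'⟩ := exists_makes_mul (K := K) (I := I ∪ {g}) (Or.inr rfl)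
      (Or.inl (hy (Fin.last k))) h2 (hy' _) hK m
    refine ⟨g', (h1.trans h1').mono (by rw [add_mul, one_mul]) (by rw [add_mul, one_mul]) subset_rfl
      Set.subset_union_right, h2', fun ξ => ?_⟩
    rw [Fin.prod_univ_castSucc]
    set Q := ∏ i : Fin k, y i.castSucc ξ
    have e1 : g' ξ - x ξ * (Q * y (Fin.last k) ξ) = (g' ξ - g ξ * y (Fin.last k) ξ) +
      (g ξ - x ξ * Q) * y (Fin.last k) ξ := by ring
    rw [e1]
    refine (abs_add_le _ _).trans ?_
    rw [abs_mul]
    have : |g ξ - x ξ * Q| * |y (Fin.last k) ξ| ≤ k * (1 / 4) ^ m * 1 := by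
      refine mul_le_mul (h3 ξ) ?_ (abs_nonneg _) (by positivity)
      rw [abs_of_nonneg (hy' _ ξ).1]
      exact (hy' _ ξ).2
    have := h3' ξ
    push_cast
    linarith

end Gadgets

end SparseDNN

namespace SparseDNN

/-! ### A piecewise linear partition of unity -/

section Spikes

/-- The maximum of `0` and finitely many numbers. -/
noncomputable def maxPos : (n : ℕ) → (Fin n → ℝ) → ℝ
  | 0, _ => 0
  | n + 1, z => max (maxPos n fun i => z i.castSucc) (z (Fin.last n))

lemma maxPos_nonneg : ∀ (n : ℕ) (z : Fin n → ℝ), 0 ≤ maxPos n z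
  | 0, _ => le_rfl
  | n + 1, _ => (maxPos_nonneg n _).trans (le_max_left _ _)

lemma le_maxPos : ∀ (n : ℕ) (z : Fin n → ℝ) (i : Fin n), z i ≤ maxPos n z
  | 0, _, i => i.elim0
  | n + 1, z, i => by
    refine Fin.lastCases ?_ (fun i => ?_) i
    · exact le_max_right _ _
    · exact (le_maxPos n (fun i => z i.castSucc) i).trans (le_max_left _ _)

lemma maxPos_le : ∀ {n : ℕ} {z : Fin n → ℝ} {c : ℝ}, 0 ≤ c → (∀ i, z i ≤ c) → maxPos n z ≤ c
  | 0, _, _, hc, _ => hc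
  | _ + 1, _, _, hc, h => max_le (maxPos_le hc fun _ => h _) (h _)

lemma maxPos_lt : ∀ {n : ℕ} {z : Fin n → ℝ} {c : ℝ}, 0 < c → (∀ i, z i < c) → maxPos n z < c
  | 0, _, _, hc, _ => hc
  | _ + 1, _, _, hc, h => max_lt (maxPos_lt hc fun _ => h _) (h _)

variable {t : ℕ}

/-- The spike at the grid point `k / M`, of height `1 / M`. -/
noncomputable def spike (M : ℕ) (k : Fin t → Fin (M + 1)) (y : Fin t → ℝ) : ℝ :=
  max ((-1) * maxPos t (fun i => 1 * y i + -((k i : ℝ) / M)) +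
    (-1) * maxPos t (fun i => (-1) * y i + (k i : ℝ) / M) + 1 / M) 0

lemma spike_nonneg (M : ℕ) (k : Fin t → Fin (M + 1)) (y : Fin t → ℝ) : 0 ≤ spike M k y :=
  le_max_right _ _

lemma abs_sub_le_of_spike_ne_zero {M : ℕ} {k : Fin t → Fin (M + 1)} {y : Fin t → ℝ}
    (h : spike M k y ≠ 0) (i : Fin t) : |y i - (k i : ℝ) / M| ≤ 1 / M := by
  have h1 : 0 < spike M k y := lt_of_le_of_ne (spike_nonneg _ _ _) h.symm
  rw [spike, lt_max_iff] at h1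
  have h2 := h1.resolve_right (lt_irrefl _)
  have h3 := maxPos_nonneg t (fun i => 1 * y i + -((k i : ℝ) / M))
  have h4 := maxPos_nonneg t (fun i => (-1) * y i + (k i : ℝ) / M)
  have h5 := le_maxPos t (fun i => 1 * y i + -((k i : ℝ) / M)) i
  have h6 := le_maxPos t (fun i => (-1) * y i + (k i : ℝ) / M) i
  rw [abs_le]
  constructor <;> linarith

/-- The spikes are the volumes of the sets of those shifts that round `y` to `k / M`. -/
lemma sum_spike {M : ℕ} (hM : 0 < M) {y : Fin t → ℝ} (hy : ∀ i, y i ∈ Set.Icc (0 : ℝ) 1) :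
    ∑ k, spike M k y = 1 / M := by
  have hM' : (0 : ℝ) < M := by exact_mod_cast hM
  -- A shift σ in [0, 1/M) lies in S k exactly when rounding M (y + σ) down gives k in every
  -- coordinate. These intervals therefore partition [0, 1/M), and their lengths are the spikes.
  set S : (Fin t → Fin (M + 1)) → Set ℝ := fun k =>
    Set.Ico (maxPos t (fun i => (-1) * y i + (k i : ℝ) / M))
      (1 / M - maxPos t (fun i => 1 * y i + -((k i : ℝ) / M))) with hS
  have hmem : ∀ k σ, σ ∈ S k → 0 ≤ σ ∧ σ < 1 / M ∧ ∀ i, ⌊M * (y i + σ)⌋₊ = k i := by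
    intro k σ hσ
    obtain ⟨h1, h2⟩ := hσ
    have h3 := maxPos_nonneg t (fun i => 1 * y i + -((k i : ℝ) / M))
    have h4 := maxPos_nonneg t (fun i => (-1) * y i + (k i : ℝ) / M)
    refine ⟨h4.trans h1, by linarith, fun i => ?_⟩
    have h5 := le_maxPos t (fun i => 1 * y i + -((k i : ℝ) / M)) i
    have h6 := le_maxPos t (fun i => (-1) * y i + (k i : ℝ) / M) i
    have h7 : (k i : ℝ) / M ≤ y i + σ := by linarith
    have h8 : y i + σ < ((k i : ℝ) + 1) / M := by
      rw [add_div]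
      linarith
    rw [div_le_iff₀ hM'] at h7
    rw [lt_div_iff₀ hM'] at h8
    rw [Nat.floor_eq_iff (by linarith [(Nat.cast_nonneg (k i : ℕ) : (0 : ℝ) ≤ _)])]
    constructor <;> linarith
  have hdisj : Pairwise (Function.onFun Disjoint S) := by
    intro k k' hkk
    refine Set.disjoint_left.2 fun σ h h' => hkk ?_
    funext i
    exact Fin.ext (((hmem k σ h).2.2 i).symm.trans ((hmem k' σ h').2.2 i))
  have hunion : ⋃ k, S k = Set.Ico (0 : ℝ) (1 / M) := by
    refine Set.Subset.antisymm (Set.iUnion_subset fun k σ hσ =>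
      ⟨(hmem k σ hσ).1, (hmem k σ hσ).2.1⟩) fun σ hσ => ?_
    obtain ⟨h0, h1⟩ := hσ
    rw [lt_div_iff₀ hM'] at h1
    have hnn : ∀ i, 0 ≤ M * (y i + σ) := fun i => by have := (hy i).1; positivity
    have hlt : ∀ i, ⌊M * (y i + σ)⌋₊ < M + 1 := fun i => by
      rw [Nat.floor_lt (hnn i)]
      push_cast
      nlinarith [(hy i).2]
    refine Set.mem_iUnion.2 ⟨fun i => ⟨_, hlt i⟩, maxPos_le h0 fun i => ?_, ?_⟩
    · have := Nat.floor_le (hnn i)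
      rw [← div_le_iff₀' hM'] at this
      simp only
      linarith
    · have : maxPos t (fun i => 1 * y i + -((⌊M * (y i + σ)⌋₊ : ℝ) / M)) < 1 / M - σ := by
        refine maxPos_lt (by rw [sub_pos, lt_div_iff₀ hM']; linarith) fun i => ?_
        have := Nat.lt_floor_add_one (M * (y i + σ))
        rw [← lt_div_iff₀' hM', add_div] at this
        linarith
      simp only
      linarith
  have hvol := measure_iUnion hdisj (μ := volume) fun k => measurableSet_Ico
  rw [hunion, Real.volume_Ico, tsum_fintype] at hvol
  have h1 : ∀ k, volume (S k) = ENNReal.ofReal (spike M k y) := fun k => by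
    simp only [hS]
    rw [Real.volume_Ico, spike, ENNReal.ofReal_max, ENNReal.ofReal_zero, max_eq_left zero_le]
    congr 1
    ring
  rw [Finset.sum_congr rfl fun k _ => h1 k, ← ENNReal.ofReal_sum_of_nonneg
    fun k _ => spike_nonneg _ _ _, sub_zero] at hvol
  exact ((ENNReal.ofReal_eq_ofReal_iff (by positivity)
    (Finset.sum_nonneg fun k _ => spike_nonneg _ _ _)).1 hvol).symm

variable {X : Type*} {K : ℝ} {I : Set (X → ℝ)}

/-- The maximum of P and a is P + max (a - P) 0: two layers per coordinate, for all grid points k in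
parallel. -/
lemma makes_maxPos {ι : Type*} [Fintype ι] (hK : 3 ≤ K) {s : ℝ} (hs : |s| ≤ 1) (t : ℕ)
    (y : Fin t → X → ℝ) (hy : ∀ i, y i ∈ I) (c : ι → Fin t → ℝ) (hc : ∀ k i, |c k i| ≤ 1) :
    Makes K (2 * t + 1) (Fintype.card ι * (6 * t + 1)) I
      (Set.range fun k ξ => maxPos t fun i => s * y i ξ + c k i) := by
  induction t with
  | zero =>
    refine (makes_family (K := K) (ι := ι) (a := 0) (fun _ => Fin.elim0) (fun _ => Fin.elim0)
      (fun _ => 0) (fun _ j => j.elim0) (fun _ => by simp; linarith) (fun _ => by simp; linarith)).mono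
      le_rfl (by simp) subset_rfl ?_
    simp [maxPos]
  | succ t ih =>
    set P : ι → X → ℝ := fun k ξ => maxPos t fun i => s * y i.castSucc ξ + c k i.castSucc
    set A : ι → X → ℝ := fun k ξ => max (∑ j, (![s, -1] : Fin 2 → ℝ) j *
      (![y (Fin.last t), P k] : Fin 2 → X → ℝ) j ξ + c k (Fin.last t)) 0 with hA
    have h1 := ih (fun i => y i.castSucc) (fun i => hy _) (fun k i => c k i.castSucc)
      (fun k i => hc _ _)
    have h2 := h1.trans (makes_family (K := K) (fun _ : ι => ![s, -1])
      (fun k => ![y (Fin.last t), P k]) (fun k => c k (Fin.last t)) (fun k j => ?_)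
      (fun k => by simp [Fin.sum_univ_succ]; linarith) (fun k => (hc _ _).trans (by linarith)))
    · have h3 := h2.trans (makes_family (K := K) (fun _ : ι => ![1, 1])
        (fun k => ![P k, A k]) (fun _ => 0) (fun k j => ?_)
        (fun k => by simp [Fin.sum_univ_succ]; linarith) (fun k => by simp; linarith))
      · refine h3.mono (by omega) (le_of_eq (by ring)) subset_rfl ?_
        rintro _ ⟨k, rfl⟩
        refine Or.inr ⟨k, ?_⟩
        funext ξ
        have hP : 0 ≤ P k ξ := maxPos_nonneg _ _
        have hA' : A k ξ = max (s * y (Fin.last t) ξ + c k (Fin.last t) - P k ξ) 0 := by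
          simp only [hA, Fin.sum_univ_succ, Fin.sum_univ_zero, Matrix.cons_val_zero,
            Matrix.cons_val_succ]
          congr 1
          ring
        have hm : maxPos (t + 1) (fun i => s * y i ξ + c k i) =
            max (P k ξ) (s * y (Fin.last t) ξ + c k (Fin.last t)) := rfl
        simp only [Fin.sum_univ_succ, Fin.sum_univ_zero, Matrix.cons_val_zero,
          Matrix.cons_val_succ]
        rw [hm, hA']
        rcases le_total (P k ξ) (s * y (Fin.last t) ξ + c k (Fin.last t)) with h | h
        · rw [max_eq_right h, max_eq_left (a := _ - P k ξ) (by linarith), max_eq_left (by linarith)]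
          ring
        · rw [max_eq_left h, max_eq_right (a := _ - P k ξ) (by linarith), max_eq_left (by linarith)]
          ring
      · fin_cases j
        · exact Or.inr (Or.inl ⟨k, rfl⟩)
        · exact Or.inr (Or.inr ⟨k, rfl⟩)
    · fin_cases j
      · exact Or.inl (hy _)
      · exact Or.inr ⟨k, rfl⟩

lemma makes_spikeSum (hK : 3 ≤ K) {M : ℕ} (hM : 0 < M) {y : Fin t → X → ℝ} (hy : ∀ i, y i ∈ I)
    {c : (Fin t → Fin (M + 1)) → ℝ} (hc : ∀ k, |c k| ≤ K) :
    Makes K (4 * t + 4) ((M + 1) ^ t * (12 * t + 6) + 1) I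
      {fun ξ => max (∑ k, c k * spike M k fun i => y i ξ) 0} := by
  have hM' : (0 : ℝ) < M := by exact_mod_cast hM
  have hk1 : ∀ j : Fin (M + 1), |(j : ℝ) / M| ≤ 1 := fun j => by
    rw [abs_of_nonneg (by positivity), div_le_one hM']
    exact_mod_cast Nat.lt_succ_iff.1 j.2
  have h1 := makes_maxPos (K := K) (ι := Fin t → Fin (M + 1)) hK (s := 1) (by simp) t y hy
    (fun k i => -((k i : ℝ) / M)) (fun k i => by rw [abs_neg]; exact hk1 _)
  have h2 := h1.trans (makes_maxPos (K := K) (ι := Fin t → Fin (M + 1)) hK (s := -1) (by simp) t y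
    (fun i => Or.inl (hy i)) (fun k i => (k i : ℝ) / M) (fun k i => hk1 _))
  have h3 := h2.trans (makes_wide_sum (K := K) (ι := Fin t → Fin (M + 1)) (fun _ => ![-1, -1])
    (fun k => ![fun ξ => maxPos t fun i => 1 * y i ξ + -((k i : ℝ) / M),
      fun ξ => maxPos t fun i => -1 * y i ξ + (k i : ℝ) / M]) (fun _ => 1 / M) (fun k j => ?_)
    (fun k => by simp [Fin.sum_univ_succ]; linarith) (fun k => ?_) c hc (by linarith))
  · refine h3.mono (by omega) (le_of_eq ?_) subset_rfl ?_
    · simp only [Fintype.card_pi, Fintype.card_fin, Finset.prod_const, Finset.card_univ]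
      ring
    · rintro _ rfl
      refine Or.inr ?_
      simp only [Set.mem_singleton_iff, spike, Fin.sum_univ_succ, Fin.sum_univ_zero,
        Matrix.cons_val_zero, Matrix.cons_val_succ, add_zero]
  · fin_cases j
    · exact Or.inr (Or.inl ⟨k, rfl⟩)
    · exact Or.inr (Or.inr ⟨k, rfl⟩)
  · rw [abs_of_pos (by positivity)]
    have : (1 : ℝ) / M ≤ 1 := by
      rw [div_le_one hM']
      exact_mod_cast hM
    linarith

/-- Averages of coefficients with respect to the spikes. -/
lemma makes_average (hK : 3 ≤ K) (ν : ℕ) {y : Fin t → X → ℝ} (hy : ∀ i, y i ∈ I)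
    {c : (Fin t → Fin (2 ^ ν + 1)) → ℝ} (hc : ∀ k, c k ∈ Set.Icc (0 : ℝ) 1) :
    Makes K (4 * t + 4 + ν) ((2 ^ ν + 1) ^ t * (12 * t + 6) + 1 + 2 * ν) I
      {fun ξ => ∑ k, c k * (2 ^ ν * spike (2 ^ ν) k fun i => y i ξ)} := by
  have h1 := makes_spikeSum (K := K) hK (M := 2 ^ ν) (by positivity) hy (c := c) (fun k => by
    rw [abs_of_nonneg (hc k).1]
    exact (hc k).2.trans (by linarith))
  have h2 := h1.trans (makes_two_pow_mul (K := K) (Or.inr rfl) (fun ξ => le_max_right _ _)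
    (by linarith) ν)
  refine h2.mono le_rfl le_rfl subset_rfl ?_
  rintro _ rfl
  refine Or.inr ?_
  rw [Set.mem_singleton_iff]
  funext ξ
  rw [max_eq_left (Finset.sum_nonneg fun k _ => mul_nonneg (hc k).1 (spike_nonneg _ _ _)),
    Finset.mul_sum]
  exact Finset.sum_congr rfl fun k _ => by ring

end Spikes

end SparseDNN

namespace SparseDNN

/-! ### Approximation of one Hölder function -/

section Stage

variable {p k : ℕ} {β C l u : ℝ} {G : (Fin p → ℝ) → ℝ}

lemma hatCoord_mem {x : Fin p → ℝ} (hx : ∀ j, x j ∈ Set.Icc (0 : ℝ) 1) (o : Option (Fin p)) :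
    hatCoord x o ∈ Set.Icc (0 : ℝ) 1 := by
  cases o with
  | none => simp [hatCoord]
  | some j => exact hx j

lemma mem_Icc_of_mem_cube (hl : 0 ≤ l) (hu : u ≤ 1) {x : Fin p → ℝ} (hx : x ∈ cube p l u)
    (j : Fin p) : x j ∈ Set.Icc (0 : ℝ) 1 :=
  ⟨hl.trans (hx.1 j), (hx.2 j).trans hu⟩

lemma prod_mem_Icc {ι : Type*} (s : Finset ι) {a : ι → ℝ} (ha : ∀ i, a i ∈ Set.Icc (0 : ℝ) 1) :
    ∏ i ∈ s, a i ∈ Set.Icc (0 : ℝ) 1 :=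
  ⟨Finset.prod_nonneg fun i _ => (ha i).1, Finset.prod_le_one (fun i _ => (ha i).1)
    fun i _ => (ha i).2⟩

lemma abs_prod_sub_prod_le {ι : Type*} (s : Finset ι) {a b : ι → ℝ} {δ : ℝ}
    (ha : ∀ i, a i ∈ Set.Icc (0 : ℝ) 1) (hb : ∀ i, b i ∈ Set.Icc (0 : ℝ) 1)
    (hab : ∀ i, |a i - b i| ≤ δ) : |∏ i ∈ s, a i - ∏ i ∈ s, b i| ≤ s.card * δ := by
  classical
  induction s using Finset.induction_on with
  | empty => simp
  | insert i s hi ih =>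
    rw [Finset.prod_insert hi, Finset.prod_insert hi, Finset.card_insert_of_notMem hi]
    obtain ⟨h1, h2⟩ := prod_mem_Icc s ha
    have e : a i * ∏ i ∈ s, a i - b i * ∏ i ∈ s, b i =
        (a i - b i) * ∏ i ∈ s, a i + b i * (∏ i ∈ s, a i - ∏ i ∈ s, b i) := by ring
    rw [e]
    refine (abs_add_le _ _).trans ?_
    rw [abs_mul, abs_mul, abs_of_nonneg h1, abs_of_nonneg (hb i).1]
    have h3 := mul_le_of_le_one_right (abs_nonneg (a i - b i)) h2
    have h4 := mul_le_of_le_one_left (abs_nonneg (∏ i ∈ s, a i - ∏ i ∈ s, b i)) (hb i).2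
    have := hab i
    push_cast
    linarith

/-- Functions with local polynomial approximations are Hölder continuous. -/
lemma LocPoly.abs_sub_le (hG : LocPoly k β C (cube p l u) G) (hβ : 0 < β) (hC : 0 ≤ C)
    (hl : 0 ≤ l) (hu : u ≤ 1) {x y : Fin p → ℝ} (hx : x ∈ cube p l u) (hy : y ∈ cube p l u) :
    |G x - G y| ≤ (C + (p + 1) ^ k * C * k) * ‖x - y‖ ^ min β 1 := by
  obtain ⟨c, hc, hcG⟩ := hG x hx
  -- At its own base point the local polynomial is exact because β > 0; only the polynomial
  -- increment and the error at y remain.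
  have hx1 := hcG x hx
  rw [sub_self, norm_zero, Real.zero_rpow hβ.ne', mul_zero] at hx1
  have hy1 := hcG y hy
  have hd1 : ‖x - y‖ ≤ 1 := by
    rw [pi_norm_le_iff_of_nonneg zero_le_one]
    intro j
    obtain ⟨h1, h2⟩ := mem_Icc_of_mem_cube hl hu hx j
    obtain ⟨h3, h4⟩ := mem_Icc_of_mem_cube hl hu hy j
    rw [Pi.sub_apply, Real.norm_eq_abs, abs_le]
    constructor <;> linarith
  have hmono : ∀ v : Fin k → Option (Fin p), |wordMonomial v x - wordMonomial v y| ≤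
      k * ‖x - y‖ := fun v => by
    have := abs_prod_sub_prod_le Finset.univ (a := fun i => hatCoord x (v i))
      (b := fun i => hatCoord y (v i)) (δ := ‖x - y‖)
      (fun i => hatCoord_mem (mem_Icc_of_mem_cube hl hu hx) _)
      (fun i => hatCoord_mem (mem_Icc_of_mem_cube hl hu hy) _) (fun i => by
        cases v i with
        | none => simp [hatCoord]
        | some j => exact norm_le_pi_norm (x - y) j)
    simpa [wordMonomial] using this
  have hpoly : |∑ v, c v * wordMonomial v x - ∑ v, c v * wordMonomial v y| ≤
      (p + 1) ^ k * C * k * ‖x - y‖ := by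
    rw [← Finset.sum_sub_distrib]
    refine (Finset.abs_sum_le_sum_abs _ _).trans ?_
    calc _ ≤ ∑ _v : Fin k → Option (Fin p), C * (k * ‖x - y‖) := by
          refine Finset.sum_le_sum fun v _ => ?_
          rw [← mul_sub, abs_mul]
          exact mul_le_mul (hc v) (hmono v) (abs_nonneg _) hC
      _ = _ := by
          simp
          ring
  have h1 : ‖x - y‖ ≤ ‖x - y‖ ^ min β 1 := by
    rcases (norm_nonneg (x - y)).eq_or_lt with h | h
    · rw [← h]
      positivity
    · calc ‖x - y‖ = ‖x - y‖ ^ (1 : ℝ) := (Real.rpow_one _).symm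
        _ ≤ _ := Real.rpow_le_rpow_of_exponent_ge h hd1 (min_le_right _ _)
  have h2 : ‖y - x‖ ^ β ≤ ‖x - y‖ ^ min β 1 := by
    rw [norm_sub_rev]
    rcases (norm_nonneg (x - y)).eq_or_lt with h | h
    · rw [← h, Real.zero_rpow hβ.ne']
      positivity
    · exact Real.rpow_le_rpow_of_exponent_ge h hd1 (min_le_left _ _)
  have e : G x - G y = (G x - ∑ v, c v * wordMonomial v x) +
      (∑ v, c v * wordMonomial v x - ∑ v, c v * wordMonomial v y) -
      (G y - ∑ v, c v * wordMonomial v y) := by ring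
  rw [e]
  refine (abs_sub _ _).trans ?_
  have h3 := abs_add_le (G x - ∑ v, c v * wordMonomial v x)
    (∑ v, c v * wordMonomial v x - ∑ v, c v * wordMonomial v y)
  have h4 : C * ‖y - x‖ ^ β ≤ C * ‖x - y‖ ^ min β 1 := mul_le_mul_of_nonneg_left h2 hC
  have h5 : (p + 1) ^ k * C * k * ‖x - y‖ ≤ (p + 1) ^ k * C * k * ‖x - y‖ ^ min β 1 := by gcongr
  rw [add_mul]
  linarith

variable {X : Type*} {K : ℝ} {I : Set (X → ℝ)}

/-- The weight bound for the approximation of a function with local polynomial approximations. -/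
noncomputable def stageWeight (p k : ℕ) (C : ℝ) : ℝ := 2 * (p + 1) ^ k * C + 6

/-- G is close to ∑_κ Φ_κ P_κ, where Φ_κ are normalized spikes and P_κ is the local polynomial at a
base point of κ. Regrouping by monomials gives ∑_v (∑_κ c_{κ,v} Φ_κ) x^v: the many spikes enter only
linearly, and the number 2 (p + 1)^k of products is independent of the resolution. The exponent t of
the grid size arises because spikes involve the relevant coordinates only. -/
theorem exists_makes_locPoly (hG : LocPoly k β C (cube p l u) G) (hβ : 0 < β) (hC : 0 < C)
    (hl : 0 ≤ l) (hlu : l ≤ u) (hu : u ≤ 1)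
    (hG01 : ∀ x ∈ cube p l u, G x ∈ Set.Icc (0 : ℝ) 1) {s : Finset (Fin p)} {t : ℕ}
    (hst : s.card ≤ t)
    (hs : ∀ x ∈ cube p l u, ∀ y ∈ cube p l u, (∀ i ∈ s, x i = y i) → G x = G y)
    (hK : stageWeight p k C ≤ K) {y : Fin p → X → ℝ} (hyI : ∀ j, y j ∈ I) (hy0 : ∀ j ξ, 0 ≤ y j ξ)
    (ν : ℕ) :
    ∃ g : X → ℝ, Makes K ((p + 1) * 4 + 2 * (p + 1) ^ k *
        (4 * t + 4 + ν + k * (6 * (⌈β⌉₊ * ν) + 8)) + 2)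
      ((p + 1) * 8 + 2 * (p + 1) ^ k * ((2 ^ ν + 1) ^ t * (12 * t + 6) + 1 + 2 * ν +
        k * (16 * (⌈β⌉₊ * ν) + 21)) + (2 * (p + 1) ^ k + 3)) I {g} ∧
      (∀ ξ, g ξ ∈ Set.Icc (0 : ℝ) 1) ∧
      ∀ ξ, |g ξ - G (fun j => max l (min (y j ξ) u))| ≤
        (2 * (p + 1) ^ k * C * k + C * 2 ^ β) * ((2 : ℝ) ^ ν)⁻¹ ^ β := by
  classical
  have hp1 : (0 : ℝ) ≤ 2 * (p + 1) ^ k * C := by positivity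
  have hK6 : 6 ≤ K := by
    rw [stageWeight] at hK
    linarith
  -- the clipped coordinates
  set x : X → Fin p → ℝ := fun ξ j => if j ∈ s then max l (min (y j ξ) u) else l with hx
  have hxQ : ∀ ξ, x ξ ∈ cube p l u := by
    intro ξ
    refine ⟨fun j => ?_, fun j => ?_⟩ <;> simp only [hx] <;> split_ifs
    · exact le_max_left _ _
    · exact le_rfl
    · exact max_le hlu (min_le_right _ _)
    · exact hlu
  have hGx : ∀ ξ, G (fun j => max l (min (y j ξ) u)) = G (x ξ) := fun ξ => by
    refine hs _ ⟨fun j => le_max_left _ _, fun j => max_le hlu (min_le_right _ _)⟩ _ (hxQ ξ) ?_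
    intro j hj
    simp only [hx, if_pos hj]
  have hx01 := fun ξ => mem_Icc_of_mem_cube hl hu (hxQ ξ)
  set xh : Option (Fin p) → X → ℝ := fun o ξ => hatCoord (x ξ) o with hxh
  have m1 : Makes K ((p + 1) * 4) ((p + 1) * 8) I (Set.range xh) := by
    have := Makes.finset (K := K) (L := 4) (e := 8) (I := I) (Finset.univ : Finset (Option (Fin p)))
      (g := fun o => {xh o}) (fun o _ => ?_)
    · rw [Finset.card_univ, Fintype.card_option, Fintype.card_fin] at this
      refine this.mono le_rfl le_rfl subset_rfl ?_
      rintro _ ⟨o, rfl⟩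
      simp
    have hconst : ∀ b : ℝ, 0 ≤ b → b ≤ 1 → Makes K 4 8 I {fun _ => b} := fun b h0 h1 => by
      refine (makes_node (a := 0) Fin.elim0 Fin.elim0 b (fun j => j.elim0) (by simp; linarith)
        (by rw [abs_of_nonneg h0]; linarith)).mono (by norm_num) (by norm_num) subset_rfl ?_
      simp [h0]
    cases o with
    | none => exact hconst 1 zero_le_one le_rfl
    | some j =>
      by_cases hj : j ∈ s
      · have : xh (some j) = fun ξ => max l (min (y j ξ) u) := by
          funext ξ
          simp [hxh, hatCoord, hx, hj]
        rw [this]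
        exact makes_clip (K := K) (hyI j) (hy0 j) hl hlu hu (by linarith)
      · have : xh (some j) = fun _ => l := by
          funext ξ
          simp [hxh, hatCoord, hx, hj]
        rw [this]
        exact hconst l hl (hlu.trans hu)
  -- the spikes
  set t' := s.card with ht'
  set e : Fin t' → Fin p := fun i => s.orderEmbOfFin rfl i with he
  have hes : ∀ i, e i ∈ s := fun i => s.orderEmbOfFin_mem rfl i
  have hse : ∀ j ∈ s, ∃ i, e i = j := fun j hj => by
    have : j ∈ Set.range (s.orderEmbOfFin rfl) := by rwa [Finset.range_orderEmbOfFin]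
    exact this
  set z : Fin t' → X → ℝ := fun i => xh (some (e i)) with hz
  set Φ : (Fin t' → Fin (2 ^ ν + 1)) → X → ℝ := fun κ ξ =>
    2 ^ ν * spike (2 ^ ν) κ fun i => z i ξ with hΦ
  have hM : (0 : ℝ) < 2 ^ ν := by positivity
  have hΦ0 : ∀ κ ξ, 0 ≤ Φ κ ξ := fun κ ξ => mul_nonneg hM.le (spike_nonneg _ _ _)
  have hΦ1 : ∀ ξ, ∑ κ, Φ κ ξ = 1 := fun ξ => by
    simp only [hΦ]
    rw [← Finset.mul_sum, sum_spike (by positivity) fun i => hatCoord_mem (hx01 ξ) _]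
    push_cast
    field_simp
  -- The grid point itself may lie outside the cube [l, u]^p, so the base point is any value of x at
  -- which the spike is nonzero; the distance at most doubles.
  have hbase : ∀ κ : Fin t' → Fin (2 ^ ν + 1), ∃ b ∈ cube p l u, ∀ ξ, Φ κ ξ ≠ 0 →
      ‖x ξ - b‖ ≤ 2 * ((2 : ℝ) ^ ν)⁻¹ := by
    intro κ
    by_cases h : ∃ ξ, Φ κ ξ ≠ 0
    · obtain ⟨ξ₀, h₀⟩ := h
      refine ⟨x ξ₀, hxQ _, fun ξ hξ => ?_⟩
      rw [pi_norm_le_iff_of_nonneg (by positivity)]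
      intro j
      rw [Pi.sub_apply, Real.norm_eq_abs]
      by_cases hj : j ∈ s
      · obtain ⟨i, rfl⟩ := hse j hj
        have h1 := abs_sub_le_of_spike_ne_zero (right_ne_zero_of_mul hξ) i
        have h2 := abs_sub_le_of_spike_ne_zero (right_ne_zero_of_mul h₀) i
        have e1 : x ξ (e i) - x ξ₀ (e i) = (z i ξ - (κ i : ℝ) / (2 ^ ν : ℕ)) -
          (z i ξ₀ - (κ i : ℝ) / (2 ^ ν : ℕ)) := by simp [hz, hxh, hatCoord]
        rw [e1]
        refine (abs_sub _ _).trans ((add_le_add h1 h2).trans (le_of_eq ?_))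
        push_cast
        ring
      · simp only [hx, if_neg hj, sub_self, abs_zero]
        positivity
    · push Not at h
      exact ⟨fun _ => l, ⟨fun _ => le_rfl, fun _ => hlu⟩, fun ξ hξ => absurd (h ξ) hξ⟩
  choose b hbQ hb using hbase
  choose c hc hcG using fun κ => hG (b κ) (hbQ κ)
  -- the averaged coefficients
  set σ : Bool → ℝ := fun a => if a then 1 else -1 with hσ
  set U : (Fin k → Option (Fin p)) → Bool → X → ℝ := fun v a ξ =>
    ∑ κ, max (σ a * c κ v / C) 0 * Φ κ ξ with hU
  have hcoef : ∀ κ v a, max (σ a * c κ v / C) 0 ∈ Set.Icc (0 : ℝ) 1 := fun κ v a => by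
    refine ⟨le_max_right _ _, max_le ?_ zero_le_one⟩
    rw [div_le_one hC]
    have := abs_le.1 (hc κ v)
    cases a <;> simp [hσ] <;> linarith
  have hU01 : ∀ v a ξ, U v a ξ ∈ Set.Icc (0 : ℝ) 1 := fun v a ξ => by
    refine ⟨Finset.sum_nonneg fun κ _ => mul_nonneg (hcoef κ v a).1 (hΦ0 κ ξ), ?_⟩
    calc U v a ξ ≤ ∑ κ, Φ κ ξ := Finset.sum_le_sum fun κ _ =>
          mul_le_of_le_one_left (hΦ0 κ ξ) (hcoef κ v a).2
      _ = 1 := hΦ1 ξ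
  -- The product error 4⁻ᵐ is then at most 2^(-νβ), the order of the interpolation error.
  set m := ⌈β⌉₊ * ν with hm
  have hprod : ∀ va : (Fin k → Option (Fin p)) × Bool, ∃ g : X → ℝ,
      Makes K (4 * t + 4 + ν + k * (6 * m + 8)) ((2 ^ ν + 1) ^ t * (12 * t + 6) + 1 + 2 * ν +
        k * (16 * m + 21)) (I ∪ Set.range xh) {g} ∧
      ∀ ξ, |g ξ - U va.1 va.2 ξ * wordMonomial va.1 (x ξ)| ≤ k * (1 / 4) ^ m := by
    rintro ⟨v, a⟩
    have h1 := makes_average (K := K) (I := I ∪ Set.range xh) (by linarith) ν (y := z)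
      (fun i => Or.inr ⟨_, rfl⟩) (c := fun κ => max (σ a * c κ v / C) 0) (fun κ => hcoef κ v a)
    obtain ⟨g, h2, -, h3⟩ := exists_makes_prod (K := K) (I := (I ∪ Set.range xh) ∪ {U v a})
      (x := U v a) (Or.inr rfl) (hU01 v a) hK6 m k (fun i => xh (v i))
      (fun i => Or.inl (Or.inr ⟨_, rfl⟩)) (fun i ξ => hatCoord_mem (hx01 ξ) _)
    refine ⟨g, (h1.trans h2).mono ?_ ?_ subset_rfl Set.subset_union_right, h3⟩
    · gcongr
    · gcongr
      exact Nat.le_add_left _ _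
  choose g hg hgU using hprod
  have m2 := Makes.finset (K := K) (Finset.univ : Finset ((Fin k → Option (Fin p)) × Bool))
    (g := fun va => {g va}) (fun va _ => hg va)
  have hcard : Fintype.card ((Fin k → Option (Fin p)) × Bool) = 2 * (p + 1) ^ k := by
    simp [mul_comm]
  rw [Finset.card_univ, hcard] at m2
  -- the final sum
  set ε := Fintype.equivFinOfCardEq hcard with hε
  have m3 := (m1.trans m2).trans (makes_unitClip (K := K) (a := 2 * (p + 1) ^ k)
    (fun j => σ (ε.symm j).2 * C) (fun j => g (ε.symm j)) 0 (fun j => Or.inr (Or.inr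
      (by simp only [Finset.mem_univ, Set.iUnion_true, Set.mem_iUnion]; exact ⟨_, rfl⟩))) ?_
      (by simp; linarith) (by linarith))
  swap
  · have : ∀ j : Fin (2 * (p + 1) ^ k), |σ (ε.symm j).2 * C| ≤ C := fun j => by
      cases (ε.symm j).2 <;> simp [hσ, abs_of_pos hC]
    refine (Finset.sum_le_sum fun j _ => this j).trans ?_
    rw [stageWeight] at hK
    rw [Finset.sum_const, Finset.card_univ, Fintype.card_fin, nsmul_eq_mul]
    push_cast
    linarith
  refine ⟨_, m3.mono le_rfl le_rfl subset_rfl Set.subset_union_right,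
    fun ξ => ⟨unitClip_nonneg _, unitClip_le_one _⟩, fun ξ => ?_⟩
  rw [hGx]
  refine (abs_unitClip_sub_le (hG01 _ (hxQ ξ)).1 (hG01 _ (hxQ ξ)).2 _).trans ?_
  rw [add_zero, Equiv.sum_comp ε.symm
    fun va : (Fin k → Option (Fin p)) × Bool => σ va.2 * C * g va ξ]
  -- the exact average
  have havg : ∑ va : (Fin k → Option (Fin p)) × Bool,
      σ va.2 * C * (U va.1 va.2 ξ * wordMonomial va.1 (x ξ)) =
      ∑ κ, Φ κ ξ * ∑ v, c κ v * wordMonomial v (x ξ) := by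
    rw [Fintype.sum_prod_type]
    simp only [Finset.mul_sum]
    symm
    rw [Finset.sum_comm]
    symm
    refine Finset.sum_congr rfl fun v _ => ?_
    rw [Fintype.sum_bool]
    simp only [hU, Finset.sum_mul, Finset.mul_sum]
    rw [← Finset.sum_add_distrib]
    refine Finset.sum_congr rfl fun κ _ => ?_
    have h1 : max (σ true * c κ v / C) 0 - max (σ false * c κ v / C) 0 = c κ v / C := by
      simp only [hσ, if_true, Bool.false_eq_true, if_false, one_mul, neg_one_mul, neg_div]
      rcases le_total 0 (c κ v / C) with h | h
      · rw [max_eq_left h, max_eq_right (by linarith), sub_zero]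
      · rw [max_eq_right h, max_eq_left (by linarith)]
        ring
    have h2 : c κ v = C * (max (σ true * c κ v / C) 0 - max (σ false * c κ v / C) 0) := by
      rw [h1]
      field_simp
    conv_rhs => rw [h2]
    simp only [hσ, if_true, Bool.false_eq_true, if_false]
    ring
  have herr1 : |∑ va : (Fin k → Option (Fin p)) × Bool, σ va.2 * C * g va ξ -
      ∑ κ, Φ κ ξ * ∑ v, c κ v * wordMonomial v (x ξ)| ≤
      2 * (p + 1) ^ k * C * k * (1 / 4) ^ m := by
    rw [← havg, ← Finset.sum_sub_distrib]
    refine (Finset.abs_sum_le_sum_abs _ _).trans ?_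
    calc _ ≤ ∑ _va : (Fin k → Option (Fin p)) × Bool, C * (k * (1 / 4) ^ m) := by
          refine Finset.sum_le_sum fun va _ => ?_
          rw [← mul_sub, abs_mul]
          refine mul_le_mul ?_ (hgU va ξ) (abs_nonneg _) hC.le
          cases va.2 <;> simp [hσ, abs_of_pos hC]
      _ = _ := by
          rw [Finset.sum_const, Finset.card_univ, hcard, nsmul_eq_mul]
          push_cast
          ring
  have herr2 : |∑ κ, Φ κ ξ * ∑ v, c κ v * wordMonomial v (x ξ) - G (x ξ)| ≤
      C * (2 * ((2 : ℝ) ^ ν)⁻¹) ^ β := by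
    have e1 : G (x ξ) = ∑ κ, Φ κ ξ * G (x ξ) := by rw [← Finset.sum_mul, hΦ1, one_mul]
    conv_lhs => rw [e1]
    rw [← Finset.sum_sub_distrib]
    refine (Finset.abs_sum_le_sum_abs _ _).trans ?_
    calc _ ≤ ∑ κ, Φ κ ξ * (C * (2 * ((2 : ℝ) ^ ν)⁻¹) ^ β) := by
          refine Finset.sum_le_sum fun κ _ => ?_
          rw [← mul_sub, abs_mul, abs_of_nonneg (hΦ0 κ ξ)]
          by_cases h : Φ κ ξ = 0
          · rw [h, zero_mul, zero_mul]
          refine mul_le_mul_of_nonneg_left ?_ (hΦ0 κ ξ)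
          rw [abs_sub_comm]
          refine (hcG κ _ (hxQ ξ)).trans ?_
          have := hb κ ξ h
          gcongr
      _ = _ := by rw [← Finset.sum_mul, hΦ1, one_mul]
  have hquarter : ((1 : ℝ) / 4) ^ m ≤ ((2 : ℝ) ^ ν)⁻¹ ^ β := by
    have hle1 : ((2 : ℝ) ^ ν)⁻¹ ≤ 1 := inv_le_one_of_one_le₀ (one_le_pow₀ (by norm_num))
    calc ((1 : ℝ) / 4) ^ m ≤ (1 / 2) ^ m := by gcongr; norm_num
      _ = ((2 : ℝ) ^ ν)⁻¹ ^ (⌈β⌉₊ : ℝ) := by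
          rw [Real.rpow_natCast, hm, mul_comm, pow_mul, one_div, inv_pow]
      _ ≤ _ := Real.rpow_le_rpow_of_exponent_ge (by positivity) hle1 (Nat.le_ceil β)
  rw [Real.mul_rpow (by norm_num) (by positivity)] at herr2
  calc _ ≤ |∑ va : (Fin k → Option (Fin p)) × Bool, σ va.2 * C * g va ξ -
        ∑ κ, Φ κ ξ * ∑ v, c κ v * wordMonomial v (x ξ)| +
        |∑ κ, Φ κ ξ * ∑ v, c κ v * wordMonomial v (x ξ) - G (x ξ)| := abs_sub_le _ _ _
    _ ≤ 2 * (p + 1) ^ k * C * k * ((2 : ℝ) ^ ν)⁻¹ ^ β +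
        C * (2 ^ β * ((2 : ℝ) ^ ν)⁻¹ ^ β) := by
        refine add_le_add (herr1.trans ?_) herr2
        gcongr
    _ = _ := by ring

end Stage

end SparseDNN

namespace SparseDNN

/-! ### Approximation of compositions -/

section Composition

lemma abs_max_min_sub_le {l u a z : ℝ} (hz : z ∈ Set.Icc l u) : |max l (min a u) - z| ≤ |a - z| := by
  obtain ⟨h1, h2⟩ := hz
  have e : z = max l (min z u) := by rw [min_eq_left h2, max_eq_right h1]
  conv_lhs => rw [e, max_comm l, max_comm l]
  exact (abs_max_sub_max_le_abs (min a u) (min z u) l).trans (abs_inf_sub_inf_le_abs a z u)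

lemma stage_layers_le (p k t b : ℕ) : ∃ c : ℕ, ∀ ν : ℕ, (p + 1) * 4 + 2 * (p + 1) ^ k *
    (4 * t + 4 + ν + k * (6 * (b * ν) + 8)) + 2 ≤ c * (ν + 1) := by
  refine ⟨(p + 1) * 4 + 2 * (p + 1) ^ k * (4 * t + 5 + k * (6 * b + 8)) + 2, fun ν => ?_⟩
  have h1 : 4 * t + 4 + ν + k * (6 * (b * ν) + 8) ≤ (4 * t + 5 + k * (6 * b + 8)) * (ν + 1) := by
    nlinarith [Nat.zero_le (t * ν), Nat.zero_le (k * b), Nat.zero_le (k * ν), Nat.zero_le ν]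
  have h2 := Nat.mul_le_mul_left (2 * (p + 1) ^ k) h1
  have h3 : (p + 1) * 4 ≤ (p + 1) * 4 * (ν + 1) := Nat.le_mul_of_pos_right _ (by omega)
  have h4 : 2 ≤ 2 * (ν + 1) := by omega
  calc _ ≤ (p + 1) * 4 * (ν + 1) +
        2 * (p + 1) ^ k * ((4 * t + 5 + k * (6 * b + 8)) * (ν + 1)) + 2 * (ν + 1) := by omega
    _ = _ := by ring

lemma stage_connections_le (p k t b : ℕ) (ht : 1 ≤ t) : ∃ c : ℕ, ∀ ν : ℕ, (p + 1) * 8 +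
    2 * (p + 1) ^ k * ((2 ^ ν + 1) ^ t * (12 * t + 6) + 1 + 2 * ν + k * (16 * (b * ν) + 21)) +
      (2 * (p + 1) ^ k + 3) ≤ c * 2 ^ (ν * t) := by
  refine ⟨(p + 1) * 8 + 2 * (p + 1) ^ k * (2 ^ t * (12 * t + 6) + 1 + 2 + k * (16 * b + 21)) +
    (2 * (p + 1) ^ k + 3), fun ν => ?_⟩
  set P := 2 ^ (ν * t) with hP
  have hP1 : 1 ≤ P := Nat.one_le_two_pow
  have hν : ν ≤ P := (Nat.lt_two_pow_self).le.trans
    (Nat.pow_le_pow_right (by norm_num) (Nat.le_mul_of_pos_right _ ht))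
  have h1 : (2 ^ ν + 1) ^ t ≤ 2 ^ t * P := by
    rw [hP, pow_mul, ← mul_pow]
    refine Nat.pow_le_pow_left ?_ t
    have := Nat.one_le_two_pow (n := ν)
    omega
  have h2 : (2 ^ ν + 1) ^ t * (12 * t + 6) + 1 + 2 * ν + k * (16 * (b * ν) + 21) ≤
      2 ^ t * P * (12 * t + 6) + 1 * P + 2 * P + k * (16 * (b * P) + 21 * P) := by
    gcongr <;> omega
  calc _ ≤ (p + 1) * 8 * P + 2 * (p + 1) ^ k *
        (2 ^ t * P * (12 * t + 6) + 1 * P + 2 * P + k * (16 * (b * P) + 21 * P)) +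
        (2 * (p + 1) ^ k + 3) * P := by
        refine Nat.add_le_add (Nat.add_le_add ?_ (Nat.mul_le_mul_left _ h2)) ?_
        · exact Nat.le_mul_of_pos_right _ hP1
        · exact Nat.le_mul_of_pos_right _ hP1
    _ = _ := by ring

/-- Approximation of a Hölder function of approximately computed arguments. -/
lemma exists_stage (p : ℕ) {t : ℕ} (ht : 1 ≤ t) {β A F : ℝ} (hβ : 0 < β) (hA : 0 ≤ A)
    (hF : 1 ≤ F) :
    ∃ (c : ℕ) (K C : ℝ), 0 ≤ C ∧ ∀ (l u : ℝ), l < u → |l| ≤ F → |u| ≤ F →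
      ∀ f : (Fin p → ℝ) → ℝ, HolderClass p t β l u A f → (∀ x ∈ cube p l u, |f x| ≤ F) →
      ∀ K' ≥ K, ∀ {X : Type} (I : Set (X → ℝ)) (y : Fin p → X → ℝ), (∀ j, y j ∈ I) →
      (∀ j ξ, 0 ≤ y j ξ) → ∀ (z : X → Fin p → ℝ), (∀ ξ, z ξ ∈ cube p l u) → ∀ E : ℝ, 0 ≤ E →
      (∀ j ξ, |y j ξ - (z ξ j + F) / (2 * F)| ≤ E) → ∀ ν : ℕ,
      ∃ g : X → ℝ, Makes K' (c * (ν + 1)) (c * 2 ^ (ν * t)) I {g} ∧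
        (∀ ξ, g ξ ∈ Set.Icc (0 : ℝ) 1) ∧
        ∀ ξ, |g ξ - (f (z ξ) + F) / (2 * F)| ≤ C * (((2 : ℝ) ^ ν)⁻¹ ^ β + E ^ min β 1) := by
  obtain ⟨C, hC, hloc⟩ := exists_locPoly p hβ hA hF
  set k := strictFloor β
  obtain ⟨c₁, hc₁⟩ := stage_layers_le p k t ⌈β⌉₊
  obtain ⟨c₂, hc₂⟩ := stage_connections_le p k t ⌈β⌉₊ ht
  set C₁ := 2 * (p + 1) ^ k * C * k + C * 2 ^ β with hC₁
  set C₂ := C + (p + 1) ^ k * C * k with hC₂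
  have hC₁0 : 0 ≤ C₁ := by positivity
  have hC₂0 : 0 ≤ C₂ := by positivity
  refine ⟨c₁ + c₂, stageWeight p k C, C₁ + C₂, by positivity, ?_⟩
  intro l u hlu hl hu f hf hfF K' hK' X I y hyI hy0 z hz E hE hyz ν
  have h2F : 0 < 2 * F := by linarith
  have hl' := abs_le.1 hl
  have hu' := abs_le.1 hu
  set l' := (l + F) / (2 * F) with hl'd
  set u' := (u + F) / (2 * F) with hu'd
  have hl0 : 0 ≤ l' := div_nonneg (by linarith) h2F.le
  have hu1 : u' ≤ 1 := by rw [hu'd, div_le_one h2F]; linarith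
  have hlu' : l' ≤ u' := by rw [hl'd, hu'd]; gcongr
  have hmem : ∀ x ∈ cube p l' u', (fun j => 2 * F * x j - F) ∈ cube p l u := by
    intro x hx
    refine ⟨fun j => ?_, fun j => ?_⟩
    · have h := hx.1 j
      simp only [hl'd] at h
      rw [div_le_iff₀ h2F] at h
      simp only
      linarith
    · have h := hx.2 j
      simp only [hu'd] at h
      rw [le_div_iff₀ h2F] at h
      simp only
      linarith
  set G : (Fin p → ℝ) → ℝ := fun x => (f (fun j => 2 * F * x j - F) + F) / (2 * F) with hG
  have hloc' : LocPoly k β C (cube p l' u') G := hloc t l u hlu hl hu f hf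
  have hG01 : ∀ x ∈ cube p l' u', G x ∈ Set.Icc (0 : ℝ) 1 := fun x hx => by
    have := abs_le.1 (hfF _ (hmem x hx))
    refine ⟨div_nonneg (by linarith) h2F.le, ?_⟩
    rw [hG, div_le_one h2F]
    linarith
  obtain ⟨s, hst, hs⟩ := hf.1
  obtain ⟨g, hg, hg01, hgG⟩ := exists_makes_locPoly hloc' hβ hC hl0 hlu' hu1 hG01 hst
    (fun x hx y hy hxy => by
      simp only [hG]
      rw [hs _ (hmem x hx) _ (hmem y hy) fun i hi => by rw [hxy i hi]]) hK' hyI hy0 ν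
  refine ⟨g, hg.mono ((hc₁ ν).trans (Nat.mul_le_mul_right _ (Nat.le_add_right _ _)))
    ((hc₂ ν).trans (Nat.mul_le_mul_right _ (Nat.le_add_left _ _))) subset_rfl subset_rfl, hg01,
    fun ξ => ?_⟩
  set z' : Fin p → ℝ := fun j => (z ξ j + F) / (2 * F) with hz'
  have hz'Q : z' ∈ cube p l' u' := by
    refine ⟨fun j => ?_, fun j => ?_⟩
    · simp only [hz', hl'd]
      gcongr
      exact (hz ξ).1 j
    · simp only [hz', hu'd]
      gcongr
      exact (hz ξ).2 j
  have hGz : G z' = (f (z ξ) + F) / (2 * F) := by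
    simp only [hG, hz']
    congr 3
    funext j
    field_simp
    ring
  have hclip : (fun j => max l' (min (y j ξ) u')) ∈ cube p l' u' :=
    ⟨fun j => le_max_left _ _, fun j => max_le hlu' (min_le_right _ _)⟩
  have hdist : ‖(fun j => max l' (min (y j ξ) u')) - z'‖ ≤ E := by
    rw [pi_norm_le_iff_of_nonneg hE]
    intro j
    exact (abs_max_min_sub_le ⟨hz'Q.1 j, hz'Q.2 j⟩).trans (hyz j ξ)
  have h1 := hloc'.abs_sub_le hβ hC.le hl0 hu1 hclip hz'Q
  have h2 : ‖(fun j => max l' (min (y j ξ) u')) - z'‖ ^ min β 1 ≤ E ^ min β 1 :=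
    Real.rpow_le_rpow (norm_nonneg _) hdist (by positivity)
  rw [← hGz]
  -- Error of the network at the clipped argument, plus Hölder continuity of G; clipping does not
  -- increase the distance to the true argument, which lies in the cube.
  refine (abs_sub_le _ (G fun j => max l' (min (y j ξ) u')) _).trans ?_
  have h3 := hgG ξ
  have h4 := mul_le_mul_of_nonneg_left h2 hC₂0
  have h5 : 0 ≤ C₂ * ((2 : ℝ) ^ ν)⁻¹ ^ β := by positivity
  have h6 : 0 ≤ C₁ * E ^ min β 1 := by positivity
  calc _ ≤ C₁ * ((2 : ℝ) ^ ν)⁻¹ ^ β + C₂ * E ^ min β 1 := add_le_add h3 (h1.trans h4)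
    _ ≤ _ := by nlinarith

/-- The data of a composition structured function. -/
def CompositionData (q : ℕ) (D t : ℕ → ℕ) (β : ℕ → ℝ) (A : ℝ) (l u : ℕ → ℝ)
    (g : ∀ i, (Fin (D i) → ℝ) → Fin (D (i + 1)) → ℝ) : Prop :=
  l 0 = 0 ∧ u 0 = 1 ∧
    ∀ i ≤ q, l i < u i ∧ |l (i + 1)| ≤ A ∧ |u (i + 1)| ≤ A ∧
      Set.MapsTo (g i) (cube (D i) (l i) (u i)) (cube (D (i + 1)) (l (i + 1)) (u (i + 1))) ∧
      ∀ j, HolderClass (D i) (t i) (β i) (l i) (u i) A (fun x => g i x j)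

variable {q : ℕ} {D t : ℕ → ℕ} {β : ℕ → ℝ} {A F : ℝ} {l u : ℕ → ℝ}
  {g : ∀ i, (Fin (D i) → ℝ) → Fin (D (i + 1)) → ℝ}

lemma CompositionData.composeUpTo_mem (h : CompositionData q D t β A l u g) {x : Fin (D 0) → ℝ}
    (hx : x ∈ cube (D 0) 0 1) (n : ℕ) (hn : n ≤ q + 1) :
    composeUpTo g n x ∈ cube (D n) (l n) (u n) := by
  induction n with
  | zero =>
    rw [h.1, h.2.1]
    exact hx
  | succ n ih => exact (h.2.2 n (by omega)).2.2.2.1 (ih (by omega))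

lemma CompositionData.bounds (h : CompositionData q D t β A l u g) (hA : A ≤ F) (hF : 1 ≤ F)
    (n : ℕ) (hn : n ≤ q + 1) : |l n| ≤ F ∧ |u n| ≤ F := by
  cases n with
  | zero =>
    rw [h.1, h.2.1]
    simp only [abs_zero, abs_one]
    exact ⟨by linarith, hF⟩
  | succ n =>
    have := h.2.2 n (by omega)
    exact ⟨this.2.1.trans hA, this.2.2.1.trans hA⟩

lemma abs_le_of_mem_cube {p : ℕ} {l u F : ℝ} (hl : |l| ≤ F) (hu : |u| ≤ F) {x : Fin p → ℝ}
    (hx : x ∈ cube p l u) (j : Fin p) : |x j| ≤ F :=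
  abs_le.2 ⟨(abs_le.1 hl).1.trans (hx.1 j), (hx.2 j).trans (abs_le.1 hu).2⟩

/-- A stage maps an input error E to a new error plus E to the power β_n ∧ 1. With error levels ε^(ρ
n), the recursion ρ (n + 1) = ρ n (β_n ∧ 1) makes the inherited part match the new level. All
intermediate values are normalized by v ↦ (v + F)/(2F), and all constants are chosen before the
functions g. -/
lemma exists_makes_composeUpTo (hβ : ∀ i ≤ q, 0 < β i) (ht : ∀ i ≤ q, 1 ≤ t i) (hA : 0 ≤ A)
    (hAF : A ≤ F) (hF : 1 ≤ F) (n : ℕ) (hn : n ≤ q + 1) :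
    ∃ (c : ℕ) (K C : ℝ), 0 ≤ C ∧ ∀ K' ≥ K, ∀ (l u : ℕ → ℝ)
      (g : ∀ i, (Fin (D i) → ℝ) → Fin (D (i + 1)) → ℝ), CompositionData q D t β A l u g →
      ∀ (ν : ℕ → ℕ) (N S : ℕ) (ε : ℝ) (ρ : ℕ → ℝ), 0 < ε →
      (∀ i ≤ q, ν i ≤ N) → 1 ≤ S → (∀ i ≤ q, 2 ^ (ν i * t i) ≤ S) →
      (∀ i ≤ q, ρ (i + 1) = ρ i * min (β i) 1) →
      (∀ i ≤ q, ((2 : ℝ) ^ ν i)⁻¹ ^ β i ≤ ε ^ ρ (i + 1)) →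
      ∃ y : Fin (D n) → cube (D 0) 0 1 → ℝ,
        Makes K' (c * (N + 1)) (c * S) (Set.range fun j (ξ : cube (D 0) 0 1) => ξ.1 j)
          (Set.range y) ∧ (∀ j ξ, y j ξ ∈ Set.Icc (0 : ℝ) 1) ∧
        ∀ j ξ, |y j ξ - (composeUpTo g n ξ.1 j + F) / (2 * F)| ≤ C * ε ^ ρ n := by
  have h2F : 0 < 2 * F := by linarith
  induction n with
  | zero =>
    refine ⟨D 0 * 2, 1, 0, le_rfl, ?_⟩
    intro K' hK' l u g hg ν N S ε ρ hε hN hS hS' hρ hν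
    set y : Fin (D 0) → cube (D 0) 0 1 → ℝ := fun j ξ => (ξ.1 j + F) / (2 * F) with hy
    have hy0 : ∀ j ξ, 0 ≤ y j ξ := fun j ξ => by
      have : 0 ≤ ξ.1 j := ξ.2.1 j
      positivity
    refine ⟨y, ?_, fun j ξ => ⟨hy0 j ξ, ?_⟩, fun j ξ => ?_⟩
    · have := Makes.finset (K := K') (L := 1) (e := 2)
        (I := Set.range fun j (ξ : cube (D 0) 0 1) => ξ.1 j) (Finset.univ : Finset (Fin (D 0)))
        (g := fun j => {y j}) (fun j _ => ?_)
      · rw [Finset.card_univ, Fintype.card_fin] at this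
        refine this.mono ?_ ?_ subset_rfl ?_
        · calc D 0 * 1 ≤ D 0 * 2 * 1 := by omega
            _ ≤ _ := by gcongr; omega
        · calc D 0 * 2 = D 0 * 2 * 1 := (mul_one _).symm
            _ ≤ _ := by gcongr
        · rintro _ ⟨j, rfl⟩
          simp
      · have := makes_relu₁ (K := K') (I := Set.range fun j (ξ : cube (D 0) 0 1) => ξ.1 j)
          (x := fun ξ => ξ.1 j) ⟨j, rfl⟩ (w := 1 / (2 * F)) (b := 1 / 2) ?_ ?_
        · refine this.mono le_rfl le_rfl subset_rfl ?_
          rintro _ rfl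
          rw [Set.mem_singleton_iff]
          funext ξ
          have e : 1 / (2 * F) * ξ.1 j + 1 / 2 = y j ξ := by
            simp only [hy]
            field_simp
          rw [e, max_eq_left (hy0 j ξ)]
        · rw [abs_of_pos (by positivity)]
          refine le_trans ?_ hK'
          rw [div_le_one h2F]
          linarith
        · rw [abs_of_pos (by positivity)]
          refine le_trans ?_ hK'
          norm_num
    · have : ξ.1 j ≤ 1 := ξ.2.2 j
      simp only [hy]
      rw [div_le_one h2F]
      linarith
    · simp [hy, composeUpTo]
  | succ n ih =>
    obtain ⟨c, K, C, hC, H⟩ := ih (by omega)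
    obtain ⟨c', K'', C', hC', H'⟩ := exists_stage (D n) (ht n (by omega)) (hβ n (by omega)) hA hF
    refine ⟨c + D (n + 1) * c', max K K'', C' * (1 + C ^ min (β n) 1), by positivity, ?_⟩
    intro K' hK' l u g hg ν N S ε ρ hε hN hS hS' hρ hν
    have hnq : n ≤ q := by omega
    obtain ⟨y, hy, hy01, hyE⟩ := H K' ((le_max_left _ _).trans hK') l u g hg ν N S ε ρ hε hN hS
      hS' hρ hν
    obtain ⟨hlu, -, -, hmaps, hH⟩ := hg.2.2 n hnq
    obtain ⟨hl, hu⟩ := hg.bounds hAF hF n (by omega)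
    obtain ⟨hl', hu'⟩ := hg.bounds hAF hF (n + 1) (by omega)
    have hstage : ∀ j : Fin (D (n + 1)), ∃ f : cube (D 0) 0 1 → ℝ,
        Makes K' (c' * (ν n + 1)) (c' * 2 ^ (ν n * t n))
          ((Set.range fun j (ξ : cube (D 0) 0 1) => ξ.1 j) ∪ Set.range y) {f} ∧
        (∀ ξ, f ξ ∈ Set.Icc (0 : ℝ) 1) ∧ ∀ ξ, |f ξ - (g n (composeUpTo g n ξ.1) j + F) / (2 * F)| ≤
          C' * (((2 : ℝ) ^ ν n)⁻¹ ^ β n + (C * ε ^ ρ n) ^ min (β n) 1) := fun j =>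
      H' (l n) (u n) hlu hl hu (fun x => g n x j) (hH j)
        (fun x hx => abs_le_of_mem_cube hl' hu' (hmaps hx) j) K' ((le_max_right _ _).trans hK') _ y
        (fun j => Or.inr ⟨j, rfl⟩) (fun j ξ => (hy01 j ξ).1) (fun ξ => composeUpTo g n ξ.1)
        (fun ξ => hg.composeUpTo_mem ξ.2 n (by omega)) _ (by positivity) hyE (ν n)
    choose f hf hf01 hfE using hstage
    refine ⟨f, ?_, hf01, fun j ξ => (hfE j ξ).trans ?_⟩
    · have h1 := hy.trans (Makes.finset Finset.univ (g := fun j => {f j}) fun j _ => hf j)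
      rw [Finset.card_univ, Fintype.card_fin] at h1
      refine h1.mono ?_ ?_ subset_rfl ?_
      · rw [add_mul, mul_assoc]
        gcongr
        exact hN n hnq
      · rw [add_mul, mul_assoc]
        gcongr
        exact hS' n hnq
      · rintro _ ⟨j, rfl⟩
        right
        simp
    · rw [mul_assoc C']
      refine mul_le_mul_of_nonneg_left ?_ hC'
      rw [add_mul, one_mul, Real.mul_rpow hC (by positivity), ← Real.rpow_mul hε.le,
        ← hρ n hnq]
      linarith [hν n hnq]

/-- Composition structured functions are approximated by sparse networks. -/
theorem exists_net_of_isComposition {d : ℕ} (hd : 0 < d) (hD0 : D 0 = d) (hDq : D (q + 1) = 1)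
    (hβ : ∀ i ≤ q, 0 < β i) (ht : ∀ i ≤ q, 1 ≤ t i) (hA : 0 ≤ A) (hAF : A ≤ F) (hF : 1 ≤ F) :
    ∃ C : ℕ, ∀ m : (Fin d → ℝ) → ℝ, IsComposition q D t hD0 β A m →
      (∀ x ∈ cube d 0 1, |m x| ≤ F) ∧
      ∀ (ν : ℕ → ℕ) (N S : ℕ) (ε : ℝ) (ρ : ℕ → ℝ), 0 < ε →
      (∀ i ≤ q, ν i ≤ N) → 1 ≤ S → (∀ i ≤ q, 2 ^ (ν i * t i) ≤ S) →
      (∀ i ≤ q, ρ (i + 1) = ρ i * min (β i) 1) → ρ (q + 1) = 1 →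
      (∀ i ≤ q, ((2 : ℝ) ^ ν i)⁻¹ ^ β i ≤ ε ^ ρ (i + 1)) →
      ∃ net : Net d, (∀ x ∈ cube d 0 1, |net.eval x| ≤ F ∧ |net.eval x - m x| ≤ C * ε) ∧
        1 ≤ net.depth ∧ net.depth ≤ C * (N + 1) ∧
        (∀ w ∈ net.hiddenWidths, 1 ≤ w ∧ w ≤ C * S) ∧ (∀ θ ∈ net.params, |θ| ≤ 1) ∧
        net.nnz ≤ C * ((N + 1) * S) := by
  subst hD0
  obtain ⟨c, K, C, hC, H⟩ := exists_makes_composeUpTo (D := D) hβ ht hA hAF hF (q + 1) le_rfl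
  set K' := max K 1 with hK'
  obtain ⟨a, ha⟩ := pow_unbounded_of_one_lt K' (one_lt_two (α := ℝ))
  obtain ⟨b, hb⟩ := pow_unbounded_of_one_lt F (one_lt_two (α := ℝ))
  have h2F : 0 < 2 * F := by linarith
  set d := D 0
  refine ⟨⌈2 * F * C⌉₊ + ((a + 1) * (c + 1) + b + 1) + (d + c + 4) +
    (2 * ((c + 1) * (d + c + 1)) + c + 20 * (a * (c + 1) + b) + 14), fun m hm => ?_⟩
  obtain ⟨l, u, g, hl, hu, hg, hmg⟩ := hm
  have hdata : CompositionData q D t β A l u g := ⟨hl, hu, hg⟩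
  set j₀ : Fin (D (q + 1)) := ⟨0, by omega⟩
  have hmeq : ∀ x ∈ cube d 0 1, m x = composeUpTo g (q + 1) x j₀ := fun x hx => hmg x hx j₀
  refine ⟨fun x hx => ?_, ?_⟩
  · rw [hmeq x hx]
    obtain ⟨h1, h2⟩ := hdata.bounds hAF hF (q + 1) le_rfl
    exact abs_le_of_mem_cube h1 h2 (hdata.composeUpTo_mem hx _ le_rfl) _
  intro ν N S ε ρ hε hN hS hS' hρ hρq hν
  obtain ⟨y, hy, hy01, hyE⟩ := H K' (le_max_left _ _) l u g hdata ν N S ε ρ hε hN hS hS' hρ hν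
  obtain ⟨net, h1, h2, h3, h4, h5, h6⟩ := exists_net_of_makes hd (le_max_right _ _) hF ha.le hb.le
    (hy.mono le_rfl le_rfl subset_rfl (Set.singleton_subset_iff.2 ⟨j₀, rfl⟩))
  have hcN : c * (N + 1) + 1 ≤ (c + 1) * (N + 1) := by nlinarith
  have hdS : d + c * S + 1 ≤ (d + c + 1) * S := by nlinarith
  have hN1 : 1 ≤ N + 1 := by omega
  have hNS : 1 ≤ (N + 1) * S := Nat.mul_pos hN1 hS
  refine ⟨net, fun x hx => ?_, h2, h3.trans ?_, fun w hw => ⟨(h4 w hw).1, (h4 w hw).2.trans ?_⟩,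
    h5, h6.trans ?_⟩
  · have e1 := h1 ⟨x, hx⟩
    obtain ⟨h7, h8⟩ := hy01 j₀ ⟨x, hx⟩
    have h9 := hyE j₀ ⟨x, hx⟩
    simp only at e1
    rw [e1]
    constructor
    · rw [abs_mul, abs_of_pos (by linarith : 0 < F)]
      refine mul_le_of_le_one_right (by linarith) (abs_le.2 ⟨by linarith, by linarith⟩)
    · rw [hmeq x hx]
      simp only [hρq, Real.rpow_one] at h9
      have e2 : F * (2 * y j₀ ⟨x, hx⟩ - 1) - composeUpTo g (q + 1) x j₀ =
          2 * F * (y j₀ ⟨x, hx⟩ - (composeUpTo g (q + 1) x j₀ + F) / (2 * F)) := by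
        field_simp
        ring
      rw [e2, abs_mul, abs_of_pos h2F]
      calc _ ≤ 2 * F * (C * ε) := by gcongr
        _ = 2 * F * C * ε := by ring
        _ ≤ ⌈2 * F * C⌉₊ * ε := by gcongr; exact Nat.le_ceil _
        _ ≤ _ := by
          gcongr
          norm_cast
          omega
  · calc _ ≤ (a + 1) * ((c + 1) * (N + 1)) + b * (N + 1) + 1 * (N + 1) := by
          refine Nat.add_le_add (Nat.add_le_add (Nat.mul_le_mul_left _ hcN) ?_) ?_
          · exact Nat.le_mul_of_pos_right _ hN1
          · omega
      _ = ((a + 1) * (c + 1) + b + 1) * (N + 1) := by ring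
      _ ≤ _ := Nat.mul_le_mul_right _ (by omega)
  · calc _ ≤ (d + c + 4) * S := by nlinarith
      _ ≤ _ := Nat.mul_le_mul_right _ (by omega)
  · have e1 : (c * (N + 1) + 1) * (d + c * S + 1) ≤
        (c + 1) * (N + 1) * ((d + c + 1) * S) := Nat.mul_le_mul hcN hdS
    have e2 : c * S ≤ c * ((N + 1) * S) := Nat.mul_le_mul_left _ (Nat.le_mul_of_pos_left _ hN1)
    have e3 : a * (c * (N + 1) + 1) + b ≤ (a * (c + 1) + b) * ((N + 1) * S) := by
      calc _ ≤ a * ((c + 1) * (N + 1)) + b * (N + 1) :=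
            Nat.add_le_add (Nat.mul_le_mul_left _ hcN) (Nat.le_mul_of_pos_right _ hN1)
        _ = (a * (c + 1) + b) * (N + 1) := by ring
        _ ≤ _ := Nat.mul_le_mul_left _ (Nat.le_mul_of_pos_right _ hS)
    calc _ ≤ 2 * ((c + 1) * (N + 1) * ((d + c + 1) * S)) + c * ((N + 1) * S) +
          20 * ((a * (c + 1) + b) * ((N + 1) * S)) + 14 * ((N + 1) * S) := by
          refine Nat.add_le_add (Nat.add_le_add (Nat.add_le_add ?_ e2) ?_) ?_
          · exact Nat.mul_le_mul_left _ e1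
          · exact Nat.mul_le_mul_left _ e3
          · exact Nat.le_mul_of_pos_right _ hNS
      _ = (2 * ((c + 1) * (d + c + 1)) + c + 20 * (a * (c + 1) + b) + 14) * ((N + 1) * S) := by ring
      _ ≤ _ := Nat.mul_le_mul_right _ (by omega)

end Composition

end SparseDNN

namespace SparseDNN

/-! ### The rate -/

section Rate

variable {q : ℕ} {D t : ℕ → ℕ} {β : ℕ → ℝ}

lemma effSmoothness_pos (hβ : ∀ i ≤ q, 0 < β i) {i : ℕ} (hi : i ≤ q) : 0 < effSmoothness q β i :=
  mul_pos (hβ i hi) (Finset.prod_pos fun ℓ hℓ =>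
    lt_min (hβ ℓ (Finset.mem_Ioc.1 hℓ).2) one_pos)

lemma le_phiRate {i : ℕ} (hi : i ≤ q) (T : ℕ) :
    (T : ℝ) ^ (-(2 * effSmoothness q β i / (2 * effSmoothness q β i + (t i : ℝ)))) ≤
      phiRate q t β T :=
  Finset.le_sup' (fun i => (T : ℝ) ^ (-(2 * effSmoothness q β i /
    (2 * effSmoothness q β i + (t i : ℝ))))) (Finset.mem_range.2 (by omega))

lemma inv_le_phiRate (hβ : ∀ i ≤ q, 0 < β i) {T : ℕ} (hT : 1 ≤ T) :
    (T : ℝ)⁻¹ ≤ phiRate q t β T := by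
  refine le_trans ?_ (le_phiRate (Nat.zero_le q) T)
  have h := effSmoothness_pos hβ (Nat.zero_le q)
  rw [← Real.rpow_neg_one]
  refine Real.rpow_le_rpow_of_exponent_le (by exact_mod_cast hT) (neg_le_neg ?_)
  rw [div_le_one (by positivity)]
  linarith [(Nat.cast_nonneg (t 0) : (0 : ℝ) ≤ _)]

lemma tendsto_phiRate (hβ : ∀ i ≤ q, 0 < β i) : Tendsto (phiRate q t β) atTop (nhds 0) := by
  have h1 : Tendsto (fun T : ℕ => ∑ i ∈ Finset.range (q + 1), (T : ℝ) ^ (-(2 * effSmoothness q β i /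
      (2 * effSmoothness q β i + (t i : ℝ))))) atTop (nhds (∑ _i ∈ Finset.range (q + 1), 0)) := by
    refine tendsto_finsetSum _ fun i hi => ?_
    have h := effSmoothness_pos hβ (Nat.lt_succ_iff.1 (Finset.mem_range.1 hi))
    exact (tendsto_rpow_neg_atTop (by positivity)).comp tendsto_natCast_atTop_atTop
  rw [Finset.sum_const_zero] at h1
  refine squeeze_zero (fun T => ?_) (fun T => ?_) h1
  · exact le_trans (by positivity) (le_phiRate (Nat.zero_le q) T)
  · refine Finset.sup'_le _ _ fun i hi => ?_
    exact Finset.single_le_sum (f := fun i => (T : ℝ) ^ (-(2 * effSmoothness q β i /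
      (2 * effSmoothness q β i + (t i : ℝ))))) (fun _ _ => by positivity) hi

/-- The number of doublings in the `i`-th layer of a composition. -/
noncomputable def resolution (q : ℕ) (t : ℕ → ℕ) (β : ℕ → ℝ) (T i : ℕ) : ℕ :=
  ⌈Real.logb 2 T / (2 * effSmoothness q β i + (t i : ℝ))⌉₊

lemma le_two_pow_resolution (T i : ℕ) (hT : 0 < T) :
    (T : ℝ) ^ (1 / (2 * effSmoothness q β i + (t i : ℝ))) ≤ 2 ^ resolution q t β T i := by
  have hT' : (0 : ℝ) < T := by exact_mod_cast hT
  calc (T : ℝ) ^ (1 / (2 * effSmoothness q β i + (t i : ℝ)))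
      = (2 : ℝ) ^ (Real.logb 2 T / (2 * effSmoothness q β i + (t i : ℝ))) := by
        conv_lhs => rw [← Real.rpow_logb (b := 2) (by norm_num) (by norm_num) hT']
        rw [← Real.rpow_mul (by norm_num), mul_one_div]
    _ ≤ (2 : ℝ) ^ (resolution q t β T i : ℝ) :=
        Real.rpow_le_rpow_of_exponent_le (by norm_num) (Nat.le_ceil _)
    _ = _ := Real.rpow_natCast _ _

lemma two_pow_resolution_le (hβ : ∀ i ≤ q, 0 < β i) {T i : ℕ} (hi : i ≤ q) (hT : 1 ≤ T) :
    (2 : ℝ) ^ resolution q t β T i ≤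
      2 * (T : ℝ) ^ (1 / (2 * effSmoothness q β i + (t i : ℝ))) := by
  have hT' : (1 : ℝ) ≤ T := by exact_mod_cast hT
  have h := effSmoothness_pos hβ hi
  have h0 : 0 ≤ Real.logb 2 T / (2 * effSmoothness q β i + (t i : ℝ)) :=
    div_nonneg (Real.logb_nonneg (by norm_num) hT') (by positivity)
  calc (2 : ℝ) ^ resolution q t β T i = (2 : ℝ) ^ (resolution q t β T i : ℝ) :=
        (Real.rpow_natCast _ _).symm
    _ ≤ (2 : ℝ) ^ (Real.logb 2 T / (2 * effSmoothness q β i + (t i : ℝ)) + 1) :=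
        Real.rpow_le_rpow_of_exponent_le (by norm_num) (Nat.ceil_lt_add_one h0).le
    _ = _ := by
        rw [Real.rpow_add_one (by norm_num), mul_comm]
        congr 1
        conv_rhs => rw [← Real.rpow_logb (b := 2) (by norm_num) (by norm_num)
          (by linarith : (0 : ℝ) < T)]
        rw [← Real.rpow_mul (by norm_num), mul_one_div]

/-- Approximation of all composition structured functions at the rate `φ_T`. -/
theorem exists_net_phiRate {d : ℕ} (hd : 0 < d) (hD0 : D 0 = d) (hDq : D (q + 1) = 1)
    (hβ : ∀ i ≤ q, 0 < β i) (ht : ∀ i ≤ q, 1 ≤ t i) {A F : ℝ} (hA : 0 ≤ A) (hAF : A ≤ F)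
    (hF : 1 ≤ F) :
    ∃ C : ℝ, 0 < C ∧ ∀ m : (Fin d → ℝ) → ℝ, IsComposition q D t hD0 β A m →
      (∀ x ∈ cube d 0 1, |m x| ≤ F) ∧ ∀ T : ℕ, 1 ≤ T → 1 ≤ Real.log T →
      ∃ net : Net d,
        (∀ x ∈ cube d 0 1, |net.eval x| ≤ F ∧ |net.eval x - m x| ≤ C * √(phiRate q t β T)) ∧
        1 ≤ net.depth ∧ (net.depth : ℝ) ≤ C * Real.log T ∧
        (∀ w ∈ net.hiddenWidths, 1 ≤ w ∧ (w : ℝ) ≤ C * (T * phiRate q t β T)) ∧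
        (∀ θ ∈ net.params, |θ| ≤ 1) ∧
        (net.nnz : ℝ) ≤ C * (Real.log T * (T * phiRate q t β T)) := by
  obtain ⟨C, hC⟩ := exists_net_of_isComposition hd hD0 hDq hβ ht hA hAF hF
  set P : ℝ := ∑ i ∈ Finset.range (q + 1), (2 : ℝ) ^ t i with hP
  have hP0 : 0 ≤ P := Finset.sum_nonneg fun _ _ => by positivity
  refine ⟨C * (5 * (P + 2)) + 1, by positivity, fun m hm => ⟨(hC m hm).1, fun T hT hlog => ?_⟩⟩
  have hT' : (1 : ℝ) ≤ T := by exact_mod_cast hT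
  have hT0 : (0 : ℝ) < T := by linarith
  set φ := phiRate q t β T with hφ
  have hφT : (T : ℝ)⁻¹ ≤ φ := inv_le_phiRate hβ hT
  have hφ0 : 0 < φ := (inv_pos.2 hT0).trans_le hφT
  have hTφ : 1 ≤ T * φ := by
    rw [inv_eq_one_div, div_le_iff₀ hT0] at hφT
    linarith
  -- Solved backwards from ρ (q + 1) = 1, the empty product: inner layers must be more accurate.
  -- Then β_i equals the effective smoothness times ρ (i + 1), which is how β* appears.
  set ρ : ℕ → ℝ := fun i => (∏ ℓ ∈ Finset.Ico i (q + 1), min (β ℓ) 1)⁻¹ with hρ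
  have hprod : ∀ i, i ≤ q → 0 < ∏ ℓ ∈ Finset.Ico (i + 1) (q + 1), min (β ℓ) 1 := fun i _ =>
    Finset.prod_pos fun ℓ hℓ => lt_min (hβ ℓ (by have := (Finset.mem_Ico.1 hℓ).2; omega)) one_pos
  have heff : ∀ i, i ≤ q → effSmoothness q β i * ρ (i + 1) = β i := fun i hi => by
    have : Finset.Ioc i q = Finset.Ico (i + 1) (q + 1) := by
      ext ℓ
      simp only [Finset.mem_Ioc, Finset.mem_Ico]
      omega
    rw [effSmoothness, this, hρ, mul_assoc, mul_inv_cancel₀ (hprod i hi).ne', mul_one]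
  set S := ⌈P * (T * φ)⌉₊ + 1 with hS
  set N := ⌈2 * Real.log T⌉₊ + 1 with hN
  have hS' : (S : ℝ) ≤ (P + 2) * (T * φ) := by
    have := (Nat.ceil_lt_add_one (by positivity : 0 ≤ P * (T * φ))).le
    rw [hS]
    push_cast
    linarith
  have hN' : ((N : ℝ) + 1) ≤ 5 * Real.log T := by
    have := (Nat.ceil_lt_add_one (by positivity : 0 ≤ 2 * Real.log T)).le
    rw [hN]
    push_cast
    linarith
  have hres : ∀ i ≤ q, resolution q t β T i ≤ N := by
    intro i hi
    refine Nat.ceil_le.2 ?_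
    have hbpos := effSmoothness_pos hβ hi
    have hti : (1 : ℝ) ≤ t i := by exact_mod_cast ht i hi
    have h0 : 0 ≤ Real.logb 2 T := Real.logb_nonneg (by norm_num) hT'
    have hlogb : Real.logb 2 T ≤ 2 * Real.log T := by
      rw [Real.logb, div_le_iff₀ (Real.log_pos one_lt_two)]
      have := Real.log_two_gt_d9
      nlinarith
    have := Nat.le_ceil (2 * Real.log T)
    rw [hN]
    push_cast
    refine (div_le_self h0 (by linarith)).trans ?_
    linarith
  -- The grid has about T^(t_i/(2β*_i + t_i)) = T · T^(-2β*_i/(2β*_i + t_i)) ≤ T φ points; rounding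
  -- the resolution up costs the factor 2^(t_i).
  have hsize : ∀ i ≤ q, 2 ^ (resolution q t β T i * t i) ≤ S := by
    intro i hi
    have h1 := two_pow_resolution_le (t := t) hβ hi hT
    have hbpos := effSmoothness_pos hβ hi
    have hti : (1 : ℝ) ≤ t i := by exact_mod_cast ht i hi
    have h2 : (2 : ℝ) ^ (resolution q t β T i * t i) ≤ P * (T * φ) := by
      rw [pow_mul]
      calc _ ≤ (2 * (T : ℝ) ^ (1 / (2 * effSmoothness q β i + (t i : ℝ)))) ^ t i := by gcongr
        _ = 2 ^ t i * (T * (T : ℝ) ^ (-(2 * effSmoothness q β i /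
              (2 * effSmoothness q β i + (t i : ℝ))))) := by
            rw [mul_pow, ← Real.rpow_natCast ((T : ℝ) ^ _), ← Real.rpow_mul hT0.le]
            congr 1
            conv_rhs => rw [← Real.rpow_one_add' hT0.le (by
              rw [← sub_eq_add_neg, sub_ne_zero, ne_comm, ne_eq, div_eq_one_iff_eq (by positivity)]
              linarith)]
            congr 1
            field_simp
            ring
        _ ≤ P * (T * φ) := by
            gcongr
            · exact Finset.single_le_sum (f := fun i => (2 : ℝ) ^ t i) (fun _ _ => by positivity)
                (Finset.mem_range.2 (by omega))
            · exact le_phiRate hi T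
    have h3 : ((2 ^ (resolution q t β T i * t i) : ℕ) : ℝ) ≤ (⌈P * (T * φ)⌉₊ : ℕ) := by
      push_cast
      exact h2.trans (Nat.le_ceil _)
    have h4 : 2 ^ (resolution q t β T i * t i) ≤ ⌈P * (T * φ)⌉₊ := by exact_mod_cast h3
    omega
  have hρrec : ∀ i ≤ q, ρ (i + 1) = ρ i * min (β i) 1 := by
    intro i hi
    simp only [hρ]
    rw [Finset.prod_eq_prod_Ico_succ_bot (by omega : i < q + 1), mul_inv, mul_comm, ← mul_assoc,
      mul_inv_cancel₀ (lt_min (hβ i hi) one_pos).ne', one_mul]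
  -- With resolution T^(1/(2β*_i + t_i)) the bias is the square root of the i-th rate term raised to
  -- ρ (i + 1), so the choice ε = √φ balances bias and size.
  have herr : ∀ i ≤ q, ((2 : ℝ) ^ resolution q t β T i)⁻¹ ^ β i ≤ √φ ^ ρ (i + 1) := by
    intro i hi
    have hbpos := effSmoothness_pos hβ hi
    have hρ0 : 0 < ρ (i + 1) := inv_pos.2 (hprod i hi)
    have h1 := le_two_pow_resolution (q := q) (t := t) (β := β) T i (by omega)
    calc ((2 : ℝ) ^ resolution q t β T i)⁻¹ ^ β i
        ≤ ((T : ℝ) ^ (1 / (2 * effSmoothness q β i + (t i : ℝ))))⁻¹ ^ β i := by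
          have := (hβ i hi).le
          gcongr
      _ = ((T : ℝ) ^ (-(2 * effSmoothness q β i /
            (2 * effSmoothness q β i + (t i : ℝ))))) ^ (1 / 2 * ρ (i + 1)) := by
          rw [← Real.rpow_neg hT0.le, ← Real.rpow_mul hT0.le, ← Real.rpow_mul hT0.le]
          congr 1
          rw [← heff i hi]
          ring
      _ ≤ φ ^ (1 / 2 * ρ (i + 1)) := by
          have := le_phiRate (t := t) (β := β) hi T
          gcongr
      _ = √φ ^ ρ (i + 1) := by rw [Real.rpow_mul hφ0.le, Real.sqrt_eq_rpow]
  obtain ⟨net, h1, h2, h3, h4, h5, h6⟩ := (hC m hm).2 (resolution q t β T) N S (√φ) ρ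
    (Real.sqrt_pos.2 hφ0) hres (by omega) hsize hρrec (by simp [hρ]) herr
  have hC0 : (0 : ℝ) ≤ C := Nat.cast_nonneg C
  have hbig : (C : ℝ) ≤ C * (5 * (P + 2)) + 1 := by nlinarith
  have hlog0 : 0 < Real.log T := by linarith
  refine ⟨net, fun x hx => ⟨(h1 x hx).1, (h1 x hx).2.trans ?_⟩, h2, ?_,
    fun w hw => ⟨(h4 w hw).1, ?_⟩, h5, ?_⟩
  · exact mul_le_mul_of_nonneg_right hbig (Real.sqrt_nonneg _)
  · have : (net.depth : ℝ) ≤ C * (N + 1) := by exact_mod_cast h3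
    calc (net.depth : ℝ) ≤ C * (5 * Real.log T) := this.trans (by gcongr)
      _ ≤ C * (5 * (P + 2)) * Real.log T := by
          have h7 := mul_nonneg hC0 hlog0.le
          have h8 := mul_nonneg h7 hP0
          linarith
      _ ≤ _ := by linarith
  · have : (w : ℝ) ≤ C * S := by exact_mod_cast (h4 w hw).2
    calc (w : ℝ) ≤ C * ((P + 2) * (T * φ)) := this.trans (by gcongr)
      _ ≤ C * (5 * (P + 2)) * (T * φ) := by
          nlinarith [mul_nonneg (mul_nonneg hC0 (by linarith : 0 ≤ P + 2))
            (by linarith : (0 : ℝ) ≤ T * φ)]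
      _ ≤ _ := by linarith
  · have : (net.nnz : ℝ) ≤ C * ((N + 1) * S) := by exact_mod_cast h6
    calc (net.nnz : ℝ) ≤ C * ((5 * Real.log T) * ((P + 2) * (T * φ))) := this.trans (by gcongr)
      _ = C * (5 * (P + 2)) * (Real.log T * (T * φ)) := by ring
      _ ≤ _ := by
          have : 0 ≤ Real.log T * (T * φ) := by positivity
          linarith

end Rate

end SparseDNN

namespace SparseDNN

/-! ### Size of the covering parameters and collection of the error terms. -/

section Parameters

/-- The parameters of the covering family are of logarithmic order. -/
lemma exists_covering_parameters {L N B : ℕ → ℝ} {r : ℝ} (hr : 1 < r)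
    (hL : SameOrder L fun T => Real.log T ^ r) (hN : SameOrder N fun T => (T : ℝ))
    (hB : ∃ C_B ν₂ : ℝ, 0 < C_B ∧ 0 < ν₂ ∧
      ∀ᶠ T : ℕ in atTop, 1 ≤ B T ∧ B T ≤ C_B * (T : ℝ) ^ ν₂) :
    ∃ C : ℝ, 0 < C ∧ ∀ᶠ T : ℕ in atTop, ∃ δ K K₀ : ℝ, 0 < δ ∧ 0 ≤ K ∧
      K ≤ C * Real.log T ^ (1 + r) ∧ 0 ≤ K₀ ∧ K₀ ≤ C * Real.log T ^ (1 + r) ∧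
      δ * (L T + 1) * ((N T + 1) * B T) ^ (L T + 1) ≤ (T : ℝ)⁻¹ ∧
      2 * (B T / δ + 1) * ((L T + 1) * (N T + 1) ^ 2) ≤ Real.exp K ∧
      (L T + 1) * (N T + 1) ^ L T * Real.exp 1 ≤ Real.exp K₀ := by
  obtain ⟨c₁, c₂, hc₁, hc₂, hL⟩ := hL
  obtain ⟨n₁, n₂, hn₁, hn₂, hN⟩ := hN
  obtain ⟨C_B, ν₂, hCB, hν₂, hB⟩ := hB
  set cN := Real.log (n₂ + 1) + 1 with hcN
  have hcN0 : 0 ≤ cN := by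
    have := Real.log_nonneg (by linarith : (1 : ℝ) ≤ n₂ + 1)
    linarith
  set cB := |Real.log C_B| + ν₂ with hcB
  have hcB0 : 0 ≤ cB := by positivity
  refine ⟨4 + cB + 2 * c₂ + (c₂ + 1) * (cN + cB) + 2 * cN, by positivity, ?_⟩
  have hlogT : ∀ᶠ T : ℕ in atTop, 1 ≤ Real.log T :=
    (Real.tendsto_log_atTop.comp tendsto_natCast_atTop_atTop).eventually_ge_atTop 1
  filter_upwards [hL, hN, hB, hlogT, eventually_ge_atTop 1] with T hL hN hB hx hT
  obtain ⟨hL1, hL2⟩ := hL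
  obtain ⟨hN1, hN2⟩ := hN
  obtain ⟨hB1, hB2⟩ := hB
  have hT1 : (1 : ℝ) ≤ T := by exact_mod_cast hT
  have hT0 : (0 : ℝ) < T := by linarith
  set x := Real.log T with hxdef
  have hx0 : 0 < x := by linarith
  set y := x ^ (1 + r) with hy
  have hy1 : 1 ≤ y := Real.one_le_rpow hx (by linarith)
  have hxr1 : 1 ≤ x ^ r := Real.one_le_rpow hx (by linarith)
  have hxy : x ^ r * x = y := by rw [hy, add_comm, Real.rpow_add_one hx0.ne']
  have hxry : x ^ r ≤ y := by rw [← hxy]; nlinarith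
  have hxle : x ≤ y := by rw [← hxy]; nlinarith
  have hL0 : 0 ≤ L T := le_trans (by positivity) hL1
  have hN0 : 0 ≤ N T := le_trans (by positivity) hN1
  have hB0 : 0 < B T := by linarith
  have hlogN : Real.log (N T + 1) ≤ cN * x := by
    calc Real.log (N T + 1) ≤ Real.log ((n₂ + 1) * T) :=
          Real.log_le_log (by linarith) (by nlinarith)
      _ = Real.log (n₂ + 1) + x := Real.log_mul (by positivity) hT0.ne'
      _ ≤ cN * x := by
          have := Real.log_nonneg (by linarith : (1 : ℝ) ≤ n₂ + 1)
          rw [hcN]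
          nlinarith
  have hlogN0 : 0 ≤ Real.log (N T + 1) := Real.log_nonneg (by linarith)
  have hlogB : Real.log (B T) ≤ cB * x := by
    calc Real.log (B T) ≤ Real.log (C_B * (T : ℝ) ^ ν₂) := Real.log_le_log hB0 hB2
      _ = Real.log C_B + ν₂ * x := by
          rw [Real.log_mul hCB.ne' (by positivity), Real.log_rpow hT0]
      _ ≤ cB * x := by
          have h1 := le_abs_self (Real.log C_B)
          have h2 := abs_nonneg (Real.log C_B)
          rw [hcB]
          nlinarith
  have hlogB0 : 0 ≤ Real.log (B T) := Real.log_nonneg hB1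
  have hlogL : Real.log (L T + 1) ≤ c₂ * y := by
    have h1 := Real.log_le_sub_one_of_pos (by linarith : 0 < L T + 1)
    have h2 : c₂ * x ^ r ≤ c₂ * y := by gcongr
    linarith
  have hlogL0 : 0 ≤ Real.log (L T + 1) := Real.log_nonneg (by linarith)
  -- The dominating term: the exponent L + 1, of order log^r T, times log((N + 1) B), of order log T
  -- because N and B grow at most polynomially.
  have hprod : (L T + 1) * (Real.log (N T + 1) + Real.log (B T)) ≤ (c₂ + 1) * (cN + cB) * y := by
    calc _ ≤ ((c₂ + 1) * x ^ r) * ((cN + cB) * x) := by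
          refine mul_le_mul (by nlinarith) (by linarith) (by positivity) (by positivity)
      _ = _ := by rw [← hxy]; ring
  have hprod0 : 0 ≤ (c₂ + 1) * (cN + cB) := by positivity
  have hLN : L T * Real.log (N T + 1) ≤ (c₂ + 1) * (cN + cB) * y := by
    refine le_trans ?_ hprod
    refine mul_le_mul (by linarith) (by linarith) hlogN0 (by linarith)
  clear_value cN cB
  have hcNy : cN * x ≤ cN * y := by gcongr
  have hcBy : cB * x ≤ cB * y := by gcongr
  set Q := ((N T + 1) * B T) ^ (L T + 1) with hQ
  have hNB : 1 ≤ (N T + 1) * B T := by nlinarith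
  have hQ1 : 1 ≤ Q := Real.one_le_rpow hNB (by linarith)
  have hP0 : 0 < (T : ℝ) * (L T + 1) * Q := by positivity
  set V := 2 * (B T * (T * (L T + 1) * Q) + 1) * ((L T + 1) * (N T + 1) ^ 2) with hV
  have hP1 : 1 ≤ B T * (T * (L T + 1) * Q) := by
    refine one_le_mul_of_one_le_of_one_le hB1 (one_le_mul_of_one_le_of_one_le
      (one_le_mul_of_one_le_of_one_le hT1 (by linarith)) hQ1)
  have hV1 : 1 ≤ V := by
    refine one_le_mul_of_one_le_of_one_le (by linarith) (one_le_mul_of_one_le_of_one_le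
      (by linarith) (one_le_pow₀ (by linarith)))
  -- The step δ makes the perturbation bound equal to 1/T; K and K₀ are then the logarithms of the
  -- quantities they have to dominate.
  refine ⟨(T * (L T + 1) * Q)⁻¹, Real.log V, Real.log (L T + 1) + L T * Real.log (N T + 1) + 1,
    inv_pos.2 hP0, Real.log_nonneg hV1, ?_, by positivity, ?_, ?_, ?_, ?_⟩
  · have h1 : V ≤ 4 * (B T * (T * (L T + 1) * Q)) * ((L T + 1) * (N T + 1) ^ 2) := by
      rw [hV]
      exact mul_le_mul_of_nonneg_right (by linarith) (by positivity)
    clear_value V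
    have h2 := Real.log_le_log (by linarith) h1
    have hL' : L T + 1 ≠ 0 := by linarith
    have hN' : N T + 1 ≠ 0 := by linarith
    rw [Real.log_mul (by positivity) (by positivity), Real.log_mul (by norm_num) (by positivity),
      Real.log_mul hB0.ne' (by positivity), Real.log_mul (by positivity) (by positivity),
      Real.log_mul hT0.ne' hL', Real.log_mul hL' (by positivity), Real.log_pow, hQ,
      Real.log_rpow (by positivity), Real.log_mul hN' hB0.ne'] at h2
    have h4 := Real.log_le_sub_one_of_pos (by norm_num : (0 : ℝ) < 4)
    push_cast at h2
    refine h2.trans ?_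
    have e : (4 + cB + 2 * c₂ + (c₂ + 1) * (cN + cB) + 2 * cN) * y =
      4 * y + cB * y + 2 * (c₂ * y) + (c₂ + 1) * (cN + cB) * y + 2 * (cN * y) := by ring
    rw [e]
    linarith
  · have h3 : 0 ≤ cB * y := by positivity
    have h4 : 0 ≤ cN * y := by positivity
    have h5 : 0 ≤ c₂ * y := by positivity
    have e : (4 + cB + 2 * c₂ + (c₂ + 1) * (cN + cB) + 2 * cN) * y =
      4 * y + cB * y + 2 * (c₂ * y) + (c₂ + 1) * (cN + cB) * y + 2 * (cN * y) := by ring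
    rw [e]
    linarith
  · refine le_of_eq ?_
    field_simp
  · rw [Real.exp_log (by linarith : 0 < V), div_inv_eq_mul]
  · rw [Real.exp_add, Real.exp_add, Real.exp_log (by linarith : 0 < L T + 1),
      Real.rpow_def_of_pos (by linarith : 0 < N T + 1), mul_comm (L T)]

/-- The terms of the oracle inequality are of the order of the rate. -/
lemma risk_bound_le {F Cn Cp Cε b μ d T φ a K₀ P : ℝ} (hF : 0 < F) (hCn : 0 < Cn) (hCp : 0 ≤ Cp)
    (hCε : 0 ≤ Cε) (hb : 0 < b) (hμ : 0 ≤ μ) (hd : 0 ≤ d) (hT : 0 < T) (hφ : 0 ≤ φ) (hφa : φ ≤ a)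
    (hTa : T⁻¹ ≤ a) (hP : P ≤ F ^ 2 * Cn * (T * a)) (hK₀ : K₀ ≤ Cp * (T * a)) :
    4 * F ^ 2 * d / T + 4 * F ^ 2 * ((1 + μ) / T) + 1 / (b * T) * (3 * T * (Cn * √φ) ^ 2 + P + 1 +
      8 * (3 * F) ^ 2 * (1 + K₀) + 16 * F * T * (Cε * T⁻¹)) ≤
    (4 * F ^ 2 * d + 4 * F ^ 2 * (1 + μ) + 1 / b * (3 * Cn ^ 2 + F ^ 2 * Cn + 1 +
      72 * F ^ 2 * (1 + Cp) + 16 * F * Cε)) * a := by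
  have ha : 0 ≤ a := hφ.trans hφa
  have h1T : 1 ≤ T * a := by
    rw [inv_eq_one_div, div_le_iff₀ hT] at hTa
    linarith
  have e1 : 3 * T * (Cn * √φ) ^ 2 ≤ 3 * Cn ^ 2 * (T * a) := by
    rw [mul_pow, Real.sq_sqrt hφ]
    calc 3 * T * (Cn ^ 2 * φ) = 3 * Cn ^ 2 * (T * φ) := by ring
      _ ≤ _ := by gcongr
  have e2 : 8 * (3 * F) ^ 2 * (1 + K₀) ≤ 72 * F ^ 2 * (1 + Cp) * (T * a) := by
    have h1 : 1 + K₀ ≤ (1 + Cp) * (T * a) := by linarith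
    calc _ = 72 * F ^ 2 * (1 + K₀) := by ring
      _ ≤ 72 * F ^ 2 * ((1 + Cp) * (T * a)) := by gcongr
      _ = _ := by ring
  have e3 : 16 * F * T * (Cε * T⁻¹) ≤ 16 * F * Cε * (T * a) := by
    calc _ = 16 * F * Cε * 1 := by field_simp
      _ ≤ _ := by gcongr
  have hinner : 3 * T * (Cn * √φ) ^ 2 + P + 1 + 8 * (3 * F) ^ 2 * (1 + K₀) +
      16 * F * T * (Cε * T⁻¹) ≤
      (3 * Cn ^ 2 + F ^ 2 * Cn + 1 + 72 * F ^ 2 * (1 + Cp) + 16 * F * Cε) * (T * a) := by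
    linarith
  have hout : ∀ z : ℝ, 0 ≤ z → z / T ≤ z * a := fun z hz => by
    rw [div_eq_mul_inv]
    gcongr
  have e4 := hout (4 * F ^ 2 * d) (by positivity)
  have e5 := hout (4 * F ^ 2 * (1 + μ)) (by positivity)
  have e6 : 1 / (b * T) * (3 * T * (Cn * √φ) ^ 2 + P + 1 +
      8 * (3 * F) ^ 2 * (1 + K₀) + 16 * F * T * (Cε * T⁻¹)) ≤
      1 / b * (3 * Cn ^ 2 + F ^ 2 * Cn + 1 + 72 * F ^ 2 * (1 + Cp) + 16 * F * Cε) * a := by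
    calc _ ≤ 1 / (b * T) * ((3 * Cn ^ 2 + F ^ 2 * Cn + 1 + 72 * F ^ 2 * (1 + Cp) + 16 * F * Cε) *
          (T * a)) := by gcongr
      _ = _ := by field_simp
  have e7 : 4 * F ^ 2 * ((1 + μ) / T) = 4 * F ^ 2 * (1 + μ) / T := by ring
  rw [e7, add_mul, add_mul]
  exact add_le_add (add_le_add e4 e5) e6

end Parameters

end SparseDNN
-- The rate, uniformly over the class of mean functions.
theorem mainTheorem2
    -- the class of mean functions
    {d : ℕ} (c₀ : ℝ) (c : Fin d → ℝ) (hc₀ : 0 < c₀) (hc : ∀ i, 0 < c i) (hcsum : ∑ i, c i < 1)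
    (q : ℕ) (D t : ℕ → ℕ) (hD0 : D 0 = d) (hDq : D (q + 1) = 1)
    (ht : ∀ i ≤ q, 1 ≤ t i ∧ t i ≤ D i)
    (β : ℕ → ℝ) (hβ : ∀ i ≤ q, 0 < β i) (A : ℝ) (hA : 0 < A)
    -- the initial distribution
    (ν : Measure (Fin d → ℝ)) [IsProbabilityMeasure ν] (hν : Integrable (fun x => ‖x‖) ν)
    -- the tuning parameters
    (F : ℝ) (hF : max 1 A ≤ F) (r : ℝ) (hr : 1 < r)
    (L N B lam τ : ℕ → ℝ) (ι : ℝ → ℝ)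
    (hL : SameOrder L (fun T => Real.log T ^ r))
    (hN : SameOrder N (fun T => (T : ℝ)))
    (hB : ∃ C_B ν₂ : ℝ, 0 < C_B ∧ 0 < ν₂ ∧
      ∀ᶠ T : ℕ in atTop, 1 ≤ B T ∧ B T ≤ C_B * (T : ℝ) ^ ν₂)
    (hι_mono : StrictMonoOn ι (Set.Ici 1))
    (hι_lim : Tendsto (fun x => ι x / Real.log x) atTop atTop)
    (hlam : ∀ᶠ T : ℕ in atTop, lam T = F ^ 2 * ι T * Real.log T ^ (2 + r) / T)
    (hτ : ∃ C_τ : ℝ, 0 < C_τ ∧ ∀ᶠ T : ℕ in atTop, 0 < τ T ∧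
      τ T * (L T + 1) * ((N T + 1) * B T) ^ (L T + 1) ≤ C_τ * (T : ℝ)⁻¹)
    -- the estimators
    (fhat : ∀ T : ℕ, Sample d T → (Fin d → ℝ) → ℝ)
    (hfhat : ∀ᶠ T : ℕ in atTop,
      IsSparsePenalizedEstimator (L T) (N T) (B T) F (lam T) (τ T) (fhat T)) :
    ∃ C : ℝ, 0 < C ∧ ∀ᶠ T : ℕ in atTop,
      (⨆ m ∈ meanClass c₀ c q D t hD0 β A, genError ν m T (fhat T)) ≤
        ENNReal.ofReal (C * (phiRate q t β T * ι T * Real.log T ^ (3 + r))) := by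
  have hd : 0 < d := by
    have := ht 0 (Nat.zero_le q)
    omega
  have hF1 : 1 ≤ F := (le_max_left _ _).trans hF
  have hAF : A ≤ F := (le_max_right _ _).trans hF
  obtain ⟨R, hR1, hR⟩ := exists_radius hc₀ hc hcsum hd
  obtain ⟨κ, hκ0, hκ1, hκ⟩ := exists_density_lower_bound c₀ hc hcsum R hR1
  obtain ⟨Cn, hCn, hnet⟩ := exists_net_phiRate hd hD0 hDq hβ (fun i hi => (ht i hi).1) hA.le hAF hF1
  obtain ⟨Cp, hCp, hpar⟩ := exists_covering_parameters hr hL hN hB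
  obtain ⟨c₁, c₂, hc₁, hc₂, hL⟩ := hL
  obtain ⟨n₁, n₂, hn₁, hn₂, hN⟩ := hN
  obtain ⟨C_B, ν₂, hCB, hν₂, hB⟩ := hB
  obtain ⟨C_τ, hCτ, hτ⟩ := hτ
  set Cε := max C_τ 1 with hCε
  have hCε1 : 1 ≤ Cε := le_max_right _ _
  set b : ℝ := κ ^ d / (16 * d) with hb
  have hd' : (0 : ℝ) < d := Nat.cast_pos.2 hd
  have hb0 : 0 < b := by positivity
  set μ := ∫ x, ‖x‖ ∂ν with hμ
  have hμ0 : 0 ≤ μ := integral_nonneg fun x => norm_nonneg x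
  have hlogT : Tendsto (fun T : ℕ => Real.log T) atTop atTop :=
    Real.tendsto_log_atTop.comp tendsto_natCast_atTop_atTop
  -- The approximating network has depth O(log T), which fits below L_T of order log^r T because r >
  -- 1.
  have hdepth : ∀ᶠ T : ℕ in atTop, Cn / c₁ ≤ Real.log T ^ (r - 1) :=
    ((tendsto_rpow_atTop (by linarith)).comp hlogT).eventually_ge_atTop _
  have hι : ∀ᶠ T : ℕ in atTop, 72 * Cp + 1 ≤ ι T / Real.log T :=
    (hι_lim.comp tendsto_natCast_atTop_atTop).eventually_ge_atTop _
  -- The approximating network has width O(T φ_T), which fits below N_T of order T because φ_T tends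
  -- to zero.
  have hφ : ∀ᶠ T : ℕ in atTop, phiRate q t β T < n₁ / Cn :=
    (tendsto_phiRate hβ).eventually_lt_const (by positivity)
  have hTd : ∀ᶠ T : ℕ in atTop, (d : ℝ) / n₁ ≤ T :=
    tendsto_natCast_atTop_atTop.eventually_ge_atTop _
  have hTε : ∀ᶠ T : ℕ in atTop, Cε ≤ T := tendsto_natCast_atTop_atTop.eventually_ge_atTop _
  refine ⟨4 * F ^ 2 * d + 4 * F ^ 2 * (1 + μ) + 1 / b * (3 * Cn ^ 2 + F ^ 2 * Cn + 1 +
    72 * F ^ 2 * (1 + Cp) + 16 * F * Cε), by positivity, ?_⟩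
  filter_upwards [hL, hN, hB, hτ, hlam, hfhat, hpar, hdepth, hι, hφ, hTd, hTε,
    hlogT.eventually_ge_atTop 1, eventually_ge_atTop (2 + 2 * d)] with
    T hL hN hB hτ hlam hfhat hpar hdepth hι hφ hTd hTε hx hT
  obtain ⟨δ, K, K₀, hδ0, hK0, hK, hK₀0, hK₀, hδ, hKV, hK₀V⟩ := hpar
  have hT1 : 1 ≤ T := by omega
  have hT0 : (0 : ℝ) < T := by exact_mod_cast hT1
  set x := Real.log T with hxdef
  have hx0 : 0 < x := by linarith
  set φ := phiRate q t β T with hφdef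
  have hφT : (T : ℝ)⁻¹ ≤ φ := inv_le_phiRate hβ hT1
  have hφ0 : 0 < φ := (inv_pos.2 hT0).trans_le hφT
  have hιx : (72 * Cp + 1) * x ≤ ι T := by rwa [le_div_iff₀ hx0] at hι
  have hCpι : 72 * Cp + 1 ≤ ι T := (le_mul_of_one_le_right (by positivity) hx).trans hιx
  have hι1 : 1 ≤ ι T := by linarith
  have hx3 : x ^ (2 + r) * x = x ^ (3 + r) := by
    rw [← Real.rpow_add_one hx0.ne']
    ring_nf
  have hx31 : 1 ≤ x ^ (3 + r) := Real.one_le_rpow hx (by linarith)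
  have hx13 : x ^ (1 + r) ≤ x ^ (3 + r) := Real.rpow_le_rpow_of_exponent_le hx (by linarith)
  have hx12 : x ^ (1 + r) ≤ x ^ (2 + r) := Real.rpow_le_rpow_of_exponent_le hx (by linarith)
  set a := φ * ι T * x ^ (3 + r) with ha
  have hφa : φ ≤ a := by
    rw [ha, mul_assoc]
    exact le_mul_of_one_le_right hφ0.le (one_le_mul_of_one_le_of_one_le hι1 hx31)
  have hTa : (T : ℝ)⁻¹ ≤ a := hφT.trans hφa
  have ha0 : 0 < a := hφ0.trans_le hφa
  have hya : x ^ (1 + r) * (T : ℝ)⁻¹ ≤ a := by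
    calc x ^ (1 + r) * (T : ℝ)⁻¹ ≤ x ^ (3 + r) * φ := by gcongr
      _ ≤ x ^ (3 + r) * φ * ι T := le_mul_of_one_le_right (by positivity) hι1
      _ = a := by rw [ha]; ring
  have hL0 : 0 ≤ L T := le_trans (by positivity) hL.1
  have hN0 : 0 ≤ N T := le_trans (by positivity) hN.1
  have hTlam : T * lam T = F ^ 2 * ι T * x ^ (2 + r) := by
    rw [hlam]
    field_simp
  have hlam0 : 0 ≤ lam T := by
    rw [hlam]
    positivity
  have hdN : (d : ℝ) ≤ N T := by
    rw [div_le_iff₀ hn₁] at hTd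
    linarith [hN.1]
  have hε : max (τ T) δ * (L T + 1) * ((N T + 1) * B T) ^ (L T + 1) ≤ Cε * (T : ℝ)⁻¹ := by
    have h1 : C_τ * (T : ℝ)⁻¹ ≤ Cε * (T : ℝ)⁻¹ := by
      gcongr
      exact le_max_left _ _
    have h2 : 1 * (T : ℝ)⁻¹ ≤ Cε * (T : ℝ)⁻¹ := by gcongr
    rcases max_cases (τ T) δ with ⟨h, -⟩ | ⟨h, -⟩ <;> rw [h] <;> linarith [hτ.2]
  have hε1 : Cε * (T : ℝ)⁻¹ ≤ 1 := by
    rw [← div_eq_mul_inv, div_le_one hT0]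
    exact hTε
  obtain ⟨J, hJ, ψ, w, hψm, hψF, hw0, hw1, hcover⟩ := exists_covering_family (F := F) hL0 hdN hB.1
    hτ.1 hδ0 hK0 hε hε1 hKV hK₀V
  -- The number 72 is 8 · 3². Since K is of order log^(1+r) T, the lower bound on ι lets T lam_T
  -- cover it.
  have hKlam : K ≤ 1 / (8 * (3 * F) ^ 2) * (T * lam T) := by
    have e : 1 / (8 * (3 * F) ^ 2) * (T * lam T) = ι T * x ^ (2 + r) / 72 := by
      rw [hTlam]
      field_simp
      norm_num
    rw [e, le_div_iff₀ (by norm_num)]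
    have h1 : 72 * Cp ≤ ι T := by linarith
    calc K * 72 ≤ 72 * Cp * x ^ (1 + r) := by linarith
      _ ≤ ι T * x ^ (2 + r) := by gcongr
  -- Everything so far, including the covering family, is independent of m, so the bound is uniform
  -- over the class.
  refine iSup₂_le fun m hm => ?_
  obtain ⟨hmF, hnet⟩ := hnet m hm.2
  obtain ⟨f, hf, hf1, hf2, hf3, hf4, hf5⟩ := hnet T hT1 hx
  have hfclass : f ∈ netClass d (L T) (N T) (B T) F := by
    refine ⟨hf1, hf2.trans (le_trans ?_ hL.1), fun w hw => ⟨(hf3 w hw).1, (hf3 w hw).2.trans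
      (le_trans ?_ hN.1)⟩, fun θ hθ => (hf4 θ hθ).trans hB.1, fun y hy => (hf y hy).1⟩
    · have e : x ^ r = x ^ (r - 1) * x := by
        rw [← Real.rpow_add_one hx0.ne']
        ring_nf
      rw [div_le_iff₀ hc₁] at hdepth
      calc Cn * x ≤ x ^ (r - 1) * c₁ * x := by gcongr
        _ = c₁ * x ^ r := by rw [e]; ring
    · rw [lt_div_iff₀ hCn] at hφ
      calc Cn * (T * φ) = φ * Cn * T := by ring
        _ ≤ n₁ * T := by gcongr
  refine (genError_le_of_family ν hν hm.1.1 hd hF1 hmF hR1 hκ0 hκ1 (hκ m hm.1) hT1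
    (hR m hm.1 T hT) hτ.1 hlam0 hfhat hψm hψF hw0 hw1 hK₀0 (by positivity) hKlam hcover hfclass
    fun y hy => (hf y hy).2).trans (ENNReal.ofReal_le_ofReal ?_)
  -- The penalty of the approximating network is what determines the rate: log^(2+r) T from lam and
  -- one more logarithm from the number of nonzero parameters.
  have hclip : T * lam T * f.clipNorm (τ T) ≤ F ^ 2 * Cn * (T * a) := by
    have h1 := (f.clipNorm_le_nnz (τ T)).trans hf5
    rw [hTlam]
    calc _ ≤ F ^ 2 * ι T * x ^ (2 + r) * (Cn * (x * (T * φ))) := by gcongr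
      _ = F ^ 2 * Cn * (T * (φ * ι T * (x ^ (2 + r) * x))) := by ring
      _ = _ := by rw [hx3]
  have hyT : x ^ (1 + r) ≤ T * a := by
    rw [← div_eq_mul_inv, div_le_iff₀ hT0] at hya
    linarith
  exact risk_bound_le (by linarith) hCn hCp.le (by linarith) hb0 hμ0 hd'.le hT0 hφ0.le hφa hTa
    hclip (hK₀.trans (by gcongr))
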